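/- Let $n\ge 3$ and let $(M^n,g)$ be a closed (compact, without boundary) smooth Riemannian manifold with positive scalar curvature $R>0$. Let $t\in\mathbb R$ satisfy $$t<-\tfrac{5}{12}\ \text{ if } n=3,\qquad t<-\tfrac13\ \text{ if } n=4,\qquad t\le -\tfrac{n}{4(n-1)}\ \text{ if } n\ge 5,$$ and suppose that $g$ is a critical point of $$\mathcal F_t(g)=\int_M|\mathrm{Ric}|^2\,dv_g+t\int_M R^2\,dv_g$$ on the space of smooth Riemannian metrics of volume one on $M$; that is, $g$ has volume one and $\frac{d}{ds}\big|_{s=0}\mathcal F_t(g_s)=0$ for every smooth one-parameter family $(g_s)$ of metrics of volume one with $g_0=g$. Write $R_{ijkl}$ for the curvature tensor (with the sign for which the unit sphere has $R_{ijkl}=g_{ik}g_{jl}-g_{il}g_{jk}$), $R_{ik}=g^{jl}R_{ijkl}$, $\mathring{\mathrm{Ric}}=\mathrm{Ric}-\frac Rn g$, $$(A\odot B)_{ijkl}=A_{ik}B_{jl}-A_{il}B_{jk}+A_{jl}B_{ik}-A_{jk}B_{il}$$ for the Kulkarni–Nomizu product of symmetric 2-tensors, and $$W_{ijkl}=R_{ijkl}-\tfrac1{n-2}(\mathrm{Ric}\odot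 g)_{ijkl}+\tfrac{R}{(n-1)(n-2)}(g_{ik}g_{jl}-g_{il}g_{jk})$$ for the Weyl tensor; norms are full tensor norms, $|T|^2=g^{ia}g^{jb}g^{kc}g^{ld}T_{ijkl}T_{abcd}$ and $|A|^2=g^{ia}g^{jb}A_{ij}A_{ab}$. Suppose that at every point of $M$ $$\Big|W-\frac{n-4}{\sqrt{2n}\,(n-2)}\,\mathring{\mathrm{Ric}}\odot g\Big|<-\sqrt{\frac{2}{(n-1)(n-2)}}\left(\frac{2(n-2)+2n(n-1)t}{n}+1\right)R .$$ Then $g$ is Einstein: $\mathrm{Ric}=c\,g$ with $c$ constant on each connected component of $M$ (hence a constant if $M$ is connected). -/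

import Mathlib

open scoped Manifold ContDiff
open MeasureTheory

noncomputable section

namespace QuadCurv

/-! ### Curvature of a metric given in coordinates

`G y` is the matrix `(g_ij)` of a metric at the point `y` of a coordinate domain in `ℝⁿ`. -/

section Coordinates

variable {n : ℕ}

/-- The partial derivative `∂_i f` at `y`. -/
def partialDeriv (i : Fin n) (f : EuclideanSpace ℝ (Fin n) → ℝ) (y : EuclideanSpace ℝ (Fin n)) : ℝ :=
  fderiv ℝ f y (EuclideanSpace.single i 1)

/-- The Christoffel symbol `Γ^k_ij`. -/
def christoffel (G : EuclideanSpace ℝ (Fin n) → Matrix (Fin n) (Fin n) ℝ) (k i j : Fin n)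
    (y : EuclideanSpace ℝ (Fin n)) : ℝ :=
  (1 / 2) * ∑ l, (G y)⁻¹ k l *
    (partialDeriv i (fun z => G z j l) y + partialDeriv j (fun z => G z i l) y
      - partialDeriv l (fun z => G z i j) y)

/-- The curvature tensor `R_ijkl = g(R(∂_i, ∂_j) ∂_l, ∂_k)`, where
`R(X, Y) Z = ∇_X ∇_Y Z - ∇_Y ∇_X Z - ∇_[X,Y] Z`. With this convention the unit sphere has
`R_ijkl = g_ik g_jl - g_il g_jk`. -/
def riemann (G : EuclideanSpace ℝ (Fin n) → Matrix (Fin n) (Fin n) ℝ)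
    (y : EuclideanSpace ℝ (Fin n)) (i j k l : Fin n) : ℝ :=
  ∑ m, G y k m *
    (partialDeriv i (christoffel G m j l) y - partialDeriv j (christoffel G m i l) y
      + ∑ p, (christoffel G m i p y * christoffel G p j l y
        - christoffel G m j p y * christoffel G p i l y))

/-- The Ricci tensor `R_ik = g^{jl} R_ijkl`. -/
def ricci (G : EuclideanSpace ℝ (Fin n) → Matrix (Fin n) (Fin n) ℝ)
    (y : EuclideanSpace ℝ (Fin n)) (i k : Fin n) : ℝ :=
  ∑ j, ∑ l, (G y)⁻¹ j l * riemann G y i j k l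

/-- The scalar curvature `R = g^{ik} R_ik`. -/
def scalar (G : EuclideanSpace ℝ (Fin n) → Matrix (Fin n) (Fin n) ℝ)
    (y : EuclideanSpace ℝ (Fin n)) : ℝ :=
  ∑ i, ∑ k, (G y)⁻¹ i k * ricci G y i k

/-- The Kulkarni–Nomizu product of two symmetric 2-tensors at a point. -/
def kulkarniNomizu (A B : Fin n → Fin n → ℝ) (i j k l : Fin n) : ℝ :=
  A i k * B j l - A i l * B j k + A j l * B i k - A j k * B i l

/-- The squared norm `g^{ia} g^{jb} T_ij T_ab` of a 2-tensor at a point where the metric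
has the matrix `g`. -/
def normSq₂ (g : Matrix (Fin n) (Fin n) ℝ) (T : Fin n → Fin n → ℝ) : ℝ :=
  ∑ i, ∑ j, ∑ a, ∑ b, g⁻¹ i a * g⁻¹ j b * T i j * T a b

/-- The squared norm `g^{ia} g^{jb} g^{kc} g^{ld} T_ijkl T_abcd` of a 4-tensor at a point where
the metric has the matrix `g`. -/
def normSq₄ (g : Matrix (Fin n) (Fin n) ℝ) (T : Fin n → Fin n → Fin n → Fin n → ℝ) : ℝ :=
  ∑ i, ∑ j, ∑ k, ∑ l, ∑ a, ∑ b, ∑ c, ∑ d,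
    g⁻¹ i a * g⁻¹ j b * g⁻¹ k c * g⁻¹ l d * T i j k l * T a b c d

end Coordinates

/-! ### Riemannian metrics on a manifold -/

section Manifold

variable {n : ℕ} {M : Type*} [TopologicalSpace M] [ChartedSpace (EuclideanSpace ℝ (Fin n)) M]
  [IsManifold (𝓡 n) ∞ M]

variable (n M) in
/-- Smooth Riemannian metrics on the tangent bundle of `M`. -/
abbrev Metric : Type _ :=
  Bundle.ContMDiffRiemannianMetric (𝓡 n) ∞ (EuclideanSpace ℝ (Fin n))
    (fun x : M => TangentSpace (𝓡 n) x)

/-- The coordinate vector field `∂_i` of the preferred chart at `x`, at the point with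
coordinates `y`. -/
def coordVector (x : M) (i : Fin n) (y : EuclideanSpace ℝ (Fin n)) :
    TangentSpace (𝓡 n) ((chartAt (EuclideanSpace ℝ (Fin n)) x).symm y) :=
  mfderiv (𝓡 n) (𝓡 n) (chartAt (EuclideanSpace ℝ (Fin n)) x).symm y
    (EuclideanSpace.single i (1 : ℝ) : EuclideanSpace ℝ (Fin n))

/-- The coefficients `g_ij = g(∂_i, ∂_j)` of `g` in the preferred chart at `x`. -/
def coordMetric (g : Metric n M) (x : M) (y : EuclideanSpace ℝ (Fin n)) :
    Matrix (Fin n) (Fin n) ℝ :=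
  Matrix.of fun i j =>
    g.inner ((chartAt (EuclideanSpace ℝ (Fin n)) x).symm y) (coordVector x i y) (coordVector x j y)

/-- The coordinates of `x` in its preferred chart. -/
def coordPoint (n : ℕ) {M : Type*} [TopologicalSpace M]
    [ChartedSpace (EuclideanSpace ℝ (Fin n)) M] (x : M) : EuclideanSpace ℝ (Fin n) :=
  chartAt (EuclideanSpace ℝ (Fin n)) x x

/-! Below, the components of a tensor at `x` are those in the preferred chart at `x`. -/

/-- The components of `g` at `x`. -/
def metricAt (g : Metric n M) (x : M) : Matrix (Fin n) (Fin n) ℝ :=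
  coordMetric g x (coordPoint n x)

/-- The components of the curvature tensor at `x`. -/
def riemannAt (g : Metric n M) (x : M) : Fin n → Fin n → Fin n → Fin n → ℝ :=
  riemann (coordMetric g x) (coordPoint n x)

/-- The components of the Ricci tensor at `x`. -/
def ricciAt (g : Metric n M) (x : M) : Fin n → Fin n → ℝ :=
  ricci (coordMetric g x) (coordPoint n x)

/-- The scalar curvature. -/
def scalarCurvature (g : Metric n M) (x : M) : ℝ :=
  scalar (coordMetric g x) (coordPoint n x)

/-- The components of the trace-free Ricci tensor `Ric - (R / n) g` at `x`. -/
def tracelessRicciAt (g : Metric n M) (x : M) (i j : Fin n) : ℝ :=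
  ricciAt g x i j - scalarCurvature g x / n * metricAt g x i j

/-- The components of the Weyl tensor at `x`:
`W = Rm - 1/(n-2) Ric ∧ g + R/((n-1)(n-2)) (g_ik g_jl - g_il g_jk)`. -/
def weylAt (g : Metric n M) (x : M) (i j k l : Fin n) : ℝ :=
  riemannAt g x i j k l
    - 1 / ((n : ℝ) - 2) * kulkarniNomizu (ricciAt g x) (metricAt g x) i j k l
    + scalarCurvature g x / (((n : ℝ) - 1) * ((n : ℝ) - 2)) *
      (metricAt g x i k * metricAt g x j l - metricAt g x i l * metricAt g x j k)

/-- `g` is Einstein: `Ric = c g`, with `c` constant on every connected component of `M`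
(so a constant if `M` is connected). -/
def IsEinstein (g : Metric n M) : Prop :=
  ∃ c : M → ℝ, IsLocallyConstant c ∧ ∀ x i j, ricciAt g x i j = c x * metricAt g x i j

variable [MeasurableSpace M]

/-- The measure `√(det g_ij) dy` of the preferred chart at `x`, carried to `M`; it lives on the
domain of that chart. -/
def chartVolume (g : Metric n M) (x : M) : Measure M :=
  Measure.map (chartAt (EuclideanSpace ℝ (Fin n)) x).symm
    ((volume.restrict (chartAt (EuclideanSpace ℝ (Fin n)) x).target).withDensity
      fun y => ENNReal.ofReal (Real.sqrt (coordMetric g x y).det))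

/-- The Riemannian volume measure. The measures `chartVolume g x` agree on the overlaps of the
chart domains, so their supremum is the unique measure that restricts to `chartVolume g x` on the
domain of the chart at `x`, for every `x`, when `M` is second countable. -/
def riemannianVolume (g : Metric n M) : Measure M :=
  ⨆ x : M, chartVolume g x

/-- The functional `F_t(g) = ∫ |Ric|² + t ∫ R²`. -/
def functional (t : ℝ) (g : Metric n M) : ℝ :=
  ∫ x, normSq₂ (metricAt g x) (ricciAt g x) ∂(riemannianVolume g)
    + t * ∫ x, scalarCurvature g x ^ 2 ∂(riemannianVolume g)

/-- A one-parameter family of metrics that is smooth jointly in the parameter and the point. -/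
def IsSmoothFamily (γ : ℝ → Metric n M) : Prop :=
  ContMDiff (𝓘(ℝ, ℝ).prod (𝓡 n))
    ((𝓡 n).prod 𝓘(ℝ, EuclideanSpace ℝ (Fin n) →L[ℝ] EuclideanSpace ℝ (Fin n) →L[ℝ] ℝ)) ∞
    (fun p : ℝ × M =>
      Bundle.TotalSpace.mk' (EuclideanSpace ℝ (Fin n) →L[ℝ] EuclideanSpace ℝ (Fin n) →L[ℝ] ℝ)
        (E := fun x : M => TangentSpace (𝓡 n) x →L[ℝ] TangentSpace (𝓡 n) x →L[ℝ] ℝ)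
        p.2 ((γ p.1).inner p.2))

/-- `g` is a critical point of `F_t` on the space of metrics of volume one: it has volume one, and
`F_t` has derivative zero at `g` along every smooth family of metrics of volume one through `g`. -/
def IsCritical (t : ℝ) (g : Metric n M) : Prop :=
  riemannianVolume g Set.univ = 1 ∧
    ∀ γ : ℝ → Metric n M, IsSmoothFamily γ → γ 0 = g →
      (∀ s, riemannianVolume (γ s) Set.univ = 1) →
        HasDerivAt (fun s => functional t (γ s)) 0 0

end Manifold

end QuadCurv

end

/-! Let L be the trace-free Ricci endomorphism and ρ a smooth function supported in one chart. The
metric is varied through g_s(v, w) = g(E v, E w) with E = exp(s ρ L / 2), whose velocity at s = 0 is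
ρ L. Since tr L = 0, E has determinant one, so the volume measure does not move at all (`det_gauge`,
`riemannianVolume_varMetric`). The family is therefore admissible without normalisation, no Lagrange
multiplier appears, and F_t is differentiated under the integral against a fixed measure.

The derivative of |Ric|² + t R² is the linearised Ricci tensor paired with 2 Ric + 2tR, plus an
algebraic term. Integration by parts, with div L = (n-2)/(2n) dR from the contracted Bianchi
identity, gives |∇L|² minus two copies of the crossed product of ∇_j L_ik with ∇_k L_ij. The Ricci
identity (`dvg_bochner`) trades one copy for curvature. The outcome (`MetricData.first_variation`)
is a divergence plus ρ f + dρ(W), where f is `bochnerFun`. Criticality says that ρ f + dρ(W) has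
integral zero (`integral_bochnerAt_eq_zero`). Summing over a partition of unity turns ρ into 1 and
kills dρ, so ∫ f = 0 (`integral_bochnerFunAt`).

Pointwise, f consists of half the squared norm of C_ijk = ∇_k L_ij - ∇_j L_ik, a multiple of |dR|²,
and terms without derivatives. The trace part of C is a multiple of dR, and `cotton_inequality`
shows that it absorbs the |dR|² term exactly when t ≤ -n/(4(n-1)). The remaining terms are a
multiple of R|L|² minus W(L, L) + (n-4)/(n-2) tr L³. By `weyl_inequality` the latter is at most
√((n-2)/(2(n-1))) |L|² times the norm of the tensor in the pinching condition. That condition thus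
makes f at least a positive multiple of |L|². Being continuous and nonnegative with integral zero, f
vanishes, so L = 0, and Schur's lemma makes R locally constant.

The tensor calculus is carried out once, in a commutative ℝ-algebra with commuting derivations
(`MetricData`). It is applied to smooth functions on a chart domain, and on ℝ times a chart domain,
where ∂_s is a further derivation commuting with the coordinate ones. `CoordChange` covers four
situations: transition maps, restriction to an overlap, restriction to the slice s = 0, and a
constant linear frame that is orthonormal and diagonalises L at one given point. Tensors on the
manifold are read at x in the preferred chart at x, so invariance under `CoordChange` is also what
makes these quantities continuous functions and allows integration in a fixed chart. -/

noncomputable section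

namespace QuadCurv

/-! ### Tensor calculus in a ring with commuting derivations -/

/-- A metric `G` with inverse `H`, whose coefficients lie in a commutative ring with commuting
derivations `d i` (the coordinate derivatives). -/
structure MetricData (n : ℕ) (𝒜 : Type*) [CommRing 𝒜] [Algebra ℝ 𝒜] where
  d : Fin n → Derivation ℝ 𝒜 𝒜
  d_comm : ∀ i j f, d i (d j f) = d j (d i f)
  G : Matrix (Fin n) (Fin n) 𝒜
  H : Matrix (Fin n) (Fin n) 𝒜
  G_symm : G.transpose = G
  GH : G * H = 1

namespace MetricData

open Matrix

variable {n : ℕ} {𝒜 : Type*} [CommRing 𝒜] [Algebra ℝ 𝒜] (D : MetricData n 𝒜)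

lemma HG : D.H * D.G = 1 := mul_eq_one_comm.mp D.GH

lemma G_apply_symm (i j : Fin n) : D.G i j = D.G j i := by
  conv_lhs => rw [← D.G_symm]
  rfl

lemma H_symm : D.Hᵀ = D.H := by
  have h : D.Hᵀ * D.G = 1 := by
    have := congrArg transpose D.GH
    rwa [transpose_mul, D.G_symm, transpose_one] at this
  calc D.Hᵀ = D.Hᵀ * (D.G * D.H) := by rw [D.GH, mul_one]
    _ = D.H := by rw [← mul_assoc, h, one_mul]

lemma H_apply_symm (i j : Fin n) : D.H i j = D.H j i := by
  conv_lhs => rw [← D.H_symm]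
  rfl

/-- Entrywise derivative of a matrix. -/
def dM (k : Fin n) (M : Matrix (Fin n) (Fin n) 𝒜) : Matrix (Fin n) (Fin n) 𝒜 := M.map (D.d k)

@[simp] lemma dM_apply (k i j : Fin n) (M : Matrix (Fin n) (Fin n) 𝒜) :
    D.dM k M i j = D.d k (M i j) := rfl

lemma dM_add (k : Fin n) (M N : Matrix (Fin n) (Fin n) 𝒜) :
    D.dM k (M + N) = D.dM k M + D.dM k N := by
  ext i j; simp

lemma dM_sub (k : Fin n) (M N : Matrix (Fin n) (Fin n) 𝒜) :
    D.dM k (M - N) = D.dM k M - D.dM k N := by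
  ext i j; simp

lemma dM_neg (k : Fin n) (M : Matrix (Fin n) (Fin n) 𝒜) : D.dM k (-M) = -D.dM k M := by
  ext i j; simp

lemma dM_mul (k : Fin n) (M N : Matrix (Fin n) (Fin n) 𝒜) :
    D.dM k (M * N) = D.dM k M * N + M * D.dM k N := by
  ext i j
  simp only [dM_apply, mul_apply, Matrix.add_apply, map_sum, Derivation.leibniz, smul_eq_mul,
    ← Finset.sum_add_distrib]
  exact Finset.sum_congr rfl fun _ _ => by ring

lemma dM_one (k : Fin n) : D.dM k 1 = 0 := by
  ext i j; rcases eq_or_ne i j with h | h <;> simp [h]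

lemma dM_transpose (k : Fin n) (M : Matrix (Fin n) (Fin n) 𝒜) :
    D.dM k Mᵀ = (D.dM k M)ᵀ := rfl

lemma dM_smul (k : Fin n) (f : 𝒜) (M : Matrix (Fin n) (Fin n) 𝒜) :
    D.dM k (f • M) = D.d k f • M + f • D.dM k M := by
  ext i j
  simp only [dM_apply, Matrix.smul_apply, smul_eq_mul, Matrix.add_apply, Derivation.leibniz]
  ring

lemma dM_comm (i j : Fin n) (M : Matrix (Fin n) (Fin n) 𝒜) :
    D.dM i (D.dM j M) = D.dM j (D.dM i M) := by
  ext k l; simp [D.d_comm i j]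

lemma d_trace (k : Fin n) (M : Matrix (Fin n) (Fin n) 𝒜) :
    D.d k M.trace = (D.dM k M).trace := by
  simp [trace, diag]

/-- The Christoffel symbols: `Γ k` is the matrix with entries `Γ^m_kl`. -/
def Γ (k : Fin n) : Matrix (Fin n) (Fin n) 𝒜 := of fun m l =>
  (1 / 2 : ℝ) • ∑ p, D.H m p * (D.d k (D.G l p) + D.d l (D.G k p) - D.d p (D.G k l))

lemma Γ_symm (k m l : Fin n) : D.Γ k m l = D.Γ l m k := by
  simp only [Γ, of_apply]
  congr 1
  refine Finset.sum_congr rfl fun p _ => ?_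
  rw [D.G_apply_symm k l]; ring

lemma G_mul_Γ (k q l : Fin n) : (D.G * D.Γ k) q l =
    (1 / 2 : ℝ) • (D.d k (D.G l q) + D.d l (D.G k q) - D.d q (D.G k l)) := by
  have : D.Γ k = (1 / 2 : ℝ) • (D.H * of fun p l =>
      (D.d k (D.G l p) + D.d l (D.G k p) - D.d p (D.G k l))) := by
    ext m l; simp [Γ, mul_apply]
  rw [this, mul_smul_comm, ← mul_assoc, D.GH, one_mul]
  rfl

lemma half_smul_add_half_smul (a : 𝒜) : (1 / 2 : ℝ) • a + (1 / 2 : ℝ) • a = a := by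
  rw [← add_smul]; norm_num

lemma dM_G (k : Fin n) : D.dM k D.G = (D.Γ k)ᵀ * D.G + D.G * D.Γ k := by
  have h : (D.Γ k)ᵀ * D.G = (D.G * D.Γ k)ᵀ := by rw [transpose_mul, D.G_symm]
  ext i j
  have e : D.d k (D.G j i) + D.d j (D.G k i) - D.d i (D.G k j)
      + (D.d k (D.G i j) + D.d i (D.G k j) - D.d j (D.G k i)) = D.d k (D.G i j) + D.d k (D.G i j) := by
    rw [D.G_apply_symm j i]; ring
  rw [h, Matrix.add_apply, transpose_apply, G_mul_Γ, G_mul_Γ, ← smul_add, dM_apply,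
    add_comm (D.d k (D.G i j) + _ - _), e, smul_add, half_smul_add_half_smul]

/-- A symmetric family of matrices is determined by the symmetric parts of its lowered members. -/
lemma koszul {C h : Fin n → Matrix (Fin n) (Fin n) 𝒜}
    (hC : ∀ k m l, C k m l = C l m k) (hh : ∀ k, (C k)ᵀ * D.G + D.G * C k = h k) (k q l : Fin n) :
    (D.G * C k) q l = (1 / 2 : ℝ) • (h k l q + h l k q - h q k l) := by
  have hs : ∀ k q l, (D.G * C k) q l = (D.G * C l) q k := fun k q l => by
    simp only [mul_apply]
    exact Finset.sum_congr rfl fun m _ => by rw [hC]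
  have he : ∀ k i j, h k i j = (D.G * C k) j i + (D.G * C k) i j := fun k i j => by
    have : (C k)ᵀ * D.G = (D.G * C k)ᵀ := by rw [transpose_mul, D.G_symm]
    rw [← hh k, this]; rfl
  have : h k l q + h l k q - h q k l = (D.G * C k) q l + (D.G * C k) q l := by
    rw [he, he, he, hs l q k, hs q l k, hs q k l]; ring
  rw [this, smul_add, half_smul_add_half_smul]

lemma eq_of_G_mul_eq {M N : Matrix (Fin n) (Fin n) 𝒜} (h : D.G * M = D.G * N) : M = N := by
  have := congrArg (D.H * ·) h
  simpa [← mul_assoc, D.HG] using this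

/-- Uniqueness of the torsion-free metric connection, by the Koszul formula. It allows the
transformation law of Γ to be checked through its two characteristic properties. -/
lemma Γ_unique {C : Fin n → Matrix (Fin n) (Fin n) 𝒜}
    (hC : ∀ k m l, C k m l = C l m k) (hh : ∀ k, (C k)ᵀ * D.G + D.G * C k = D.dM k D.G)
    (k : Fin n) : C k = D.Γ k := by
  apply D.eq_of_G_mul_eq
  ext q l
  rw [D.koszul hC hh, D.koszul D.Γ_symm (fun k => (D.dM_G k).symm)]

/-- The covariant derivative `∇_k` of an endomorphism field. -/
def cov (k : Fin n) (M : Matrix (Fin n) (Fin n) 𝒜) : Matrix (Fin n) (Fin n) 𝒜 :=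
  D.dM k M + D.Γ k * M - M * D.Γ k

lemma cov_add (k : Fin n) (M N : Matrix (Fin n) (Fin n) 𝒜) :
    D.cov k (M + N) = D.cov k M + D.cov k N := by
  simp only [cov, dM_add]; noncomm_ring

lemma cov_sub (k : Fin n) (M N : Matrix (Fin n) (Fin n) 𝒜) :
    D.cov k (M - N) = D.cov k M - D.cov k N := by
  simp only [cov, dM_sub]; noncomm_ring

lemma cov_smul (k : Fin n) (f : 𝒜) (M : Matrix (Fin n) (Fin n) 𝒜) :
    D.cov k (f • M) = D.d k f • M + f • D.cov k M := by
  simp only [cov, dM_smul, smul_sub, smul_add, mul_smul_comm, smul_mul_assoc]; abel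

lemma cov_one (k : Fin n) : D.cov k 1 = 0 := by
  simp [cov, dM_one]

lemma trace_cov (k : Fin n) (M : Matrix (Fin n) (Fin n) 𝒜) :
    (D.cov k M).trace = D.d k M.trace := by
  rw [cov, trace_sub, trace_add, trace_mul_comm, d_trace]; ring

/-- The covariant derivative of a covariant 2-tensor. -/
def covLow (k : Fin n) (A : Matrix (Fin n) (Fin n) 𝒜) : Matrix (Fin n) (Fin n) 𝒜 :=
  D.dM k A - (D.Γ k)ᵀ * A - A * D.Γ k

lemma covLow_G_mul (k : Fin n) (M : Matrix (Fin n) (Fin n) 𝒜) :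
    D.covLow k (D.G * M) = D.G * D.cov k M := by
  simp only [cov, covLow, dM_mul, dM_G]; noncomm_ring

lemma covLow_transpose (k : Fin n) (A : Matrix (Fin n) (Fin n) 𝒜) :
    (D.covLow k A)ᵀ = D.covLow k Aᵀ := by
  simp only [covLow, transpose_sub, transpose_mul, transpose_transpose, dM_transpose]; abel

lemma dM_H (k : Fin n) : D.dM k D.H = -(D.Γ k * D.H + D.H * (D.Γ k)ᵀ) := by
  have h1 : D.dM k D.G * D.H + D.G * D.dM k D.H = 0 := by
    rw [← dM_mul, D.GH, dM_one]
  have h2 : D.dM k D.H = -(D.H * D.dM k D.G * D.H) := by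
    have := congrArg (D.H * ·) h1
    simp only [mul_add, mul_zero, ← mul_assoc, D.HG, one_mul] at this
    exact eq_neg_of_add_eq_zero_right this
  rw [h2, dM_G, mul_add, add_mul]
  congr 1
  rw [← mul_assoc D.H D.G, D.HG, one_mul, mul_assoc, mul_assoc, D.GH, mul_one, add_comm]

/-- The covariant derivative of a contravariant 2-tensor. -/
def covUp (k : Fin n) (S : Matrix (Fin n) (Fin n) 𝒜) : Matrix (Fin n) (Fin n) 𝒜 :=
  D.dM k S + D.Γ k * S + S * (D.Γ k)ᵀ

lemma covUp_mul_H (k : Fin n) (M : Matrix (Fin n) (Fin n) 𝒜) :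
    D.covUp k (M * D.H) = D.cov k M * D.H := by
  simp only [cov, covUp, dM_mul, dM_H]; noncomm_ring

/-- The curvature endomorphisms: `Ω i j` has the entries `R(∂_i, ∂_j)^m_l`. -/
def Ω (i j : Fin n) : Matrix (Fin n) (Fin n) 𝒜 :=
  D.dM i (D.Γ j) - D.dM j (D.Γ i) + D.Γ i * D.Γ j - D.Γ j * D.Γ i

lemma Ω_antisymm (i j : Fin n) : D.Ω i j = -D.Ω j i := by
  simp only [Ω]; abel

/-- Mixed derivatives of `G` commute; expanding both orders with ∂G = ΓᵀG + GΓ leaves exactly this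
combination. -/
lemma Ω_skew (i j : Fin n) : (D.Ω i j)ᵀ * D.G + D.G * D.Ω i j = 0 := by
  have h := D.dM_comm i j D.G
  simp only [dM_G, dM_add, dM_mul, dM_transpose] at h
  simp only [Ω, transpose_add, transpose_sub, transpose_mul]
  rw [← sub_eq_zero] at h
  rw [← h]
  noncomm_ring

lemma Ω_bianchi (i j l m : Fin n) : D.Ω i j m l + D.Ω j l m i + D.Ω l i m j = 0 := by
  simp only [Ω, Matrix.add_apply, Matrix.sub_apply, dM_apply, mul_apply]
  rw [D.Γ_symm j m l, D.Γ_symm i m l, D.Γ_symm i m j]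
  have e : ∀ a b c : Fin n, ∑ p, D.Γ a m p * D.Γ b p c = ∑ p, D.Γ a m p * D.Γ c p b :=
    fun a b c => Finset.sum_congr rfl fun p _ => by rw [D.Γ_symm b p c]
  rw [e i j l, e j l i, e l i j]
  ring

/-- The curvature tensor with all indices lowered. -/
def Rm (i j k l : Fin n) : 𝒜 := (D.G * D.Ω i j) k l

lemma Rm_antisymm_left (i j k l : Fin n) : D.Rm i j k l = -D.Rm j i k l := by
  rw [Rm, Ω_antisymm, mul_neg]; rfl

lemma Rm_antisymm_right (i j k l : Fin n) : D.Rm i j k l = -D.Rm i j l k := by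
  have h := D.Ω_skew i j
  have h' : (D.Ω i j)ᵀ * D.G = (D.G * D.Ω i j)ᵀ := by rw [transpose_mul, D.G_symm]
  rw [h'] at h
  have := congrFun (congrFun h k) l
  simp only [Matrix.add_apply, transpose_apply, Matrix.zero_apply] at this
  exact eq_neg_of_add_eq_zero_right this

lemma Rm_bianchi (i j k l : Fin n) : D.Rm i j k l + D.Rm j l k i + D.Rm l i k j = 0 := by
  simp only [Rm, mul_apply, ← Finset.sum_add_distrib, ← mul_add, D.Ω_bianchi, mul_zero,
    Finset.sum_const_zero]

lemma Rm_pair (i j k l : Fin n) : D.Rm i j k l = D.Rm k l i j := by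
  have b1 := D.Rm_bianchi i j k l
  have b2 := D.Rm_bianchi j k l i
  have b3 := D.Rm_bianchi k l i j
  have b4 := D.Rm_bianchi l i j k
  -- The octahedron argument: the four cyclic identities with signs +, -, -, + leave twice the
  -- difference, and 2 is invertible in an ℝ-algebra.
  have key : (2 : ℝ) • (D.Rm i j k l - D.Rm k l i j) = 0 := by
    rw [two_smul]
    linear_combination b1 + b4 - b2 - b3 - D.Rm_antisymm_right l i k j
      - D.Rm_antisymm_left i k j l - D.Rm_antisymm_right k l j i + D.Rm_antisymm_right k i l j
      + D.Rm_antisymm_right i j l k + D.Rm_antisymm_left l j i k - D.Rm_antisymm_right j l i k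
      + D.Rm_antisymm_right j k i l
  have := congrArg ((1 / 2 : ℝ) • ·) key
  simp only [smul_smul, smul_zero] at this
  norm_num at this
  exact sub_eq_zero.mp this

/-- The Ricci tensor. -/
def Ric : Matrix (Fin n) (Fin n) 𝒜 := of fun i k => ∑ j, ∑ l, D.H j l * D.Rm i j k l

lemma Ω_apply (i j m l : Fin n) : D.Ω i j m l = ∑ k, D.H m k * D.Rm i j k l := by
  have : D.Ω i j = D.H * (D.G * D.Ω i j) := by rw [← mul_assoc, D.HG, one_mul]
  conv_lhs => rw [this]
  rfl

/-- In this form the Ricci tensor is a trace not involving the metric, so its variation and its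
transformation law follow from those of Ω alone. -/
lemma Ric_eq (i k : Fin n) : D.Ric i k = ∑ l, D.Ω l k l i := by
  simp only [Ric, of_apply, Ω_apply]
  rw [Finset.sum_comm]
  refine Finset.sum_congr rfl fun j _ => Finset.sum_congr rfl fun l _ => ?_
  rw [D.H_apply_symm, D.Rm_pair j k l i, D.Rm_antisymm_left, D.Rm_antisymm_right, neg_neg]

lemma Ric_symm : D.Ricᵀ = D.Ric := by
  ext i k
  simp only [transpose_apply, Ric, of_apply]
  rw [Finset.sum_comm]
  refine Finset.sum_congr rfl fun j _ => Finset.sum_congr rfl fun l _ => ?_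
  rw [D.H_apply_symm, D.Rm_pair k l i j]

end MetricData
end QuadCurv
end

/-! ### Bianchi and Ricci identities, divergences and the Bochner-type formula. -/

noncomputable section

namespace QuadCurv

namespace MetricData

open Matrix

variable {n : ℕ} {𝒜 : Type*} [CommRing 𝒜] [Algebra ℝ 𝒜] (D : MetricData n 𝒜)

/-- The Ricci endomorphism. -/
def ricEnd : Matrix (Fin n) (Fin n) 𝒜 := D.H * D.Ric

/-- The scalar curvature. -/
def scal : 𝒜 := D.ricEnd.trace

lemma G_mul_ricEnd : D.G * D.ricEnd = D.Ric := by
  rw [ricEnd, ← mul_assoc, D.GH, one_mul]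

lemma H_mul_covLow (k : Fin n) (A : Matrix (Fin n) (Fin n) 𝒜) :
    D.H * D.covLow k A = D.cov k (D.H * A) := by
  have : A = D.G * (D.H * A) := by rw [← mul_assoc, D.GH, one_mul]
  conv_lhs => rw [this, covLow_G_mul, ← mul_assoc, D.HG, one_mul]

lemma covUp_transpose (k : Fin n) (S : Matrix (Fin n) (Fin n) 𝒜) :
    (D.covUp k S)ᵀ = D.covUp k Sᵀ := by
  simp only [covUp, transpose_add, transpose_mul, transpose_transpose, dM_transpose]; abel

lemma covUp_mul (k : Fin n) (M S : Matrix (Fin n) (Fin n) 𝒜) :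
    D.covUp k (M * S) = D.cov k M * S + M * D.covUp k S := by
  simp only [covUp, cov, dM_mul]; noncomm_ring

/-- The covariant derivative of the curvature, as an endomorphism. -/
def nablaΩ (m l k : Fin n) : Matrix (Fin n) (Fin n) 𝒜 :=
  D.cov m (D.Ω l k) - ∑ p, D.Γ m p l • D.Ω p k - ∑ p, D.Γ m p k • D.Ω l p

lemma cov_neg (k : Fin n) (M : Matrix (Fin n) (Fin n) 𝒜) : D.cov k (-M) = -D.cov k M := by
  simp only [cov, dM_neg]; noncomm_ring

lemma nablaΩ_antisymm (m l k : Fin n) : D.nablaΩ m l k = -D.nablaΩ m k l := by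
  have h1 : D.cov m (D.Ω l k) = -D.cov m (D.Ω k l) := by rw [← cov_neg, ← Ω_antisymm]
  have h2 : ∑ p, D.Γ m p l • D.Ω p k = -∑ p, D.Γ m p l • D.Ω k p := by
    rw [← Finset.sum_neg_distrib]
    exact Finset.sum_congr rfl fun p _ => by rw [Ω_antisymm, smul_neg]
  have h3 : ∑ p, D.Γ m p k • D.Ω l p = -∑ p, D.Γ m p k • D.Ω p l := by
    rw [← Finset.sum_neg_distrib]
    exact Finset.sum_congr rfl fun p _ => by rw [Ω_antisymm, smul_neg]
  rw [nablaΩ, nablaΩ, h1, h2, h3]; abel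

/-- The Jacobi identity for the operators ∂ + Γ; the symmetry of Γ plays no role yet. -/
lemma cov_Ω_bianchi (m l k : Fin n) :
    D.cov m (D.Ω l k) + D.cov l (D.Ω k m) + D.cov k (D.Ω m l) = 0 := by
  simp only [cov, Ω, dM_add, dM_sub, dM_mul]
  rw [D.dM_comm m l, D.dM_comm m k, D.dM_comm l k]
  noncomm_ring

/-- The corrections at the two form indices cancel in pairs between different summands, because Γ is
symmetric and Ω is antisymmetric. -/
lemma nablaΩ_bianchi (m l k : Fin n) :
    D.nablaΩ m l k + D.nablaΩ l k m + D.nablaΩ k m l = 0 := by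
  have e : ∀ a b c : Fin n,
      ∑ p, D.Γ a p b • D.Ω p c + ∑ p, D.Γ b p a • D.Ω c p = 0 := fun a b c => by
    rw [← Finset.sum_add_distrib]
    refine Finset.sum_eq_zero fun p _ => ?_
    rw [D.Γ_symm b p a, D.Ω_antisymm c p, smul_neg, add_neg_cancel]
  calc D.nablaΩ m l k + D.nablaΩ l k m + D.nablaΩ k m l
      = (D.cov m (D.Ω l k) + D.cov l (D.Ω k m) + D.cov k (D.Ω m l))
        - (∑ p, D.Γ m p l • D.Ω p k + ∑ p, D.Γ l p m • D.Ω k p)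
        - (∑ p, D.Γ l p k • D.Ω p m + ∑ p, D.Γ k p l • D.Ω m p)
        - (∑ p, D.Γ k p m • D.Ω p l + ∑ p, D.Γ m p k • D.Ω l p) := by
        simp only [nablaΩ]; abel
    _ = 0 := by rw [cov_Ω_bianchi, e, e, e]; simp

lemma sum_nablaΩ (m k i : Fin n) : ∑ l, D.nablaΩ m l k l i = D.covLow m D.Ric i k := by
  simp only [nablaΩ, cov, covLow, Matrix.sub_apply, Matrix.add_apply, dM_apply, mul_apply,
    Matrix.sum_apply, Matrix.smul_apply, smul_eq_mul, transpose_apply, Finset.sum_sub_distrib,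
    Finset.sum_add_distrib, Ric_eq, map_sum, Finset.mul_sum, Finset.sum_mul]
  have h1 : ∑ l, ∑ p, D.Γ m l p * D.Ω l k p i = ∑ l, ∑ p, D.Γ m p l * D.Ω p k l i :=
    Finset.sum_comm
  have h2 : ∑ l, ∑ p, D.Ω l k l p * D.Γ m p i = ∑ p, ∑ l, D.Γ m p i * D.Ω l k l p := by
    rw [Finset.sum_comm]; simp only [mul_comm]
  have h3 : ∑ l, ∑ p, D.Γ m p k * D.Ω l p l i = ∑ p, ∑ l, D.Ω l p l i * D.Γ m p k := by
    rw [Finset.sum_comm]; simp only [mul_comm]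
  rw [h1, h2, h3]; abel

lemma Ω_mul_H_skew (i j : Fin n) : (D.Ω i j * D.H)ᵀ = -(D.Ω i j * D.H) := by
  have h := congrArg (fun M => D.H * M * D.H) (D.Ω_skew i j)
  simp only [mul_add, add_mul, mul_zero, zero_mul, mul_assoc, D.GH, mul_one] at h
  rw [← mul_assoc D.H D.G, D.HG, one_mul] at h
  rw [transpose_mul, D.H_symm]
  exact eq_neg_of_add_eq_zero_left h

lemma nablaΩ_mul_H_skew (m i j : Fin n) : (D.nablaΩ m i j * D.H)ᵀ = -(D.nablaΩ m i j * D.H) := by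
  simp only [nablaΩ, sub_mul, Finset.sum_mul, transpose_sub, transpose_sum, smul_mul_assoc,
    transpose_smul, Ω_mul_H_skew, smul_neg, Finset.sum_neg_distrib, ← covUp_mul_H, covUp_transpose]
  have : ∀ S, D.covUp m (-S) = -D.covUp m S := fun S => by
    simp only [covUp, dM_neg]; noncomm_ring
  rw [this]; abel

/-- The contracted second Bianchi identity. -/
lemma contracted_bianchi (m : Fin n) :
    D.d m D.scal = 2 * ∑ l, D.cov l D.ricEnd l m := by
  -- The second Bianchi identity is contracted twice: the first term becomes dR, and each of the
  -- other two becomes minus the divergence of the Ricci endomorphism.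
  have hsum : ∑ l, ∑ k, ((D.nablaΩ m l k * D.H) l k + (D.nablaΩ l k m * D.H) l k
      + (D.nablaΩ k m l * D.H) l k) = 0 := by
    refine Finset.sum_eq_zero fun l _ => Finset.sum_eq_zero fun k _ => ?_
    rw [← Matrix.add_apply, ← Matrix.add_apply, ← add_mul, ← add_mul, nablaΩ_bianchi, zero_mul,
      Matrix.zero_apply]
  have hc : ∀ k m : Fin n, ∑ l, ∑ j, (D.nablaΩ k l m) l j * D.H j k = (D.cov k D.ricEnd) k m := by
    intro k m
    rw [Finset.sum_comm]
    simp only [← Finset.sum_mul, sum_nablaΩ]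
    rw [ricEnd, ← H_mul_covLow, mul_apply]
    refine Finset.sum_congr rfl fun j _ => ?_
    rw [D.H_apply_symm, mul_comm]
  have h1 : ∑ l, ∑ k, (D.nablaΩ m l k * D.H) l k = D.d m D.scal := by
    have : ∑ l, ∑ k, (D.nablaΩ m l k * D.H) l k = ∑ k, ∑ j, (∑ l, D.nablaΩ m l k l j) * D.H j k := by
      rw [Finset.sum_comm]
      refine Finset.sum_congr rfl fun k _ => ?_
      simp only [mul_apply, Finset.sum_mul]
      rw [Finset.sum_comm]
    rw [this, scal, ← trace_cov, ricEnd, ← H_mul_covLow]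
    simp only [sum_nablaΩ, trace, diag, mul_apply]
    refine Finset.sum_congr rfl fun k _ => Finset.sum_congr rfl fun j _ => ?_
    rw [D.H_apply_symm, mul_comm]
  have h2 : ∑ l, ∑ k, (D.nablaΩ l k m * D.H) l k = -∑ l, D.cov l D.ricEnd l m := by
    rw [← Finset.sum_neg_distrib]
    refine Finset.sum_congr rfl fun l _ => ?_
    rw [← hc, ← Finset.sum_neg_distrib]
    refine Finset.sum_congr rfl fun k _ => ?_
    have := congrFun (congrFun (D.nablaΩ_mul_H_skew l k m) k) l
    rw [transpose_apply] at this
    rw [this, Matrix.neg_apply, mul_apply]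
  have h3 : ∑ l, ∑ k, (D.nablaΩ k m l * D.H) l k = -∑ l, D.cov l D.ricEnd l m := by
    rw [Finset.sum_comm, ← Finset.sum_neg_distrib]
    refine Finset.sum_congr rfl fun k _ => ?_
    rw [← hc, ← Finset.sum_neg_distrib]
    refine Finset.sum_congr rfl fun l _ => ?_
    rw [nablaΩ_antisymm, neg_mul, Matrix.neg_apply, mul_apply]
  simp only [Finset.sum_add_distrib] at hsum
  rw [h1, h2, h3] at hsum
  linear_combination hsum

/-- The divergence of a vector field. -/
def dvg (V : Fin n → 𝒜) : 𝒜 := ∑ k, (D.d k (V k) + (D.Γ k).trace * V k)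

lemma dvg_sub (V W : Fin n → 𝒜) : D.dvg (fun k => V k - W k) = D.dvg V - D.dvg W := by
  simp only [dvg, map_sub, ← Finset.sum_sub_distrib]
  exact Finset.sum_congr rfl fun _ _ => by ring

lemma dvg_mul (f : 𝒜) (V : Fin n → 𝒜) :
    D.dvg (fun k => f * V k) = f * D.dvg V + ∑ k, D.d k f * V k := by
  simp only [dvg, Finset.mul_sum, ← Finset.sum_add_distrib, Derivation.leibniz, smul_eq_mul]
  exact Finset.sum_congr rfl fun _ _ => by ring

lemma trace_Γ (k : Fin n) : (D.Γ k).trace = ∑ p, D.Γ p p k := by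
  simp only [trace, diag]
  exact Finset.sum_congr rfl fun p _ => D.Γ_symm k p p

/-- Contraction commutes with the connection: the trace of Γ comes from the differentiated upper
index, and the two Γ-terms at the contracted index `j` cancel. -/
lemma dvg_contract (S : Fin n → Matrix (Fin n) (Fin n) 𝒜) :
    D.dvg (fun k => ∑ j, S j k j) =
      ∑ k, ∑ j, (D.covUp k (S j) - ∑ p, D.Γ k p j • S p) k j := by
  simp only [dvg, trace_Γ, covUp, Matrix.sub_apply, Matrix.add_apply, dM_apply, mul_apply,
    Matrix.sum_apply, Matrix.smul_apply, smul_eq_mul, transpose_apply, Finset.sum_sub_distrib,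
    Finset.sum_add_distrib, map_sum, Finset.mul_sum, Finset.sum_mul]
  have h1 : ∑ k, ∑ j, ∑ p, D.Γ k k p * S j p j = ∑ k, ∑ j, ∑ p, D.Γ p p k * S j k j := by
    rw [Finset.sum_comm, Finset.sum_comm (f := fun k j => ∑ p, D.Γ p p k * S j k j)]
    exact Finset.sum_congr rfl fun j _ => Finset.sum_comm
  have h2 : ∑ k, ∑ j, ∑ p, S j k p * D.Γ k j p = ∑ k, ∑ j, ∑ p, D.Γ k p j * S p k j := by
    refine Finset.sum_congr rfl fun k _ => ?_
    rw [Finset.sum_comm]; simp only [mul_comm]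
  rw [h1, h2]; abel

/-- The second covariant derivative of an endomorphism field. -/
def nabla2 (M : Matrix (Fin n) (Fin n) 𝒜) (k j : Fin n) : Matrix (Fin n) (Fin n) 𝒜 :=
  D.cov k (D.cov j M) - ∑ p, D.Γ k p j • D.cov p M

/-- The Ricci identity. -/
lemma nabla2_comm (M : Matrix (Fin n) (Fin n) 𝒜) (k j : Fin n) :
    D.nabla2 M k j = D.nabla2 M j k + (D.Ω k j * M - M * D.Ω k j) := by
  have h : D.cov k (D.cov j M) = D.cov j (D.cov k M) + (D.Ω k j * M - M * D.Ω k j) := by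
    simp only [cov, Ω, dM_add, dM_sub, dM_mul]
    rw [D.dM_comm k j]
    noncomm_ring
  have h2 : ∑ p, D.Γ k p j • D.cov p M = ∑ p, D.Γ j p k • D.cov p M :=
    Finset.sum_congr rfl fun p _ => by rw [D.Γ_symm]
  rw [nabla2, nabla2, h, h2]; abel

/-- The divergence of an endomorphism field. -/
def dvgEnd (M : Matrix (Fin n) (Fin n) 𝒜) (i : Fin n) : 𝒜 := ∑ k, D.cov k M k i

lemma sum_nabla2 (M : Matrix (Fin n) (Fin n) 𝒜) (j i : Fin n) :
    ∑ k, D.nabla2 M j k k i = D.d j (D.dvgEnd M i) - ∑ p, D.Γ j p i * D.dvgEnd M p := by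
  have e : ∀ N : Matrix (Fin n) (Fin n) 𝒜, ∀ k, D.cov j N k i =
      D.d j (N k i) + ∑ p, D.Γ j k p * N p i - ∑ p, N k p * D.Γ j p i := fun N k => by
    simp only [cov, Matrix.sub_apply, Matrix.add_apply, dM_apply, mul_apply]
  simp only [nabla2, dvgEnd, Matrix.sub_apply, e (D.cov _ M), Matrix.sum_apply, Matrix.smul_apply,
    smul_eq_mul, Finset.sum_sub_distrib, Finset.sum_add_distrib, map_sum, Finset.mul_sum]
  have h1 : ∑ k, ∑ p, D.Γ j k p * D.cov k M p i = ∑ k, ∑ p, D.Γ j p k * D.cov p M k i :=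
    Finset.sum_comm
  have h2 : ∑ k, ∑ p, D.cov k M k p * D.Γ j p i = ∑ p, ∑ k, D.Γ j p i * D.cov k M k p := by
    rw [Finset.sum_comm]; simp only [mul_comm]
  rw [h1, h2]; abel

lemma dvg_mulVec (N : Matrix (Fin n) (Fin n) 𝒜) (w : Fin n → 𝒜) :
    D.dvg (fun k => ∑ i, N k i * w i) =
      ∑ k, ∑ i, (D.covUp k N k i * w i + N k i * (D.d k (w i) - ∑ p, D.Γ k p i * w p)) := by
  simp only [dvg, trace_Γ, covUp, Matrix.add_apply, dM_apply, mul_apply, transpose_apply,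
    Finset.sum_add_distrib, map_sum, Finset.mul_sum, Finset.sum_mul, add_mul, mul_sub,
    Finset.sum_sub_distrib, Derivation.leibniz, smul_eq_mul]
  have h1 : ∑ k, ∑ i, ∑ p, D.Γ k k p * N p i * w i = ∑ k, ∑ i, ∑ p, D.Γ p p k * (N k i * w i) := by
    rw [Finset.sum_comm, Finset.sum_comm (f := fun k i => ∑ p, D.Γ p p k * (N k i * w i))]
    refine Finset.sum_congr rfl fun j _ => ?_
    rw [Finset.sum_comm]; simp only [mul_assoc]
  have h2 : ∑ k, ∑ i, ∑ p, N k p * D.Γ k i p * w i = ∑ k, ∑ i, ∑ p, N k i * (D.Γ k p i * w p) := by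
    refine Finset.sum_congr rfl fun k _ => ?_
    rw [Finset.sum_comm]; simp only [mul_assoc]
  have h3 : ∑ k, ∑ i, w i * D.d k (N k i) = ∑ k, ∑ i, D.d k (N k i) * w i := by
    simp only [mul_comm]
  rw [h1, h2, h3]; abel

/-- The Bochner-type formula: the divergence of
`V^k = (∇_j M)^k_i N^{ij} - N^{ki} (div M)_i`, where `N = M H`. -/
lemma dvg_bochner (M : Matrix (Fin n) (Fin n) 𝒜) (hN : (M * D.H)ᵀ = M * D.H) :
    D.dvg (fun k => ∑ j, (D.cov j M * (M * D.H)) k j - ∑ i, (M * D.H) k i * D.dvgEnd M i) =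
      ∑ k, ∑ j, (D.cov j M * D.cov k M * D.H) k j
      - ∑ i, ∑ j, D.H i j * D.dvgEnd M i * D.dvgEnd M j
      + ∑ k, ∑ j, ((D.Ω k j * M - M * D.Ω k j) * (M * D.H)) k j := by
  set N := M * D.H with hNdef
  have hN' : ∀ i j, N i j = N j i := fun i j => congrFun (congrFun hN j) i
  rw [dvg_sub, dvg_contract (S := fun j => D.cov j M * N), dvg_mulVec]
  -- The only place where derivatives are interchanged; the commutator is the curvature term of the
  -- formula.
  have h1 : ∀ k j, D.covUp k (D.cov j M * N) - ∑ p, D.Γ k p j • (D.cov p M * N)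
      = D.nabla2 M j k * N + (D.Ω k j * M - M * D.Ω k j) * N + D.cov j M * D.cov k M * D.H := by
    intro k j
    rw [← add_mul, ← nabla2_comm, covUp_mul, hNdef, covUp_mul_H, nabla2, sub_mul, Finset.sum_mul]
    simp only [smul_mul_assoc, mul_assoc]; abel
  simp only [h1, Matrix.add_apply, Finset.sum_add_distrib]
  -- After the interchange the second derivatives contract to the derivative of the divergence,
  -- which cancels against the same term in the other half of the vector field.
  have h2 : ∑ k, ∑ j, (D.nabla2 M j k * N) k j =
      ∑ k, ∑ i, N k i * (D.d k (D.dvgEnd M i) - ∑ p, D.Γ k p i * D.dvgEnd M p) := by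
    simp only [← sum_nabla2]
    rw [Finset.sum_comm]
    refine Finset.sum_congr rfl fun j _ => ?_
    simp only [mul_apply, Finset.mul_sum]
    rw [Finset.sum_comm]
    refine Finset.sum_congr rfl fun i _ => Finset.sum_congr rfl fun k _ => ?_
    rw [hN' i j, mul_comm]
  have h3 : ∑ k, ∑ i, D.covUp k N k i * D.dvgEnd M i =
      ∑ i, ∑ j, D.H i j * D.dvgEnd M i * D.dvgEnd M j := by
    rw [hNdef]
    simp only [covUp_mul_H]
    rw [Finset.sum_comm, Finset.sum_comm (f := fun i j => D.H i j * D.dvgEnd M i * D.dvgEnd M j)]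
    refine Finset.sum_congr rfl fun i _ => ?_
    rw [← Finset.sum_mul, ← Finset.sum_mul]
    congr 1
    simp only [mul_apply]
    rw [Finset.sum_comm]
    refine Finset.sum_congr rfl fun q _ => ?_
    rw [← Finset.sum_mul, mul_comm]; rfl
  rw [h2, h3]; abel

end MetricData
end QuadCurv
end

/-! ### Linearised Ricci tensor and first variation of the integrand. -/

noncomputable section

namespace QuadCurv

namespace MetricData

open Matrix

variable {n : ℕ} {𝒜 : Type*} [CommRing 𝒜] [Algebra ℝ 𝒜] (D : MetricData n 𝒜)

/-- The linearization of the Ricci tensor when the Christoffel symbols vary by `C`. -/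
def linRic (C : Fin n → Matrix (Fin n) (Fin n) 𝒜) : Matrix (Fin n) (Fin n) 𝒜 :=
  of fun i k => ∑ l, (D.cov l (C k) - D.cov k (C l)) l i

/-- Integration by parts. The trace condition, satisfied when the volume form is preserved, removes
the half ∇_k (C_l) of the linearised Ricci tensor, and ∇_l is then moved onto `S`. -/
lemma sum_mul_linRic {C : Fin n → Matrix (Fin n) (Fin n) 𝒜} (hC : ∀ k m l, C k m l = C l m k)
    (htr : ∀ k, (C k).trace = 0) (S : Matrix (Fin n) (Fin n) 𝒜) :
    ∑ i, ∑ k, S i k * D.linRic C i k =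
      D.dvg (fun l => ∑ i, ∑ k, S i k * C k l i)
        - ∑ l, ∑ i, ∑ k, D.covUp l S i k * C k l i := by
  have htr' : ∀ i, ∑ l, C l l i = 0 := fun i => by
    rw [← htr i, trace]
    exact Finset.sum_congr rfl fun l _ => hC l l i
  have e : ∀ i k, D.linRic C i k = ∑ l, D.d l (C k l i) + ∑ l, ∑ p, D.Γ l l p * C k p i
      - ∑ l, ∑ p, C k l p * D.Γ l p i - ∑ l, ∑ p, D.Γ k l p * C l p i := by
    intro i k
    have h1 : ∑ l, D.d k (C l l i) = 0 := by rw [← map_sum, htr', map_zero]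
    have h2 : ∑ l, ∑ p, C l l p * D.Γ k p i = 0 := by
      rw [Finset.sum_comm]
      simp only [← Finset.sum_mul, htr', zero_mul, Finset.sum_const_zero]
    simp only [linRic, of_apply, cov, Matrix.sub_apply, Matrix.add_apply, dM_apply, mul_apply,
      Finset.sum_sub_distrib, Finset.sum_add_distrib, h1, h2]
    abel
  simp only [e, dvg, trace_Γ, covUp, Matrix.add_apply, dM_apply, mul_apply, transpose_apply,
    Finset.sum_add_distrib, map_sum, Finset.mul_sum, Finset.sum_mul, add_mul, mul_sub, mul_add,
    Finset.sum_sub_distrib, Derivation.leibniz, smul_eq_mul]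
  have r3 : ∀ F : Fin n → Fin n → Fin n → 𝒜,
      ∑ l, ∑ i, ∑ k, F l i k = ∑ i, ∑ k, ∑ l, F l i k := fun F => by
    rw [Finset.sum_comm]
    exact Finset.sum_congr rfl fun i _ => Finset.sum_comm
  have h1 : ∑ l, ∑ i, ∑ k, S i k * D.d l (C k l i) = ∑ i, ∑ k, ∑ l, S i k * D.d l (C k l i) :=
    r3 _
  have h2 : ∑ l, ∑ i, ∑ k, D.d l (S i k) * C k l i = ∑ l, ∑ i, ∑ k, C k l i * D.d l (S i k) := by
    simp only [mul_comm]
  have h3 : ∑ l, ∑ i, ∑ k, ∑ p, D.Γ p p l * (S i k * C k l i) =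
      ∑ i, ∑ k, ∑ l, ∑ p, S i k * (D.Γ l l p * C k p i) := by
    rw [r3]
    refine Finset.sum_congr rfl fun i _ => Finset.sum_congr rfl fun k _ => ?_
    rw [Finset.sum_comm]
    exact Finset.sum_congr rfl fun l _ => Finset.sum_congr rfl fun p _ => by ring
  have h4 : ∑ l, ∑ i, ∑ k, ∑ p, D.Γ l i p * S p k * C k l i =
      ∑ i, ∑ k, ∑ l, ∑ p, S i k * (C k l p * D.Γ l p i) := by
    have : ∀ l, ∑ i, ∑ k, ∑ p, D.Γ l i p * S p k * C k l i =
        ∑ i, ∑ k, ∑ p, S i k * (C k l p * D.Γ l p i) := fun l => by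
      rw [Finset.sum_comm, Finset.sum_comm (f := fun i k => ∑ p, S i k * (C k l p * D.Γ l p i))]
      refine Finset.sum_congr rfl fun k _ => ?_
      rw [Finset.sum_comm]
      exact Finset.sum_congr rfl fun i _ => Finset.sum_congr rfl fun p _ => by ring
    simp only [this]
    exact r3 _
  have h5 : ∑ l, ∑ i, ∑ k, ∑ p, S i p * D.Γ l k p * C k l i =
      ∑ i, ∑ k, ∑ l, ∑ p, S i k * (D.Γ k l p * C l p i) := by
    rw [Finset.sum_comm]
    refine Finset.sum_congr rfl fun i _ => ?_
    have : ∀ l, ∑ k, ∑ p, S i p * D.Γ l k p * C k l i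
        = ∑ p, ∑ k, S i p * D.Γ l k p * C k l i := fun l => Finset.sum_comm
    simp only [this]
    rw [Finset.sum_comm]
    refine Finset.sum_congr rfl fun k _ => ?_
    rw [Finset.sum_comm]
    refine Finset.sum_congr rfl fun l _ => Finset.sum_congr rfl fun p _ => ?_
    rw [D.Γ_symm k l p]; ring
  rw [h1, h2, h3, h4, h5]; abel

/-- The Koszul formula writes `C` as half of three terms in `K`. Against the symmetric tensor Q H
the first two agree and their halves add up to one; the third keeps its factor 1/2. -/
lemma sum_mul_christoffel_variation {C K : Fin n → Matrix (Fin n) (Fin n) 𝒜}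
    (hC : ∀ k m l, C k m l = C l m k) (hK : ∀ k, (C k)ᵀ * D.G + D.G * C k = D.G * K k)
    (Q : Fin n → Matrix (Fin n) (Fin n) 𝒜) (hQ : ∀ l, (Q l * D.H)ᵀ = Q l * D.H) :
    ∑ l, ∑ i, ∑ k, (Q l * D.H) i k * C k l i =
      ∑ i, ∑ l, (Q l * K i * D.H) i l - (1 / 2 : ℝ) • ∑ l, ∑ m, D.H l m * (Q l * K m).trace := by
  have hQ' : ∀ l i k, (Q l * D.H) i k = (Q l * D.H) k i := fun l i k =>
    congrFun (congrFun (hQ l) k) i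
  have hCe : ∀ k l i, C k l i = ∑ m, D.H l m * ((1 / 2 : ℝ) •
      ((D.G * K k) i m + (D.G * K i) k m - (D.G * K m) k i)) := fun k l i => by
    have : C k = D.H * (D.G * C k) := by rw [← mul_assoc, D.HG, one_mul]
    conv_lhs => rw [this, mul_apply]
    simp only [D.koszul hC hK]
  have h1 : ∀ l i, ∑ k, ∑ m, (Q l * D.H) i k * (D.H l m * (D.G * K i) k m) =
      (Q l * K i * D.H) i l := fun l i => by
    have : Q l * K i * D.H = Q l * D.H * (D.G * K i) * D.H := by
      rw [mul_assoc (Q l) D.H, ← mul_assoc D.H D.G, D.HG, one_mul]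
    rw [this, mul_apply]
    simp only [mul_apply (M := Q l * D.H) (N := D.G * K i), Finset.sum_mul]
    rw [Finset.sum_comm]
    refine Finset.sum_congr rfl fun k _ => Finset.sum_congr rfl fun m _ => ?_
    rw [D.H_apply_symm l]; ring
  have h2 : ∀ l m, ∑ i, ∑ k, (Q l * D.H) i k * (D.H l m * (D.G * K m) k i) =
      D.H l m * (Q l * K m).trace := fun l m => by
    have : Q l * K m = Q l * D.H * (D.G * K m) := by
      rw [mul_assoc (Q l) D.H, ← mul_assoc D.H D.G, D.HG, one_mul]
    rw [this]
    simp only [trace, diag, mul_apply (M := Q l * D.H) (N := D.G * K m), Finset.mul_sum]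
    exact Finset.sum_congr rfl fun i _ => Finset.sum_congr rfl fun k _ => by ring
  have h3 : ∀ l, ∑ i, ∑ k, ∑ m, (Q l * D.H) i k * (D.H l m * (D.G * K k) i m) =
      ∑ i, (Q l * K i * D.H) i l := fun l => by
    rw [Finset.sum_comm]
    refine Finset.sum_congr rfl fun k _ => ?_
    rw [← h1]
    exact Finset.sum_congr rfl fun i _ => Finset.sum_congr rfl fun m _ => by rw [hQ' l i k]
  have h4 : ∀ l, ∑ i, ∑ k, ∑ m, (Q l * D.H) i k * (D.H l m * (D.G * K m) k i) =
      ∑ m, D.H l m * (Q l * K m).trace := fun l => by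
    simp only [← h2]
    rw [Finset.sum_comm (s := (Finset.univ : Finset (Fin n)))
      (f := fun m i => ∑ k, (Q l * D.H) i k * (D.H l m * (D.G * K m) k i))]
    exact Finset.sum_congr rfl fun i _ => Finset.sum_comm
  simp only [hCe, Finset.mul_sum, mul_smul_comm, mul_add, mul_sub, smul_add, smul_sub,
    Finset.sum_add_distrib, Finset.sum_sub_distrib, ← Finset.smul_sum, h1, h3, h4]
  rw [Finset.sum_comm (f := fun l i => (Q l * K i * D.H) i l)]
  rw [half_smul_add_half_smul]

/-- The trace-free Ricci endomorphism. -/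
def tf : Matrix (Fin n) (Fin n) 𝒜 := D.ricEnd - (algebraMap ℝ 𝒜 (1 / n) * D.scal) • 1

/-- The gradient of the integrand `|Ric|² + t R²` with respect to the Ricci endomorphism. -/
def gradEnd (t : ℝ) : Matrix (Fin n) (Fin n) 𝒜 :=
  (2 : 𝒜) • D.ricEnd + (2 * algebraMap ℝ 𝒜 t * D.scal) • 1

/-- The squared norm of `dR`. -/
def dscalSq : 𝒜 := ∑ i, ∑ j, D.H i j * D.d i D.scal * D.d j D.scal

/-- The scalar integrand of the Bochner-type formula. -/
def bochnerFun (t : ℝ) : 𝒜 :=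
  ∑ l, ∑ m, D.H l m * (D.cov l D.tf * D.cov m D.tf).trace
    - ∑ k, ∑ j, (D.cov j D.tf * D.cov k D.tf * D.H) k j
    - algebraMap ℝ 𝒜 ((2 / n + 2 * t + (n - 2) / (2 * n)) * ((n - 2) / (2 * n))) * D.dscalSq
    - (D.gradEnd t * D.tf * D.ricEnd).trace
    + ∑ k, ∑ j, ((D.Ω k j * D.tf - D.tf * D.Ω k j) * (D.tf * D.H)) k j

/-- The vector field of the Bochner-type formula. -/
def bochnerVec (t : ℝ) (i : Fin n) : 𝒜 :=
  -∑ l, (D.cov l D.tf * (D.tf * D.H)) i l + ∑ l, D.H i l * (D.cov l D.tf * D.tf).trace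
    - algebraMap ℝ 𝒜 (2 / n + 2 * t + (n - 2) / (2 * n)) * ∑ j, (D.tf * D.H) i j * D.d j D.scal

lemma ricEnd_mul_H_symm : (D.ricEnd * D.H)ᵀ = D.ricEnd * D.H := by
  rw [ricEnd, transpose_mul, transpose_mul, D.H_symm, D.Ric_symm, mul_assoc]

lemma tf_mul_H_symm : (D.tf * D.H)ᵀ = D.tf * D.H := by
  rw [tf, sub_mul, transpose_sub, ricEnd_mul_H_symm, smul_mul_assoc, one_mul, transpose_smul,
    D.H_symm]

lemma trace_tf (hn : n ≠ 0) : D.tf.trace = 0 := by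
  rw [tf, trace_sub, trace_smul, trace_one, ← scal, Fintype.card_fin, smul_eq_mul,
    ← map_natCast (algebraMap ℝ 𝒜) n]
  have : algebraMap ℝ 𝒜 (1 / n) * algebraMap ℝ 𝒜 n = 1 := by
    rw [← map_mul, one_div, inv_mul_cancel₀ (by exact_mod_cast hn), map_one]
  linear_combination (-D.scal) * this

lemma cov_tf (k : Fin n) :
    D.cov k D.tf = D.cov k D.ricEnd - (algebraMap ℝ 𝒜 (1 / n) * D.d k D.scal) • 1 := by
  rw [tf, cov_sub, cov_smul, cov_one, smul_zero, add_zero, Derivation.leibniz,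
    Derivation.map_algebraMap]
  simp

/-- The constant is 1/2 - 1/n: contracted Bianchi for Ric, minus the derivative of the trace part.
-/
lemma dvgEnd_tf (hn : n ≠ 0) (i : Fin n) :
    D.dvgEnd D.tf i = algebraMap ℝ 𝒜 ((n - 2) / (2 * n)) * D.d i D.scal := by
  have h := D.contracted_bianchi i
  have h2 : ∑ k, D.cov k D.ricEnd k i = algebraMap ℝ 𝒜 (1 / 2) * D.d i D.scal := by
    rw [h, ← mul_assoc, ← map_ofNat (algebraMap ℝ 𝒜) 2, ← map_mul]; norm_num
  simp only [dvgEnd, cov_tf, Matrix.sub_apply, Matrix.smul_apply, Finset.sum_sub_distrib, h2,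
    one_apply, smul_eq_mul, mul_ite, mul_one, mul_zero, Finset.sum_ite_eq', Finset.mem_univ,
    if_true]
  rw [← sub_mul, ← map_sub]
  congr 2
  have : (n : ℝ) ≠ 0 := by exact_mod_cast hn
  field_simp

lemma cov_gradEnd (t : ℝ) (k : Fin n) : D.cov k (D.gradEnd t) =
    (2 : 𝒜) • D.cov k D.tf + (algebraMap ℝ 𝒜 (2 / n + 2 * t) * D.d k D.scal) • 1 := by
  have e : algebraMap ℝ 𝒜 (2 / n + 2 * t) = 2 * algebraMap ℝ 𝒜 (1 / n) + 2 * algebraMap ℝ 𝒜 t := by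
    rw [← map_ofNat (algebraMap ℝ 𝒜) 2, ← map_mul, ← map_mul, ← map_add]; congr 1; ring
  rw [gradEnd, cov_add, cov_smul, cov_smul, cov_one, cov_tf, e]
  simp only [Derivation.leibniz, Derivation.map_algebraMap, smul_zero, add_zero, smul_eq_mul,
    smul_sub, smul_smul]
  have : D.d k (2 : 𝒜) = 0 := by
    rw [← map_ofNat (algebraMap ℝ 𝒜) 2, Derivation.map_algebraMap]
  rw [this]
  module

lemma gradEnd_mul_H_symm (t : ℝ) : (D.gradEnd t * D.H)ᵀ = D.gradEnd t * D.H := by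
  rw [gradEnd, add_mul, transpose_add, smul_mul_assoc, smul_mul_assoc, one_mul, transpose_smul,
    transpose_smul, ricEnd_mul_H_symm, D.H_symm]

/-- The first variation of `|Ric|² + t R²` in the direction `ρ` times the trace-free Ricci tensor,
combined with the Bochner-type formula. -/
lemma first_variation (hn : n ≠ 0) (t : ℝ) (ρ : 𝒜) {C : Fin n → Matrix (Fin n) (Fin n) 𝒜}
    (hC : ∀ k m l, C k m l = C l m k)
    (hK : ∀ k, (C k)ᵀ * D.G + D.G * C k = D.G * D.cov k (ρ • D.tf)) :
    (D.gradEnd t * (D.H * D.linRic C)).trace - ρ * (D.gradEnd t * D.tf * D.ricEnd).trace =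
      D.dvg (fun l => ∑ i, ∑ k, (D.gradEnd t * D.H) i k * C k l i
        - ρ * (∑ j, (D.cov j D.tf * (D.tf * D.H)) l j
          - ∑ i, (D.tf * D.H) l i * D.dvgEnd D.tf i))
      + ρ * D.bochnerFun t + ∑ k, D.d k ρ * D.bochnerVec t k := by
  set L := D.tf with hL
  -- Twice the trace of `C k` is the derivative of the trace of the velocity ρ L, which is zero.
  have htr : ∀ k, (C k).trace = 0 := fun k => by
    have h1 : (D.H * ((C k)ᵀ * D.G)).trace = (C k).trace := by
      rw [← mul_assoc, trace_mul_comm, ← mul_assoc, D.GH, one_mul, trace_transpose]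
    have h2 : (D.H * (D.G * C k)).trace = (C k).trace := by rw [← mul_assoc, D.HG, one_mul]
    have h3 : (D.H * (D.G * D.cov k (ρ • L))).trace = 0 := by
      rw [← mul_assoc, D.HG, one_mul, trace_cov, trace_smul, hL, D.trace_tf hn, smul_zero, map_zero]
    rw [← hK k, mul_add, trace_add, h1, h2] at h3
    rw [← half_smul_add_half_smul (C k).trace, ← smul_add, h3, smul_zero]
  have hS : (D.gradEnd t * (D.H * D.linRic C)).trace
      = ∑ i, ∑ k, (D.gradEnd t * D.H) i k * D.linRic C i k := by
    rw [← mul_assoc, trace]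
    simp only [diag, mul_apply (M := D.gradEnd t * D.H) (N := D.linRic C)]
    rw [Finset.sum_comm]
    refine Finset.sum_congr rfl fun i _ => Finset.sum_congr rfl fun k _ => ?_
    have := congrFun (congrFun (D.gradEnd_mul_H_symm t) i) k
    rw [transpose_apply] at this
    rw [this]
  have hcu : ∀ l, D.covUp l (D.gradEnd t * D.H) = D.cov l (D.gradEnd t) * D.H :=
    fun l => D.covUp_mul_H l _
  rw [hS, D.sum_mul_linRic hC htr]
  simp only [hcu]
  rw [D.sum_mul_christoffel_variation hC hK (fun l => D.cov l (D.gradEnd t)) (fun l => by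
    rw [← hcu, covUp_transpose, gradEnd_mul_H_symm])]
  -- The integration by parts yields two copies of the crossed product of ∇L with itself. The
  -- Bochner-type formula replaces one by a divergence and curvature; the other will complete |∇L|²
  -- to a square.
  rw [dvg_sub, dvg_mul, D.dvg_bochner L D.tf_mul_H_symm]
  set β := algebraMap ℝ 𝒜 (2 / n + 2 * t) with hβ
  set κ := algebraMap ℝ 𝒜 ((n - 2) / (2 * n)) with hκ
  have hω : ∀ i, D.dvgEnd L i = κ * D.d i D.scal := D.dvgEnd_tf hn
  have hLc : ∀ k, (D.cov k L).trace = 0 := fun k => by rw [trace_cov, hL, D.trace_tf hn, map_zero]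
  have hdH : ∀ l, ∑ i, (D.cov i L * D.H) i l = κ * ∑ p, D.H p l * D.d p D.scal := fun l => by
    simp only [mul_apply]
    rw [Finset.sum_comm, Finset.mul_sum]
    refine Finset.sum_congr rfl fun p _ => ?_
    rw [← Finset.sum_mul]
    change D.dvgEnd L p * _ = _
    rw [hω]; ring
  have e1 : ∑ i, ∑ l, (D.cov l (D.gradEnd t) * D.cov i (ρ • L) * D.H) i l =
      2 * ∑ i, D.d i ρ * ∑ l, (D.cov l L * (L * D.H)) i l
      + β * ∑ i, D.d i ρ * ∑ l, (L * D.H) i l * D.d l D.scal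
      + ρ * (2 * ∑ k, ∑ j, (D.cov j L * D.cov k L * D.H) k j)
      + ρ * (β * κ * D.dscalSq) := by
    have h : ∀ i l, (D.cov l (D.gradEnd t) * D.cov i (ρ • L) * D.H) i l =
        2 * (D.d i ρ * (D.cov l L * (L * D.H)) i l) + β * (D.d i ρ * ((L * D.H) i l * D.d l D.scal))
        + ρ * (2 * (D.cov l L * D.cov i L * D.H) i l)
        + ρ * β * (D.d l D.scal * (D.cov i L * D.H) i l) := fun i l => by
      rw [cov_gradEnd, cov_smul]
      simp only [add_mul, mul_add, smul_mul_assoc, mul_smul_comm, one_mul, Matrix.add_apply,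
        Matrix.smul_apply, smul_eq_mul, mul_assoc, smul_add]
      ring
    simp only [h, Finset.sum_add_distrib, ← Finset.mul_sum]
    have h' : ∑ i, ∑ l, D.d l D.scal * (D.cov i L * D.H) i l = κ * D.dscalSq := by
      rw [Finset.sum_comm]
      simp only [← Finset.mul_sum, hdH]
      rw [dscalSq, Finset.sum_comm, Finset.mul_sum]
      refine Finset.sum_congr rfl fun l _ => ?_
      simp only [Finset.mul_sum]
      exact Finset.sum_congr rfl fun p _ => by ring
    rw [h']; ring
  have e2 : (1 / 2 : ℝ) • ∑ l, ∑ m, D.H l m * (D.cov l (D.gradEnd t) * D.cov m (ρ • L)).trace =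
      ∑ k, D.d k ρ * ∑ l, D.H k l * (D.cov l L * L).trace
      + ρ * ∑ l, ∑ m, D.H l m * (D.cov l L * D.cov m L).trace := by
    have h : ∀ l m, D.H l m * (D.cov l (D.gradEnd t) * D.cov m (ρ • L)).trace =
        2 * (D.d m ρ * (D.H m l * (D.cov l L * L).trace)
          + ρ * (D.H l m * (D.cov l L * D.cov m L).trace)) := fun l m => by
      rw [cov_gradEnd, cov_smul, D.H_apply_symm m l]
      simp only [add_mul, mul_add, smul_mul_assoc, mul_smul_comm, one_mul, trace_add,
        trace_smul, smul_eq_mul, hLc, smul_add, mul_zero]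
      rw [hL, D.trace_tf hn]
      ring
    simp only [h, ← Finset.mul_sum, Finset.sum_add_distrib]
    rw [Finset.sum_comm (f := fun l m => D.d m ρ * (D.H m l * (D.cov l L * L).trace))]
    simp only [← Finset.mul_sum]
    rw [two_mul, smul_add, half_smul_add_half_smul]
  have e3 : ∑ i, ∑ j, D.H i j * D.dvgEnd L i * D.dvgEnd L j = κ * κ * D.dscalSq := by
    simp only [hω, dscalSq, Finset.mul_sum]
    exact Finset.sum_congr rfl fun i _ => Finset.sum_congr rfl fun j _ => by ring
  have e4 : ∑ k, D.d k ρ * (∑ j, (D.cov j L * (L * D.H)) k j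
      - ∑ i, (L * D.H) k i * D.dvgEnd L i) =
      ∑ k, D.d k ρ * ∑ j, (D.cov j L * (L * D.H)) k j
      - κ * ∑ k, D.d k ρ * ∑ i, (L * D.H) k i * D.d i D.scal := by
    simp only [mul_sub, Finset.sum_sub_distrib, hω, Finset.mul_sum]
    congr 1
    exact Finset.sum_congr rfl fun i _ => Finset.sum_congr rfl fun j _ => by ring
  have e5 : ∑ k, D.d k ρ * D.bochnerVec t k =
      -∑ k, D.d k ρ * ∑ l, (D.cov l L * (L * D.H)) k l
      + ∑ k, D.d k ρ * ∑ l, D.H k l * (D.cov l L * L).trace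
      - (β + κ) * ∑ k, D.d k ρ * ∑ j, (L * D.H) k j * D.d j D.scal := by
    rw [hβ, hκ, ← map_add]
    rw [Finset.mul_sum, ← Finset.sum_neg_distrib, ← Finset.sum_add_distrib,
      ← Finset.sum_sub_distrib]
    refine Finset.sum_congr rfl fun k _ => ?_
    rw [bochnerVec]
    ring
  have e6 : algebraMap ℝ 𝒜 ((2 / n + 2 * t + (n - 2) / (2 * n)) * ((n - 2) / (2 * n)))
      = (β + κ) * κ := by rw [map_mul, map_add]
  rw [e1, e2, e3, e4, e5, bochnerFun, e6, ← hL]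
  ring

end MetricData
end QuadCurv
end

/-! ### Transformation of connection, curvature and covariant derivatives under coordinate changes.
-/

noncomputable section

namespace QuadCurv

namespace MetricData

open Matrix

variable {n : ℕ} {𝒜 ℬ : Type*} [CommRing 𝒜] [Algebra ℝ 𝒜] [CommRing ℬ] [Algebra ℝ ℬ]

/-- A change of coordinates between two metrics, with Jacobian matrix `J`. -/
structure CoordChange (D : MetricData n 𝒜) (D' : MetricData n ℬ) where
  Φ : 𝒜 →ₐ[ℝ] ℬ
  J : Matrix (Fin n) (Fin n) ℬ
  Ji : Matrix (Fin n) (Fin n) ℬ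
  J_mul_Ji : J * Ji = 1
  d_Φ : ∀ k f, D'.d k (Φ f) = ∑ p, J p k * Φ (D.d p f)
  d_J : ∀ k p l, D'.d k (J p l) = D'.d l (J p k)
  G_eq : D'.G = Jᵀ * D.G.map Φ * J

namespace CoordChange

variable {D : MetricData n 𝒜} {D' : MetricData n ℬ} (c : CoordChange D D')

/-- The pullback of a matrix of functions. -/
def pull (M : Matrix (Fin n) (Fin n) 𝒜) : Matrix (Fin n) (Fin n) ℬ := M.map c.Φ

lemma pull_apply (M : Matrix (Fin n) (Fin n) 𝒜) (i j : Fin n) : c.pull M i j = c.Φ (M i j) := rfl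

lemma pull_mul (M N : Matrix (Fin n) (Fin n) 𝒜) : c.pull (M * N) = c.pull M * c.pull N :=
  Matrix.map_mul

lemma pull_add (M N : Matrix (Fin n) (Fin n) 𝒜) : c.pull (M + N) = c.pull M + c.pull N := by
  ext; simp [pull]

lemma pull_sub (M N : Matrix (Fin n) (Fin n) 𝒜) : c.pull (M - N) = c.pull M - c.pull N := by
  ext; simp [pull]

lemma pull_one : c.pull 1 = 1 := by simp [pull]

lemma pull_transpose (M : Matrix (Fin n) (Fin n) 𝒜) : c.pull Mᵀ = (c.pull M)ᵀ := rfl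

lemma pull_smul (f : 𝒜) (M : Matrix (Fin n) (Fin n) 𝒜) : c.pull (f • M) = c.Φ f • c.pull M := by
  ext; simp [pull]

lemma pull_trace (M : Matrix (Fin n) (Fin n) 𝒜) : (c.pull M).trace = c.Φ M.trace := by
  simp [trace, pull]

lemma Ji_mul_J : c.Ji * c.J = 1 := mul_eq_one_comm.mp c.J_mul_Ji

lemma Ji_mul_J_mul (M : Matrix (Fin n) (Fin n) ℬ) : c.Ji * (c.J * M) = M := by
  rw [← mul_assoc, c.Ji_mul_J, one_mul]

lemma J_mul_Ji_mul (M : Matrix (Fin n) (Fin n) ℬ) : c.J * (c.Ji * M) = M := by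
  rw [← mul_assoc, c.J_mul_Ji, one_mul]

lemma JiT_mul_JT_mul (M : Matrix (Fin n) (Fin n) ℬ) : c.Jiᵀ * (c.Jᵀ * M) = M := by
  rw [← mul_assoc, ← transpose_mul, c.J_mul_Ji, transpose_one, one_mul]

/-- Conjugation by the Jacobian of a pulled back endomorphism. -/
def conj (M : Matrix (Fin n) (Fin n) 𝒜) : Matrix (Fin n) (Fin n) ℬ := c.Ji * c.pull M * c.J

lemma conj_mul (M N : Matrix (Fin n) (Fin n) 𝒜) : c.conj (M * N) = c.conj M * c.conj N := by
  simp only [conj, pull_mul, mul_assoc, c.J_mul_Ji_mul]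

lemma conj_sub (M N : Matrix (Fin n) (Fin n) 𝒜) : c.conj (M - N) = c.conj M - c.conj N := by
  simp only [conj, pull_sub, mul_sub, sub_mul]

lemma conj_smul (f : 𝒜) (M : Matrix (Fin n) (Fin n) 𝒜) : c.conj (f • M) = c.Φ f • c.conj M := by
  simp only [conj, pull_smul, mul_smul_comm, smul_mul_assoc]

lemma conj_one : c.conj 1 = 1 := by
  rw [conj, pull_one, mul_one, c.Ji_mul_J]

lemma conj_trace (M : Matrix (Fin n) (Fin n) 𝒜) : (c.conj M).trace = c.Φ M.trace := by
  rw [conj, trace_mul_comm, ← mul_assoc, c.J_mul_Ji, one_mul, pull_trace]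

lemma H_eq : D'.H = c.Ji * c.pull D.H * c.Jiᵀ := by
  apply D'.eq_of_G_mul_eq
  rw [D'.GH, c.G_eq]
  change 1 = c.Jᵀ * c.pull D.G * c.J * _
  simp only [mul_assoc, c.J_mul_Ji_mul]
  rw [← mul_assoc (c.pull D.G), ← pull_mul, D.GH, pull_one, one_mul, ← transpose_mul, c.Ji_mul_J,
    transpose_one]

lemma dM_pull (k : Fin n) (M : Matrix (Fin n) (Fin n) 𝒜) :
    D'.dM k (c.pull M) = ∑ p, c.J p k • c.pull (D.dM p M) := by
  ext i j
  simp [Matrix.sum_apply, pull_apply, c.d_Φ]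

lemma dM_Ji (k : Fin n) : D'.dM k c.Ji = -(c.Ji * D'.dM k c.J * c.Ji) := by
  have h : D'.dM k c.J * c.Ji + c.J * D'.dM k c.Ji = 0 := by
    rw [← dM_mul, c.J_mul_Ji, dM_one]
  have := congrArg (c.Ji * ·) h
  simp only [mul_add, mul_zero, c.Ji_mul_J_mul, ← mul_assoc] at this
  exact eq_neg_of_add_eq_zero_right this

/-- The pullback of the connection matrices. -/
def pullΓ (k : Fin n) : Matrix (Fin n) (Fin n) ℬ := ∑ p, c.J p k • c.pull (D.Γ p)

/-- The right side is torsion-free, by the symmetry of the derivatives of the Jacobian, and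
compatible with the metric, so `Γ_unique` identifies it. -/
lemma Γ_eq (k : Fin n) : D'.Γ k = c.Ji * D'.dM k c.J + c.Ji * c.pullΓ k * c.J := by
  refine (D'.Γ_unique (C := fun k => c.Ji * D'.dM k c.J + c.Ji * c.pullΓ k * c.J) ?_ ?_ k).symm
  · intro k m l
    have h1 : (c.Ji * D'.dM k c.J) m l = (c.Ji * D'.dM l c.J) m k := by
      simp only [mul_apply, dM_apply]
      exact Finset.sum_congr rfl fun p _ => by rw [c.d_J]
    have h2 : (c.Ji * c.pullΓ k * c.J) m l = (c.Ji * c.pullΓ l * c.J) m k := by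
      rw [mul_assoc, mul_assoc, mul_apply, mul_apply]
      refine Finset.sum_congr rfl fun q _ => ?_
      congr 1
      simp only [pullΓ, mul_apply, Matrix.sum_apply, Matrix.smul_apply, smul_eq_mul, Finset.sum_mul,
        pull_apply]
      rw [Finset.sum_comm]
      refine Finset.sum_congr rfl fun p _ => Finset.sum_congr rfl fun r _ => ?_
      rw [D.Γ_symm]; ring
    rw [Matrix.add_apply, Matrix.add_apply, h1, h2]
  · intro k
    have hG : D'.G = c.Jᵀ * c.pull D.G * c.J := c.G_eq
    have h3 : D'.dM k (c.pull D.G) = (c.pullΓ k)ᵀ * c.pull D.G + c.pull D.G * c.pullΓ k := by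
      rw [c.dM_pull, pullΓ, transpose_sum, Finset.sum_mul, Finset.mul_sum, ← Finset.sum_add_distrib]
      refine Finset.sum_congr rfl fun p _ => ?_
      rw [dM_G, pull_add, pull_mul, pull_mul, pull_transpose, smul_add, transpose_smul,
        smul_mul_assoc, mul_smul_comm]
    rw [hG, dM_mul, dM_mul, h3, dM_transpose]
    simp only [transpose_add, transpose_mul, add_mul, mul_add, mul_assoc, c.J_mul_Ji_mul,
      c.JiT_mul_JT_mul]
    abel

/-- `J` acts as a gauge transformation. All derivatives of `J` cancel, the remaining first-order
ones by the symmetry `d_J`. -/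
lemma Ω_eq (i j : Fin n) : D'.Ω i j = ∑ p, ∑ q, (c.J p i * c.J q j) • c.conj (D.Ω p q) := by
  have h1 : ∀ i j, D'.dM i (c.pullΓ j) = (∑ p, D'.d i (c.J p j) • c.pull (D.Γ p))
      + ∑ q, ∑ p, (c.J q i * c.J p j) • c.pull (D.dM q (D.Γ p)) := fun i j => by
    have : D'.dM i (c.pullΓ j) = ∑ p, D'.dM i (c.J p j • c.pull (D.Γ p)) := by
      ext a b; simp [pullΓ, Matrix.sum_apply]
    rw [this, Finset.sum_comm, ← Finset.sum_add_distrib]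
    refine Finset.sum_congr rfl fun p _ => ?_
    rw [dM_smul, c.dM_pull, Finset.smul_sum]
    simp only [smul_smul, mul_comm]
  have h2 : D'.Ω i j = c.Ji * (D'.dM i (c.pullΓ j) - D'.dM j (c.pullΓ i)
      + c.pullΓ i * c.pullΓ j - c.pullΓ j * c.pullΓ i) * c.J := by
    simp only [Ω, c.Γ_eq, dM_add, dM_mul, c.dM_Ji, D'.dM_comm j i c.J]
    simp only [mul_add, add_mul, mul_sub, sub_mul, mul_assoc, c.J_mul_Ji_mul, neg_mul]
    abel
  have h3 : ∑ p, D'.d i (c.J p j) • c.pull (D.Γ p) = ∑ p, D'.d j (c.J p i) • c.pull (D.Γ p) :=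
    Finset.sum_congr rfl fun p _ => by rw [c.d_J]
  have h4 : ∑ q, ∑ p, (c.J q j * c.J p i) • c.pull (D.dM q (D.Γ p)) =
      ∑ p, ∑ q, (c.J p i * c.J q j) • c.pull (D.dM q (D.Γ p)) := by
    rw [Finset.sum_comm]; simp only [mul_comm]
  have h5 : c.pullΓ i * c.pullΓ j = ∑ p, ∑ q, (c.J p i * c.J q j) • c.pull (D.Γ p * D.Γ q) := by
    simp only [pullΓ, Finset.sum_mul, Finset.mul_sum, pull_mul, smul_mul_assoc, mul_smul_comm,
      Finset.smul_sum, smul_smul]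
    rw [Finset.sum_comm]
    exact Finset.sum_congr rfl fun p _ => Finset.sum_congr rfl fun q _ => by rw [mul_comm]
  have h6 : c.pullΓ j * c.pullΓ i = ∑ p, ∑ q, (c.J p i * c.J q j) • c.pull (D.Γ q * D.Γ p) := by
    simp only [pullΓ, Finset.sum_mul, Finset.mul_sum, pull_mul, smul_mul_assoc, mul_smul_comm,
      Finset.smul_sum, smul_smul]
  have h7 : D'.dM i (c.pullΓ j) - D'.dM j (c.pullΓ i)
      + c.pullΓ i * c.pullΓ j - c.pullΓ j * c.pullΓ i
      = ∑ p, ∑ q, (c.J p i * c.J q j) • c.pull (D.Ω p q) := by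
    rw [h1, h1, h3, h4, h5, h6, add_sub_add_left_eq_sub]
    simp only [← Finset.sum_sub_distrib, ← Finset.sum_add_distrib, ← smul_sub, ← smul_add]
    simp only [Ω, pull_add, pull_sub]
  rw [h2, h7]
  simp only [Finset.mul_sum, Finset.sum_mul, mul_smul_comm, smul_mul_assoc, conj]

lemma Rm_eq (i j k l : Fin n) : D'.Rm i j k l =
    ∑ p, ∑ q, ∑ r, ∑ s, c.J p i * c.J q j * c.J r k * c.J s l * c.Φ (D.Rm p q r s) := by
  have hG : D'.G = c.Jᵀ * c.pull D.G * c.J := c.G_eq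
  have h : D'.G * D'.Ω i j = ∑ p, ∑ q, (c.J p i * c.J q j) •
      (c.Jᵀ * c.pull (D.G * D.Ω p q) * c.J) := by
    rw [c.Ω_eq, hG]
    simp only [Finset.mul_sum, mul_smul_comm, conj, pull_mul, mul_assoc, c.J_mul_Ji_mul]
  rw [Rm, h]
  simp only [Matrix.sum_apply, Matrix.smul_apply, smul_eq_mul]
  refine Finset.sum_congr rfl fun p _ => Finset.sum_congr rfl fun q _ => ?_
  rw [mul_assoc c.Jᵀ, mul_apply, Finset.mul_sum]
  refine Finset.sum_congr rfl fun r _ => ?_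
  rw [mul_apply, Finset.mul_sum, Finset.mul_sum]
  refine Finset.sum_congr rfl fun s _ => ?_
  rw [transpose_apply, pull_apply, Rm]
  ring

lemma Ric_eq : D'.Ric = c.Jᵀ * c.pull D.Ric * c.J := by
  ext i k
  rw [MetricData.Ric_eq]
  simp only [c.Ω_eq, Matrix.sum_apply, Matrix.smul_apply, smul_eq_mul]
  have h : ∀ p q, ∑ l, c.J p l * c.conj (D.Ω p q) l i = (c.pull (D.Ω p q) * c.J) p i := fun p q => by
    have : c.pull (D.Ω p q) * c.J = c.J * c.conj (D.Ω p q) := by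
      rw [conj, mul_assoc, c.J_mul_Ji_mul]
    rw [this, mul_apply]
  have h' : ∑ l, ∑ p, ∑ q, c.J p l * c.J q k * c.conj (D.Ω p q) l i =
      ∑ q, ∑ p, c.J q k * (c.pull (D.Ω p q) * c.J) p i := by
    rw [Finset.sum_comm, Finset.sum_comm (f := fun q p => c.J q k * (c.pull (D.Ω p q) * c.J) p i)]
    refine Finset.sum_congr rfl fun p _ => ?_
    rw [Finset.sum_comm]
    refine Finset.sum_congr rfl fun q _ => ?_
    rw [← h, Finset.mul_sum]
    exact Finset.sum_congr rfl fun l _ => by ring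
  rw [h', mul_apply]
  refine Finset.sum_congr rfl fun q _ => ?_
  rw [← Finset.mul_sum, mul_comm]
  congr 1
  simp only [mul_apply, pull_apply, MetricData.Ric_eq, transpose_apply, map_sum, Finset.mul_sum]
  rw [Finset.sum_comm]
  exact Finset.sum_congr rfl fun r _ => Finset.sum_congr rfl fun p _ => mul_comm _ _

lemma ricEnd_eq : D'.ricEnd = c.conj D.ricEnd := by
  rw [ricEnd, ricEnd, c.H_eq, c.Ric_eq, conj, pull_mul]
  simp only [mul_assoc, c.JiT_mul_JT_mul]

lemma scal_eq : D'.scal = c.Φ D.scal := by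
  rw [scal, c.ricEnd_eq, conj_trace, scal]

lemma tf_eq : D'.tf = c.conj D.tf := by
  rw [tf, tf, conj_sub, c.ricEnd_eq, c.scal_eq, conj_smul, conj_one, map_mul, AlgHom.commutes]

lemma cov_conj (k : Fin n) (M : Matrix (Fin n) (Fin n) 𝒜) :
    D'.cov k (c.conj M) = ∑ p, c.J p k • c.conj (D.cov p M) := by
  have h : D'.cov k (c.conj M) = c.Ji * (D'.dM k (c.pull M) + c.pullΓ k * c.pull M
      - c.pull M * c.pullΓ k) * c.J := by
    simp only [MetricData.cov, c.Γ_eq, conj, dM_mul, c.dM_Ji]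
    simp only [mul_add, add_mul, mul_sub, sub_mul, mul_assoc, c.J_mul_Ji_mul, neg_mul]
    abel
  rw [h, c.dM_pull, pullΓ, Finset.sum_mul, Finset.mul_sum, ← Finset.sum_add_distrib,
    ← Finset.sum_sub_distrib, Finset.mul_sum, Finset.sum_mul]
  refine Finset.sum_congr rfl fun p _ => ?_
  rw [conj, MetricData.cov, pull_sub, pull_add, pull_mul, pull_mul]
  simp only [smul_mul_assoc, mul_smul_comm, mul_add, add_mul, mul_sub, sub_mul, smul_add, smul_sub]

lemma d_scal (k : Fin n) : D'.d k D'.scal = ∑ p, c.J p k * c.Φ (D.d p D.scal) := by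
  rw [c.scal_eq, c.d_Φ]

lemma tf_mul_H : D'.tf * D'.H = c.Ji * c.pull (D.tf * D.H) * c.Jiᵀ := by
  rw [c.tf_eq, c.H_eq, conj, pull_mul]
  simp only [mul_assoc, c.J_mul_Ji_mul]

lemma sum_J_mul_Ji (p q : Fin n) : ∑ l, c.J p l * c.Ji l q = if p = q then 1 else 0 := by
  have := congrFun (congrFun c.J_mul_Ji p) q
  rwa [mul_apply, one_apply] at this

/-- Raising an index commutes with a change of coordinates. -/
lemma sum_raise (N : Matrix (Fin n) (Fin n) 𝒜) (w : Fin n → 𝒜) (i : Fin n) :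
    ∑ l, (c.Ji * c.pull N * c.Jiᵀ) i l * ∑ p, c.J p l * c.Φ (w p) =
      ∑ q, c.Ji i q * c.Φ (∑ p, N q p * w p) := by
  have h : ∀ p, ∑ l, (c.Ji * c.pull N * c.Jiᵀ) i l * c.J p l = (c.Ji * c.pull N) i p := fun p => by
    have : c.Ji * c.pull N = c.Ji * c.pull N * c.Jiᵀ * c.Jᵀ := by
      rw [mul_assoc (c.Ji * c.pull N), ← transpose_mul, c.J_mul_Ji, transpose_one, mul_one]
    conv_rhs => rw [this, mul_apply]
    rfl
  simp only [Finset.mul_sum]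
  rw [Finset.sum_comm]
  simp only [← mul_assoc, ← Finset.sum_mul, h]
  simp only [mul_apply, Finset.sum_mul, map_sum, map_mul, Finset.mul_sum, pull_apply]
  rw [Finset.sum_comm]
  simp only [mul_assoc]

lemma bochnerVec_eq (t : ℝ) (i : Fin n) :
    D'.bochnerVec t i = ∑ q, c.Ji i q * c.Φ (D.bochnerVec t q) := by
  have h1 : ∑ l, (D'.cov l D'.tf * (D'.tf * D'.H)) i l =
      ∑ q, c.Ji i q * c.Φ (∑ l, (D.cov l D.tf * (D.tf * D.H)) q l) := by
    have e : ∀ l, D'.cov l D'.tf * (D'.tf * D'.H) =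
        ∑ p, c.J p l • (c.Ji * c.pull (D.cov p D.tf * (D.tf * D.H)) * c.Jiᵀ) := fun l => by
      rw [c.tf_mul_H, c.tf_eq, c.cov_conj, Finset.sum_mul]
      refine Finset.sum_congr rfl fun p _ => ?_
      rw [smul_mul_assoc, conj, c.pull_mul (D.cov p D.tf)]
      simp only [mul_assoc, c.J_mul_Ji_mul]
    have e2 : ∀ p, ∑ l, (c.Ji * c.pull (D.cov p D.tf * (D.tf * D.H)) * c.Jiᵀ) i l * c.J p l
        = (c.Ji * c.pull (D.cov p D.tf * (D.tf * D.H))) i p := fun p => by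
      have : c.Ji * c.pull (D.cov p D.tf * (D.tf * D.H)) =
          c.Ji * c.pull (D.cov p D.tf * (D.tf * D.H)) * c.Jiᵀ * c.Jᵀ := by
        rw [mul_assoc (c.Ji * c.pull _), ← transpose_mul, c.J_mul_Ji, transpose_one, mul_one]
      conv_rhs => rw [this, mul_apply]
      rfl
    simp only [e, Matrix.sum_apply, Matrix.smul_apply, smul_eq_mul]
    rw [Finset.sum_comm]
    simp only [mul_comm (c.J _ _), e2]
    simp only [mul_apply (M := c.Ji), map_sum, Finset.mul_sum, pull_apply]
    exact Finset.sum_comm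
  have h2 : ∑ l, D'.H i l * (D'.cov l D'.tf * D'.tf).trace =
      ∑ q, c.Ji i q * c.Φ (∑ l, D.H q l * (D.cov l D.tf * D.tf).trace) := by
    rw [← c.sum_raise, ← c.H_eq]
    refine Finset.sum_congr rfl fun l _ => ?_
    rw [c.tf_eq, c.cov_conj, Finset.sum_mul, trace_sum]
    congr 1
    refine Finset.sum_congr rfl fun p _ => ?_
    rw [smul_mul_assoc, trace_smul, ← conj_mul, conj_trace, smul_eq_mul]
  have h3 : ∑ j, (D'.tf * D'.H) i j * D'.d j D'.scal =
      ∑ q, c.Ji i q * c.Φ (∑ j, (D.tf * D.H) q j * D.d j D.scal) := by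
    rw [← c.sum_raise, ← c.tf_mul_H]
    simp only [c.d_scal]
  simp only [bochnerVec, h1, h2, h3, map_sub, map_add, map_neg, map_mul, AlgHom.commutes, mul_sub,
    mul_add, mul_neg, Finset.sum_sub_distrib, Finset.sum_add_distrib, Finset.sum_neg_distrib]
  congr 1
  rw [Finset.mul_sum]
  exact Finset.sum_congr rfl fun q _ => by ring

/-- The pairing of a differential with the vector field of the Bochner-type formula is independent
of the coordinates. -/
lemma sum_mul_bochnerVec (t : ℝ) (w : Fin n → ℬ) (v : Fin n → ℬ)
    (hw : ∀ k, w k = ∑ p, c.J p k * v p) :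
    ∑ k, w k * D'.bochnerVec t k = ∑ p, v p * c.Φ (D.bochnerVec t p) := by
  have h : ∀ k, w k * D'.bochnerVec t k =
      ∑ p, ∑ q, c.J p k * v p * (c.Ji k q * c.Φ (D.bochnerVec t q)) := fun k => by
    rw [hw, c.bochnerVec_eq, Finset.sum_mul_sum]
  have h' : ∀ p q, ∑ k, c.J p k * v p * (c.Ji k q * c.Φ (D.bochnerVec t q)) =
      v p * c.Φ (D.bochnerVec t q) * (if p = q then 1 else 0) := fun p q => by
    rw [← c.sum_J_mul_Ji, Finset.mul_sum]
    exact Finset.sum_congr rfl fun k _ => by ring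
  simp only [h]
  rw [Finset.sum_comm]
  refine Finset.sum_congr rfl fun p _ => ?_
  rw [Finset.sum_comm]
  simp [h']

end CoordChange
end MetricData
end QuadCurv
end

/-! ### Invariance of the Bochner integrand; linear frames. -/

noncomputable section

namespace QuadCurv

namespace MetricData

open Matrix

variable {n : ℕ} {𝒜 ℬ : Type*} [CommRing 𝒜] [Algebra ℝ 𝒜] [CommRing ℬ] [Algebra ℝ ℬ]

lemma sum_comm₄ {ι M : Type*} [Fintype ι] [AddCommMonoid M] (F : ι → ι → ι → ι → M) :
    ∑ l, ∑ m, ∑ p, ∑ q, F l m p q = ∑ p, ∑ q, ∑ l, ∑ m, F l m p q := by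
  have : ∑ x : ι × ι, ∑ y : ι × ι, F x.1 x.2 y.1 y.2 = ∑ y : ι × ι, ∑ x : ι × ι, F x.1 x.2 y.1 y.2 :=
    Finset.sum_comm
  simpa only [Fintype.sum_prod_type] using this

lemma derivation_sum_apply {ι : Type*} (s : Finset ι) (δ : ι → Derivation ℝ 𝒜 𝒜) (f : 𝒜) :
    (∑ i ∈ s, δ i) f = ∑ i ∈ s, δ i f := by
  induction s using Finset.cons_induction with
  | empty => simp
  | cons a s ha ih => simp [Finset.sum_cons, ih]

namespace CoordChange

variable {D : MetricData n 𝒜} {D' : MetricData n ℬ} (c : CoordChange D D')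

lemma sum_H_mul (F : Fin n → Fin n → 𝒜) :
    ∑ l, ∑ m, D'.H l m * (∑ p, ∑ q, c.J p l * c.J q m * c.Φ (F p q)) =
      c.Φ (∑ p, ∑ q, D.H p q * F p q) := by
  have h : c.pull D.H = c.J * D'.H * c.Jᵀ := by
    rw [c.H_eq]
    simp only [mul_assoc, c.J_mul_Ji_mul]
    rw [← transpose_mul, c.J_mul_Ji, transpose_one, mul_one]
  have h' : ∀ p q, c.Φ (D.H p q) = ∑ l, ∑ m, D'.H l m * (c.J p l * c.J q m) := fun p q => by
    have := congrFun (congrFun h p) q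
    rw [pull_apply] at this
    rw [this, mul_apply, Finset.sum_comm]
    refine Finset.sum_congr rfl fun m _ => ?_
    rw [mul_apply, Finset.sum_mul]
    exact Finset.sum_congr rfl fun l _ => by rw [transpose_apply]; ring
  simp only [map_sum, map_mul, h', Finset.mul_sum, Finset.sum_mul]
  rw [sum_comm₄]
  refine Finset.sum_congr rfl fun p _ => Finset.sum_congr rfl fun q _ =>
    Finset.sum_congr rfl fun l _ => Finset.sum_congr rfl fun m _ => by ring

lemma sum_contract (F : Fin n → Fin n → Matrix (Fin n) (Fin n) 𝒜) :
    ∑ k, ∑ j, ((∑ p, ∑ q, (c.J p k * c.J q j) • c.conj (F p q)) * D'.H) k j =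
      c.Φ (∑ p, ∑ q, (F p q * D.H) p q) := by
  have h : ∀ p q, c.pull (F p q * D.H) = c.J * (c.conj (F p q) * D'.H) * c.Jᵀ := fun p q => by
    rw [c.H_eq, conj, pull_mul]
    simp only [mul_assoc, c.J_mul_Ji_mul]
    rw [← transpose_mul, c.J_mul_Ji, transpose_one, mul_one]
  have h' : ∀ p q, c.Φ ((F p q * D.H) p q) =
      ∑ l, ∑ m, c.J p l * c.J q m * (c.conj (F p q) * D'.H) l m := fun p q => by
    have := congrFun (congrFun (h p q) p) q
    rw [pull_apply] at this
    rw [this, mul_apply, Finset.sum_comm]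
    refine Finset.sum_congr rfl fun m _ => ?_
    rw [mul_apply, Finset.sum_mul]
    exact Finset.sum_congr rfl fun l _ => by rw [transpose_apply]; ring
  simp only [map_sum, h', Finset.sum_mul, Matrix.sum_apply, smul_mul_assoc, Matrix.smul_apply,
    smul_eq_mul]
  rw [sum_comm₄]

/-- Each of the five summands is a complete contraction, so the Jacobians cancel. This makes the
integrand a function on the manifold and permits its evaluation in an adapted frame. -/
lemma bochnerFun_eq (t : ℝ) : D'.bochnerFun t = c.Φ (D.bochnerFun t) := by
  have h1 : ∑ l, ∑ m, D'.H l m * (D'.cov l D'.tf * D'.cov m D'.tf).trace =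
      c.Φ (∑ l, ∑ m, D.H l m * (D.cov l D.tf * D.cov m D.tf).trace) := by
    rw [← c.sum_H_mul]
    refine Finset.sum_congr rfl fun l _ => Finset.sum_congr rfl fun m _ => ?_
    rw [c.tf_eq, c.cov_conj, c.cov_conj, Finset.sum_mul_sum, trace_sum]
    congr 1
    refine Finset.sum_congr rfl fun p _ => ?_
    rw [trace_sum]
    refine Finset.sum_congr rfl fun q _ => ?_
    rw [smul_mul_smul_comm, trace_smul, ← conj_mul, conj_trace, smul_eq_mul]
  have h2 : ∑ k, ∑ j, (D'.cov j D'.tf * D'.cov k D'.tf * D'.H) k j =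
      c.Φ (∑ k, ∑ j, (D.cov j D.tf * D.cov k D.tf * D.H) k j) := by
    rw [← c.sum_contract]
    refine Finset.sum_congr rfl fun k _ => Finset.sum_congr rfl fun j _ => ?_
    have e : D'.cov j D'.tf * D'.cov k D'.tf =
        ∑ p, ∑ q, (c.J p k * c.J q j) • c.conj (D.cov q D.tf * D.cov p D.tf) := by
      rw [c.tf_eq, c.cov_conj, c.cov_conj, Finset.sum_mul_sum, Finset.sum_comm]
      refine Finset.sum_congr rfl fun p _ => Finset.sum_congr rfl fun q _ => ?_
      rw [smul_mul_smul_comm, ← conj_mul, mul_comm]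
    rw [e]
  have h3 : D'.dscalSq = c.Φ D.dscalSq := by
    have := c.sum_H_mul (fun p q => D.d p D.scal * D.d q D.scal)
    simp only [dscalSq, mul_assoc] at this ⊢
    rw [← this]
    refine Finset.sum_congr rfl fun l _ => Finset.sum_congr rfl fun m _ => ?_
    rw [c.d_scal, c.d_scal, Finset.sum_mul_sum]
    congr 1
    refine Finset.sum_congr rfl fun p _ => Finset.sum_congr rfl fun q _ => ?_
    rw [map_mul]; ring
  have h4 : (D'.gradEnd t * D'.tf * D'.ricEnd).trace = c.Φ (D.gradEnd t * D.tf * D.ricEnd).trace := by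
    have : D'.gradEnd t = c.conj (D.gradEnd t) := by
      have e : D.gradEnd t = (2 : 𝒜) • D.ricEnd - (-(2 * algebraMap ℝ 𝒜 t * D.scal)) • 1 := by
        rw [gradEnd, neg_smul, sub_neg_eq_add]
      rw [e, conj_sub, conj_smul, conj_smul, conj_one, gradEnd, c.ricEnd_eq, c.scal_eq]
      simp only [map_neg, map_mul, map_ofNat, AlgHom.commutes, neg_smul, sub_neg_eq_add]
    rw [this, c.tf_eq, c.ricEnd_eq, ← conj_mul, ← conj_mul, conj_trace]
  have h5 : ∑ k, ∑ j, ((D'.Ω k j * D'.tf - D'.tf * D'.Ω k j) * (D'.tf * D'.H)) k j =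
      c.Φ (∑ k, ∑ j, ((D.Ω k j * D.tf - D.tf * D.Ω k j) * (D.tf * D.H)) k j) := by
    simp only [← mul_assoc]
    rw [← c.sum_contract]
    refine Finset.sum_congr rfl fun k _ => Finset.sum_congr rfl fun j _ => ?_
    rw [c.tf_eq, c.Ω_eq]
    simp only [Finset.sum_mul, Finset.mul_sum, smul_mul_assoc, mul_smul_comm,
      ← Finset.sum_sub_distrib, ← smul_sub, ← conj_mul, ← conj_sub]
  simp only [bochnerFun, h1, h2, h3, h4, h5, map_sub, map_add, map_mul, AlgHom.commutes]

end CoordChange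

variable (D : MetricData n 𝒜)

/-- The metric in linearly transformed coordinates. -/
def frame (P : Matrix (Fin n) (Fin n) ℝ) (hP : IsUnit P.det) : MetricData n 𝒜 where
  d k := ∑ p, P p k • D.d p
  -- The coefficients of `P` are constants, so the new derivations still commute; the frame need
  -- only be orthonormal at the one point of evaluation.
  d_comm i j f := by
    simp only [derivation_sum_apply, Derivation.smul_apply, map_sum,
      Derivation.map_smul, Finset.smul_sum]
    rw [Finset.sum_comm]
    refine Finset.sum_congr rfl fun p _ => Finset.sum_congr rfl fun q _ => ?_
    rw [D.d_comm, smul_comm]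
  G := (P.map (algebraMap ℝ 𝒜))ᵀ * D.G * P.map (algebraMap ℝ 𝒜)
  H := P⁻¹.map (algebraMap ℝ 𝒜) * D.H * (P⁻¹.map (algebraMap ℝ 𝒜))ᵀ
  G_symm := by
    rw [transpose_mul, transpose_mul, transpose_transpose, D.G_symm, mul_assoc]
  GH := by
    have h1 : P.map (algebraMap ℝ 𝒜) * P⁻¹.map (algebraMap ℝ 𝒜) = 1 := by
      rw [← Matrix.map_mul, Matrix.mul_nonsing_inv _ hP]; simp
    have h2 : P⁻¹.map (algebraMap ℝ 𝒜) * P.map (algebraMap ℝ 𝒜) = 1 := by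
      rw [← Matrix.map_mul, Matrix.nonsing_inv_mul _ hP]; simp
    simp only [mul_assoc]
    rw [← mul_assoc (P.map _) (P⁻¹.map _), h1, one_mul, ← mul_assoc D.G, D.GH, one_mul,
      ← transpose_mul, h2, transpose_one]

/-- The linear change of coordinates. -/
def frameChange (P : Matrix (Fin n) (Fin n) ℝ) (hP : IsUnit P.det) :
    CoordChange D (D.frame P hP) where
  Φ := AlgHom.id ℝ 𝒜
  J := P.map (algebraMap ℝ 𝒜)
  Ji := P⁻¹.map (algebraMap ℝ 𝒜)
  J_mul_Ji := by rw [← Matrix.map_mul, Matrix.mul_nonsing_inv _ hP]; simp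
  d_Φ k f := by
    simp [frame, derivation_sum_apply, Algebra.smul_def]
  d_J k p l := by simp
  G_eq := by simp [frame]

end MetricData
end QuadCurv
end

noncomputable section

namespace QuadCurv

/-! ### Pointwise inequalities in an orthonormal frame -/

section Pointwise

variable {n : ℕ}

/-- The right side is half the squared norm of T_kij - T_jik. The trace of this tensor is prescribed
by `v`, and a tensor is at least as large as its trace part. -/
lemma cotton_inequality (hn : 2 ≤ n) (T : Fin n → Fin n → Fin n → ℝ) (κ : ℝ) (v : Fin n → ℝ)
    (hs : ∀ k i j, T k i j = T k j i) (htr : ∀ k, ∑ i, T k i i = 0)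
    (hdiv : ∀ i, ∑ k, T k k i = κ * v i) :
    κ ^ 2 / (n - 1) * ∑ i, v i ^ 2 ≤
      ∑ l, ∑ i, ∑ j, T l i j * T l j i - ∑ k, ∑ j, ∑ i, T j k i * T k i j := by
  have hn1 : (0 : ℝ) < n - 1 := by
    have : (2 : ℝ) ≤ n := by exact_mod_cast hn
    linarith
  set δ : Fin n → Fin n → ℝ := fun i j => if i = j then 1 else 0 with hδ
  set V := ∑ i, v i ^ 2 with hV
  set X := ∑ l, ∑ i, ∑ j, T l i j * T l j i with hX
  set Y := ∑ k, ∑ j, ∑ i, T j k i * T k i j with hY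
  -- The value for which the bracket squared in `h0` has zero trace.
  set μ := κ / (n - 1) with hμ
  have h0 : 0 ≤ ∑ i, ∑ j, ∑ k, (T k i j - T j i k + μ * (δ i j * v k - δ i k * v j)) ^ 2 := by
    positivity
  have x1 : ∑ i, ∑ j, ∑ k, T k i j * T k i j = X := by
    have : ∀ i, ∑ j, ∑ k, T k i j * T k i j = ∑ k, ∑ j, T k i j * T k i j :=
      fun i => Finset.sum_comm
    simp only [this]
    rw [Finset.sum_comm]
    exact Finset.sum_congr rfl fun l _ => Finset.sum_congr rfl fun i _ =>
      Finset.sum_congr rfl fun j _ => by rw [hs l j i]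
  have x2 : ∑ i, ∑ j, ∑ k, T j i k * T j i k = X := by
    rw [← x1]
    exact Finset.sum_congr rfl fun i _ => Finset.sum_comm
  have y1 : ∑ i, ∑ j, ∑ k, T k i j * T j i k = Y := by
    have : ∀ i, ∑ j, ∑ k, T k i j * T j i k = ∑ k, ∑ j, T k i j * T j i k :=
      fun i => Finset.sum_comm
    simp only [this]
    rw [Finset.sum_comm, hY]
    have : ∀ k, ∑ j, ∑ i, T j k i * T k i j = ∑ i, ∑ j, T j k i * T k i j :=
      fun i => Finset.sum_comm
    simp only [this]
    exact Finset.sum_congr rfl fun k _ => Finset.sum_congr rfl fun i _ =>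
      Finset.sum_congr rfl fun j _ => by rw [hs j i k, mul_comm]
  have t1 : ∑ i, ∑ j, ∑ k, δ i j * v k * T k i j = 0 := by
    simp only [hδ, ite_mul, one_mul, zero_mul]
    have : ∀ i, ∑ j, ∑ k, (if i = j then v k * T k i j else 0) = ∑ k, v k * T k i i := fun i => by
      rw [Finset.sum_comm]; simp
    simp only [this]
    rw [Finset.sum_comm]
    simp only [← Finset.mul_sum, htr, mul_zero, Finset.sum_const_zero]
  have t2 : ∑ i, ∑ j, ∑ k, δ i j * v k * T j i k = κ * V := by
    simp only [hδ, ite_mul, one_mul, zero_mul]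
    have : ∀ i, ∑ j, ∑ k, (if i = j then v k * T j i k else 0) = ∑ k, v k * T i i k := fun i => by
      rw [Finset.sum_comm]; simp
    simp only [this]
    rw [Finset.sum_comm]
    simp only [← Finset.mul_sum, hdiv]
    rw [hV, Finset.mul_sum]
    exact Finset.sum_congr rfl fun k _ => by ring
  have t3 : ∑ i, ∑ j, ∑ k, δ i k * v j * T k i j = κ * V := by
    rw [← t2]
    exact Finset.sum_congr rfl fun i _ => Finset.sum_comm
  have t4 : ∑ i, ∑ j, ∑ k, δ i k * v j * T j i k = 0 := by
    rw [← t1]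
    exact Finset.sum_congr rfl fun i _ => Finset.sum_comm
  have d1 : ∑ i, ∑ j, ∑ k, δ i j * v k ^ 2 = n * V := by
    simp only [← Finset.mul_sum, ← Finset.sum_mul, ← hV]
    simp [hδ]
  have d1' : ∑ i, ∑ j, δ i j * ∑ k, v k ^ 2 = n * V := by
    simp only [← Finset.mul_sum] at d1
    exact d1
  have d2 : ∑ i, ∑ j, ∑ k, δ i k * v j ^ 2 = n * V := by
    rw [← d1]
    exact Finset.sum_congr rfl fun i _ => Finset.sum_comm
  have d3 : ∑ i, ∑ j, ∑ k, (δ i j * v k) * (δ i k * v j) = V := by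
    simp only [hδ, ite_mul, one_mul, zero_mul, mul_ite, mul_zero]
    simp only [Finset.sum_ite_eq, Finset.mem_univ, if_true, hV, sq]
  have key : ∑ i, ∑ j, ∑ k, (T k i j - T j i k + μ * (δ i j * v k - δ i k * v j)) ^ 2 =
      2 * X - 2 * Y - 4 * μ * κ * V + μ ^ 2 * (2 * n - 2) * V := by
    have e : ∀ i j k, (T k i j - T j i k + μ * (δ i j * v k - δ i k * v j)) ^ 2 =
        T k i j * T k i j + T j i k * T j i k - 2 * (T k i j * T j i k)
        + 2 * μ * (δ i j * v k * T k i j) - 2 * μ * (δ i j * v k * T j i k)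
        - 2 * μ * (δ i k * v j * T k i j) + 2 * μ * (δ i k * v j * T j i k)
        + μ ^ 2 * (δ i j * v k ^ 2) + μ ^ 2 * (δ i k * v j ^ 2)
        - 2 * μ ^ 2 * ((δ i j * v k) * (δ i k * v j)) := fun i j k => by
      have h1 : δ i j ^ 2 = δ i j := by simp [hδ]
      have h2 : δ i k ^ 2 = δ i k := by simp [hδ]
      linear_combination μ ^ 2 * v k ^ 2 * h1 + μ ^ 2 * v j ^ 2 * h2
    simp only [e, Finset.sum_add_distrib, Finset.sum_sub_distrib, ← Finset.mul_sum, x1, x2, y1, t1,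
      t2, t3, t4, d1', d2, d3]
    ring
  rw [key] at h0
  have e1 : μ * κ = κ ^ 2 / (n - 1) := by rw [hμ]; ring
  have e2 : μ ^ 2 * (2 * n - 2) = 2 * (κ ^ 2 / (n - 1)) := by rw [hμ]; field_simp
  have e3 : 2 * X - 2 * Y - 4 * μ * κ * V + μ ^ 2 * (2 * n - 2) * V
      = 2 * X - 2 * Y - 2 * (κ ^ 2 / (n - 1)) * V := by
    rw [e2]; linear_combination (-4 * V) * e1
  rw [e3] at h0
  linarith

/-- The sum of a function of two indices over distinct indices. -/
lemma sum_offdiag (f : Fin n → Fin n → ℝ) :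
    ∑ i, ∑ j, (if i = j then 0 else f i j) = ∑ i, ∑ j, f i j - ∑ i, f i i := by
  rw [← Finset.sum_sub_distrib]
  refine Finset.sum_congr rfl fun i _ => ?_
  have : f i i = ∑ j, if i = j then f i j else 0 := by simp
  rw [this, ← Finset.sum_sub_distrib]
  exact Finset.sum_congr rfl fun j _ => by split_ifs <;> simp

/-- Cauchy–Schwarz over off-diagonal pairs, between w_ij - c(a_i + a_j) and z_ij = a_i a_j - β(a_i²
+ a_j²) + γ. Since `w` has zero row and column sums, β and γ do not affect its pairing with `z`; the
part c(a_i + a_j) contributes the cubic sum; and β, γ make the squared norm of `z` an exact multiple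
of (∑ a²)². In the application w_ij = W_ijij, and the a_i are the eigenvalues of L. -/
lemma weyl_inequality (hn : 3 ≤ n) (a : Fin n → ℝ) (ha : ∑ i, a i = 0)
    (w : Fin n → Fin n → ℝ) (hw : ∀ i, ∑ j, w i j = 0) (hw' : ∀ j, ∑ i, w i j = 0)
    (hd : ∀ i, w i i = 0) (N : ℝ)
    (hN : 2 * ∑ i, ∑ j, (if i = j then 0 else
      (w i j - ((n : ℝ) - 4) / (Real.sqrt (2 * n) * ((n : ℝ) - 2)) * (a i + a j)) ^ 2) ≤ N) :
    |∑ i, ∑ j, w i j * (a i * a j) + ((n : ℝ) - 4) / (n - 2) * ∑ i, a i ^ 3| ≤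
      Real.sqrt (((n : ℝ) - 2) / (2 * (n - 1))) * Real.sqrt N * ∑ i, a i ^ 2 := by
  have hn3 : (3 : ℝ) ≤ n := by exact_mod_cast hn
  have hn2 : (n : ℝ) - 2 ≠ 0 := by linarith
  have hn1 : (n : ℝ) - 1 ≠ 0 := by linarith
  have hn0 : (n : ℝ) ≠ 0 := by linarith
  set c := ((n : ℝ) - 4) / (Real.sqrt (2 * n) * ((n : ℝ) - 2)) with hc
  set α := Real.sqrt (2 * n) / 2 with hα
  have hs2n : Real.sqrt (2 * n) ^ 2 = 2 * n := Real.sq_sqrt (by linarith)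
  have hsne : Real.sqrt (2 * n) ≠ 0 := (Real.sqrt_pos.mpr (by linarith)).ne'
  have hα2 : α ^ 2 = n / 2 := by rw [hα, div_pow, hs2n]; ring
  have hcα : 2 * c * α = ((n : ℝ) - 4) / (n - 2) := by rw [hc, hα]; field_simp
  set s := ∑ i, a i ^ 2 with hs
  set p3 := ∑ i, a i ^ 3 with hp3
  set p4 := ∑ i, a i ^ 4 with hp4
  -- The positive root of 2nβ² = (1 - 2β)², which removes ∑ a⁴ from the norm of `z`. It turns the
  -- cubic coefficient into 2cα, which explains the constant √(2n) in `c`.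
  set β := (α - 1) / (n - 2) with hβ
  -- Makes the off-diagonal entries of `z` sum to zero, which minimises their norm for this β.
  set γ := s / (n * (n - 1)) + 2 * β * s / n with hγ
  set z : Fin n → Fin n → ℝ := fun i j => a i * a j - β * (a i ^ 2 + a j ^ 2) + γ with hz
  have hβα : β * (n - 2) = α - 1 := by rw [hβ]; field_simp
  have hcard : ∑ _i : Fin n, (1 : ℝ) = n := by simp
  have dbl : ∀ f g : Fin n → ℝ, ∑ i, ∑ j, f i * g j = (∑ i, f i) * ∑ j, g j := fun f g => by
    rw [Finset.sum_mul_sum]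
  have q1 : ∑ i, ∑ j, (if i = j then 0 else (w i j - c * (a i + a j)) * z i j) =
      ∑ i, ∑ j, w i j * (a i * a j) + ((n : ℝ) - 4) / (n - 2) * p3 := by
    rw [sum_offdiag]
    have e1 : ∑ i, ∑ j, (w i j - c * (a i + a j)) * z i j = ∑ i, ∑ j, w i j * (a i * a j)
        + 2 * c * β * n * p3 := by
      have e : ∀ i j, (w i j - c * (a i + a j)) * z i j = w i j * (a i * a j)
          - (β * a i ^ 2) * w i j - w i j * (β * a j ^ 2) + γ * w i j
          - c * (a i ^ 2 * a j) - c * (a i * a j ^ 2) + c * β * (a i ^ 3 * 1)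
          + c * β * (a i * a j ^ 2) + c * β * (a i ^ 2 * a j) + c * β * (1 * a j ^ 3)
          - c * γ * (a i * 1) - c * γ * (1 * a j) := fun i j => by simp only [hz]; ring
      have e' : ∑ i, ∑ j, w i j * (β * a j ^ 2) = 0 := by
        rw [Finset.sum_comm]
        simp only [← Finset.sum_mul, hw', zero_mul, Finset.sum_const_zero]
      have e'' : ∑ i, ∑ j, (β * a i ^ 2) * w i j = 0 := by
        simp only [← Finset.mul_sum, hw, mul_zero, Finset.sum_const_zero]
      have e3 : ∑ i, ∑ j, γ * w i j = 0 := by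
        simp only [← Finset.mul_sum, hw, mul_zero, Finset.sum_const_zero]
      simp only [e, Finset.sum_add_distrib, Finset.sum_sub_distrib, e', e'', e3]
      simp only [← Finset.mul_sum (a := c * β), ← Finset.mul_sum (a := c),
        ← Finset.mul_sum (a := c * γ)]
      rw [dbl, dbl, dbl (fun i => a i ^ 3) (fun _ => 1), dbl (fun _ => 1) (fun j => a j ^ 3),
        dbl (fun i => a i) (fun _ => 1), dbl (fun _ => 1) (fun j => a j), hcard, ha]
      ring
    have e2 : ∑ i, (w i i - c * (a i + a i)) * z i i = -(2 * c * (1 - 2 * β)) * p3 := by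
      have e : ∀ i, (w i i - c * (a i + a i)) * z i i =
          -(2 * c * (1 - 2 * β)) * a i ^ 3 - 2 * c * γ * a i := fun i => by
        simp only [hz, hd]; ring
      simp only [e, Finset.sum_sub_distrib, ← Finset.mul_sum, ha]
      ring
    rw [e1, e2]
    linear_combination p3 * hcα + 2 * c * p3 * hβα
  have q2 : ∑ i, ∑ j, (if i = j then 0 else z i j ^ 2) = (n - 2) / (n - 1) * s ^ 2 := by
    rw [sum_offdiag]
    have e1 : ∑ i, ∑ j, z i j ^ 2 = s ^ 2 + β ^ 2 * (2 * n * p4 + 2 * s ^ 2) + n ^ 2 * γ ^ 2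
        - 4 * β * γ * n * s := by
      have e : ∀ i j, z i j ^ 2 = a i ^ 2 * a j ^ 2 + β ^ 2 * (a i ^ 4 * 1) + β ^ 2 * (1 * a j ^ 4)
          + 2 * β ^ 2 * (a i ^ 2 * a j ^ 2) + γ ^ 2 * (1 * 1) - 2 * β * (a i ^ 3 * a j)
          - 2 * β * (a i * a j ^ 3) + 2 * γ * (a i * a j) - 2 * β * γ * (a i ^ 2 * 1)
          - 2 * β * γ * (1 * a j ^ 2) := fun i j => by simp only [hz]; ring
      simp only [e, Finset.sum_add_distrib, Finset.sum_sub_distrib]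
      simp only [← Finset.mul_sum (a := β ^ 2), ← Finset.mul_sum (a := 2 * β ^ 2),
        ← Finset.mul_sum (a := γ ^ 2), ← Finset.mul_sum (a := 2 * β), ← Finset.mul_sum (a := 2 * γ),
        ← Finset.mul_sum (a := 2 * β * γ)]
      rw [dbl, dbl (fun i => a i ^ 4) (fun _ => 1), dbl (fun _ => 1) (fun j => a j ^ 4),
        dbl (fun _ => 1) (fun _ => 1), dbl (fun i => a i ^ 3) a, dbl a, dbl a a,
        dbl (fun i => a i ^ 2) (fun _ => 1), dbl (fun _ => 1) (fun j => a j ^ 2), hcard, ha]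
      ring
    have e2 : ∑ i, z i i ^ 2 = (1 - 2 * β) ^ 2 * p4 + 2 * γ * (1 - 2 * β) * s + n * γ ^ 2 := by
      have e : ∀ i, z i i ^ 2 = (1 - 2 * β) ^ 2 * a i ^ 4 + 2 * γ * (1 - 2 * β) * a i ^ 2
          + γ ^ 2 * 1 := fun i => by simp only [hz]; ring
      simp only [e, Finset.sum_add_distrib, ← Finset.mul_sum, hcard]
      ring
    rw [e1, e2]
    have hp : 2 * n * β ^ 2 - (1 - 2 * β) ^ 2 = 0 := by
      have h1 : (n - 2 : ℝ) * (2 * n * β ^ 2 - (1 - 2 * β) ^ 2) = 0 := by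
        have h2 : (n - 2 : ℝ) * (2 * n * β ^ 2 - (1 - 2 * β) ^ 2)
          = 2 * (β * (n - 2)) ^ 2 + 4 * (β * (n - 2)) - (n - 2) := by ring
        rw [h2, hβα]
        linear_combination 2 * hα2
      exact (mul_eq_zero.mp h1).resolve_left hn2
    have hβ2 : β ^ 2 = (1 - 4 * β) / (2 * (n - 2)) := by
      rw [eq_div_iff (by positivity)]
      linear_combination hp
    have : s ^ 2 + β ^ 2 * (2 * n * p4 + 2 * s ^ 2) + n ^ 2 * γ ^ 2 - 4 * β * γ * n * s
        - ((1 - 2 * β) ^ 2 * p4 + 2 * γ * (1 - 2 * β) * s + n * γ ^ 2)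
        = s ^ 2 + 2 * β ^ 2 * s ^ 2 + n * (n - 1) * γ ^ 2 - 4 * β * γ * (n - 1) * s - 2 * γ * s := by
      linear_combination p4 * hp
    rw [this]
    have hγ' : γ = s * (1 + 2 * β * (n - 1)) / (n * (n - 1)) := by rw [hγ]; field_simp
    have h3 : s ^ 2 + 2 * β ^ 2 * s ^ 2 + n * (n - 1) * γ ^ 2 - 4 * β * γ * (n - 1) * s - 2 * γ * s
        = s ^ 2 * (1 + 2 * β ^ 2 - (1 + 2 * β * (n - 1)) ^ 2 / (n * (n - 1))) := by
      rw [hγ']; field_simp; ring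
    rw [h3]
    have h4 : 1 + 2 * β ^ 2 - (1 + 2 * β * (n - 1)) ^ 2 / (n * (n - 1))
        = 1 - 1 / (n * (n - 1)) - 4 * β / n - β ^ 2 * (2 * (n - 2)) / n := by
      field_simp; ring
    rw [h4, hβ2]
    field_simp
    ring
  have hcs : (∑ i, ∑ j, (if i = j then 0 else (w i j - c * (a i + a j)) * z i j)) ^ 2 ≤
      (∑ i, ∑ j, (if i = j then 0 else (w i j - c * (a i + a j)) ^ 2)) *
      ∑ i, ∑ j, (if i = j then 0 else z i j ^ 2) := by
    have := Finset.sum_mul_sq_le_sq_mul_sq (Finset.univ : Finset (Fin n × Fin n))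
      (fun x => if x.1 = x.2 then 0 else w x.1 x.2 - c * (a x.1 + a x.2))
      (fun x => if x.1 = x.2 then 0 else z x.1 x.2)
    simp only [Fintype.sum_prod_type, ite_mul, mul_ite, ite_pow, zero_mul, mul_zero] at this
    refine le_trans (le_of_eq ?_) (this.trans (le_of_eq ?_))
    · congr 1
      refine Finset.sum_congr rfl fun i _ => Finset.sum_congr rfl fun j _ => ?_
      split_ifs <;> rfl
    · congr 1 <;>
      refine Finset.sum_congr rfl fun i _ => Finset.sum_congr rfl fun j _ => ?_ <;>
      split_ifs <;> simp
  rw [q1, q2] at hcs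
  have hs0 : 0 ≤ s := by positivity
  have hfr : 0 ≤ ((n : ℝ) - 2) / (2 * (n - 1)) :=
    div_nonneg (by linarith) (by linarith)
  have hfin : (∑ i, ∑ j, w i j * (a i * a j) + ((n : ℝ) - 4) / (n - 2) * p3) ^ 2 ≤
      ((n : ℝ) - 2) / (2 * (n - 1)) * N * s ^ 2 := by
    refine hcs.trans ?_
    have : ((n : ℝ) - 2) / (n - 1) = 2 * (((n : ℝ) - 2) / (2 * (n - 1))) := by field_simp
    rw [this]
    have h0 : 0 ≤ ((n : ℝ) - 2) / (2 * (n - 1)) * s ^ 2 := by positivity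
    nlinarith [mul_le_mul_of_nonneg_left hN h0]
  have := Real.abs_le_sqrt hfin
  rwa [Real.sqrt_mul' _ (by positivity), Real.sqrt_mul hfr, Real.sqrt_sq hs0] at this

end Pointwise
end QuadCurv
end

/-! ### Tensor norms in a frame, and the pointwise lower bound of the Bochner integrand. -/

noncomputable section

namespace QuadCurv

open Matrix

section Frame

variable {n : ℕ}

/-- The components of a 4-tensor in the frame given by the columns of `P`. -/
def frame₄ (P : Matrix (Fin n) (Fin n) ℝ) (T : Fin n → Fin n → Fin n → Fin n → ℝ)
    (i j k l : Fin n) : ℝ :=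
  ∑ p, ∑ q, ∑ r, ∑ s, P p i * P q j * P r k * P s l * T p q r s

/-- Substituting g⁻¹ = P Pᵀ in the four index slots turns the full contraction into a sum of squares
of frame components. Treating a quadruple of indices as one index reduces this to a matrix identity.
-/
lemma normSq₄_eq_frame {g P : Matrix (Fin n) (Fin n) ℝ} (h : g⁻¹ = P * Pᵀ)
    (T : Fin n → Fin n → Fin n → Fin n → ℝ) :
    normSq₄ g T = ∑ i, ∑ j, ∑ k, ∑ l, frame₄ P T i j k l ^ 2 := by
  have hg : ∀ i a, g⁻¹ i a = ∑ p, P i p * P a p := fun i a => by rw [h, mul_apply]; rfl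
  let ι := Fin n × Fin n × Fin n × Fin n
  let Q : ι → ι → ℝ := fun I S => P I.1 S.1 * P I.2.1 S.2.1 * P I.2.2.1 S.2.2.1 * P I.2.2.2 S.2.2.2
  let τ : ι → ℝ := fun I => T I.1 I.2.1 I.2.2.1 I.2.2.2
  have h1 : ∀ I A : ι, g⁻¹ I.1 A.1 * g⁻¹ I.2.1 A.2.1 * g⁻¹ I.2.2.1 A.2.2.1 * g⁻¹ I.2.2.2 A.2.2.2
      = ∑ S, Q I S * Q A S := fun I A => by
    have e : ∀ p q r s : Fin n, P I.1 p * P I.2.1 q * P I.2.2.1 r * P I.2.2.2 s *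
        (P A.1 p * P A.2.1 q * P A.2.2.1 r * P A.2.2.2 s) = (P I.1 p * P A.1 p) *
        ((P I.2.1 q * P A.2.1 q) * ((P I.2.2.1 r * P A.2.2.1 r) * (P I.2.2.2 s * P A.2.2.2 s))) :=
      fun p q r s => by ring
    simp only [Q, ι, Fintype.sum_prod_type, e, ← Finset.mul_sum, ← Finset.sum_mul, hg]
    ring
  have h2 : normSq₄ g T = ∑ I : ι, ∑ A : ι, (∑ S, Q I S * Q A S) * τ I * τ A := by
    simp only [← h1]
    simp only [normSq₄, ι, τ, Fintype.sum_prod_type]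
  have h3 : ∑ i, ∑ j, ∑ k, ∑ l, frame₄ P T i j k l ^ 2 = ∑ S : ι, (∑ I, Q I S * τ I) ^ 2 := by
    simp only [frame₄, ι, Q, τ, Fintype.sum_prod_type]
  rw [h2, h3]
  have h4 : ∀ S : ι, (∑ I, Q I S * τ I) ^ 2 = ∑ I, ∑ A, Q I S * Q A S * τ I * τ A := fun S => by
    rw [sq, Finset.sum_mul_sum]
    exact Finset.sum_congr rfl fun I _ => Finset.sum_congr rfl fun A _ => by ring
  simp only [h4, Finset.sum_mul]
  have h5 : ∀ I : ι, ∑ A : ι, ∑ S : ι, Q I S * Q A S * τ I * τ A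
      = ∑ S : ι, ∑ A : ι, Q I S * Q A S * τ I * τ A := fun I => Finset.sum_comm
  simp only [h5]
  exact Finset.sum_comm

lemma frame₄_mul_13_24 (P A B : Matrix (Fin n) (Fin n) ℝ) (i j k l : Fin n) :
    frame₄ P (fun p q r s => A p r * B q s) i j k l = (Pᵀ * A * P) i k * (Pᵀ * B * P) j l := by
  have e : ∀ (A : Matrix (Fin n) (Fin n) ℝ) i k, (Pᵀ * A * P) i k =
      ∑ p, ∑ r, P p i * A p r * P r k := fun A i k => by
    rw [mul_assoc, mul_apply]
    refine Finset.sum_congr rfl fun p _ => ?_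
    rw [mul_apply, Finset.mul_sum]
    exact Finset.sum_congr rfl fun r _ => by rw [transpose_apply]; ring
  rw [e, e, frame₄, Finset.sum_mul_sum]
  refine Finset.sum_congr rfl fun p _ => Finset.sum_congr rfl fun q _ => ?_
  rw [Finset.sum_mul_sum]
  exact Finset.sum_congr rfl fun r _ => Finset.sum_congr rfl fun s _ => by ring

lemma frame₄_mul_14_23 (P A B : Matrix (Fin n) (Fin n) ℝ) (i j k l : Fin n) :
    frame₄ P (fun p q r s => A p s * B q r) i j k l = (Pᵀ * A * P) i l * (Pᵀ * B * P) j k := by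
  rw [← frame₄_mul_13_24, frame₄, frame₄]
  refine Finset.sum_congr rfl fun p _ => Finset.sum_congr rfl fun q _ => ?_
  rw [Finset.sum_comm]
  exact Finset.sum_congr rfl fun r _ => Finset.sum_congr rfl fun s _ => by ring

lemma frame₄_add (P : Matrix (Fin n) (Fin n) ℝ) (S T : Fin n → Fin n → Fin n → Fin n → ℝ)
    (i j k l : Fin n) : frame₄ P (fun p q r s => S p q r s + T p q r s) i j k l
      = frame₄ P S i j k l + frame₄ P T i j k l := by
  simp only [frame₄, mul_add, Finset.sum_add_distrib]

lemma frame₄_sub (P : Matrix (Fin n) (Fin n) ℝ) (S T : Fin n → Fin n → Fin n → Fin n → ℝ)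
    (i j k l : Fin n) : frame₄ P (fun p q r s => S p q r s - T p q r s) i j k l
      = frame₄ P S i j k l - frame₄ P T i j k l := by
  simp only [frame₄, mul_sub, Finset.sum_sub_distrib]

lemma frame₄_smul (P : Matrix (Fin n) (Fin n) ℝ) (x : ℝ) (T : Fin n → Fin n → Fin n → Fin n → ℝ)
    (i j k l : Fin n) :
    frame₄ P (fun p q r s => x * T p q r s) i j k l = x * frame₄ P T i j k l := by
  simp only [frame₄, Finset.mul_sum]
  refine Finset.sum_congr rfl fun p _ => Finset.sum_congr rfl fun q _ =>
      Finset.sum_congr rfl fun r _ => Finset.sum_congr rfl fun s _ => by ring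

lemma frame₄_kulkarniNomizu (P A B : Matrix (Fin n) (Fin n) ℝ) (i j k l : Fin n) :
    frame₄ P (kulkarniNomizu A B) i j k l =
      kulkarniNomizu (Pᵀ * A * P) (Pᵀ * B * P) i j k l := by
  have : kulkarniNomizu A B = fun p q r s => (A p r * B q s - A p s * B q r)
      + (B p r * A q s - B p s * A q r) := by
    ext p q r s; simp only [kulkarniNomizu]; ring
  rw [this, frame₄_add, frame₄_sub, frame₄_sub, frame₄_mul_13_24, frame₄_mul_14_23,
    frame₄_mul_13_24, frame₄_mul_14_23]
  simp only [kulkarniNomizu]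
  ring

/-- Only the components S_ijij and S_ijji are kept. Nothing else is needed, because W(L, L) sees
only these once L is diagonal; the two equal squares account for the factor 2. -/
lemma two_mul_sum_le_sum_sq (S : Fin n → Fin n → Fin n → Fin n → ℝ)
    (hS : ∀ i j, S i j j i = -S i j i j) :
    2 * ∑ i, ∑ j, (if i = j then 0 else S i j i j ^ 2) ≤ ∑ i, ∑ j, ∑ k, ∑ l, S i j k l ^ 2 := by
  rw [Finset.mul_sum]
  refine Finset.sum_le_sum fun i _ => ?_
  rw [Finset.mul_sum]
  refine Finset.sum_le_sum fun j _ => ?_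
  split_ifs with h
  · rw [mul_zero]; positivity
  · have h1 : ∑ x ∈ ({(i, j), (j, i)} : Finset (Fin n × Fin n)), S i j x.1 x.2 ^ 2 ≤
        ∑ x : Fin n × Fin n, S i j x.1 x.2 ^ 2 :=
      Finset.sum_le_sum_of_subset_of_nonneg (Finset.subset_univ _) fun _ _ _ => sq_nonneg _
    rw [Finset.sum_pair (by simp [h]), Fintype.sum_prod_type, hS] at h1
    linarith

open scoped MatrixOrder Matrix.Norms.L2Operator in
/-- Simultaneous diagonalization of a positive definite and a symmetric matrix. -/
lemma exists_frame {G A : Matrix (Fin n) (Fin n) ℝ} (hG : G.PosDef) (hA : Aᵀ = A) :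
    ∃ (P : Matrix (Fin n) (Fin n) ℝ) (a : Fin n → ℝ), IsUnit P.det ∧ Pᵀ * G * P = 1 ∧
      Pᵀ * A * P = diagonal a := by
  -- With G = BᵀB, an orthogonal diagonalisation U of B⁻ᵀ A B⁻¹ gives the frame P = B⁻¹U.
  obtain ⟨B, hB⟩ := CStarAlgebra.nonneg_iff_eq_star_mul_self.mp hG.posSemidef.nonneg
  have hB' : G = Bᵀ * B := by rw [hB, star_eq_conjTranspose, conjTranspose_eq_transpose_of_trivial]
  have hdet : IsUnit B.det := by
    have := hG.det_pos
    rw [hB', det_mul, det_transpose] at this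
    exact isUnit_iff_ne_zero.mpr fun h => by simp [h] at this
  have hBB : B * B⁻¹ = 1 := mul_nonsing_inv _ hdet
  have hA₀ : (B⁻¹ᵀ * A * B⁻¹).IsHermitian := by
    rw [IsHermitian, conjTranspose_eq_transpose_of_trivial, transpose_mul, transpose_mul,
      transpose_transpose, hA, mul_assoc]
  set U : Matrix (Fin n) (Fin n) ℝ := hA₀.eigenvectorUnitary.1 with hU
  have hUU : Uᵀ * U = 1 := by
    have := Unitary.coe_star_mul_self hA₀.eigenvectorUnitary
    rwa [star_eq_conjTranspose, conjTranspose_eq_transpose_of_trivial] at this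
  refine ⟨B⁻¹ * U, hA₀.eigenvalues, ?_, ?_, ?_⟩
  · rw [det_mul]
    refine IsUnit.mul ?_ ?_
    · exact isUnit_nonsing_inv_det _ hdet
    · have := congrArg det hUU
      rw [det_mul, det_one] at this
      exact IsUnit.of_mul_eq_one _ (by rw [mul_comm]; exact this)
  · calc (B⁻¹ * U)ᵀ * G * (B⁻¹ * U) = Uᵀ * ((B * B⁻¹)ᵀ * (B * B⁻¹)) * U := by
          rw [hB']; simp only [transpose_mul, mul_assoc]
      _ = 1 := by rw [hBB, transpose_one, mul_one, mul_one, hUU]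
  · have := hA₀.conjStarAlgAut_star_eigenvectorUnitary
    rw [Unitary.conjStarAlgAut_star_apply, star_eq_conjTranspose,
      conjTranspose_eq_transpose_of_trivial] at this
    calc (B⁻¹ * U)ᵀ * A * (B⁻¹ * U) = Uᵀ * (B⁻¹ᵀ * A * B⁻¹) * U := by
          simp only [transpose_mul, mul_assoc]
      _ = _ := this

end Frame
namespace MetricData

variable {n : ℕ} {𝒜 : Type*} [CommRing 𝒜] [Algebra ℝ 𝒜] (D : MetricData n 𝒜) (ev : 𝒜 →ₐ[ℝ] ℝ)

lemma G_mul_tf : D.G * D.tf = D.Ric - (algebraMap ℝ 𝒜 (1 / n) * D.scal) • D.G := by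
  rw [tf, mul_sub, G_mul_ricEnd, mul_smul_comm, mul_one]

lemma G_mul_tf_symm : (D.G * D.tf)ᵀ = D.G * D.tf := by
  rw [G_mul_tf, transpose_sub, transpose_smul, D.Ric_symm, D.G_symm]

lemma G_mul_cov_tf_symm (k : Fin n) : (D.G * D.cov k D.tf)ᵀ = D.G * D.cov k D.tf := by
  rw [← covLow_G_mul, covLow_transpose, G_mul_tf_symm]

/-- In an orthonormal frame diagonalising L everything reduces to the eigenvalues a_i, the sectional
components of the curvature and the components of ∇L. `cotton_inequality` disposes of the gradient
terms, `weyl_inequality` of the Weyl and cubic terms, and a multiple of R ∑ a² remains. -/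
lemma bochnerFun_lower_bound (hn : 3 ≤ n) (t : ℝ) (ht : t ≤ -((n : ℝ) / (4 * (n - 1))))
    (hG : D.G.map ev = 1) (a : Fin n → ℝ) (ha : D.tf.map ev = diagonal a) (N : ℝ)
    (hN : 2 * ∑ i, ∑ j, (if i = j then 0 else
      (ev (D.Rm i j i j) - 1 / ((n : ℝ) - 2) * ((a i + ev D.scal / n) + (a j + ev D.scal / n))
        + ev D.scal / (((n : ℝ) - 1) * (n - 2))
        - ((n : ℝ) - 4) / (Real.sqrt (2 * n) * ((n : ℝ) - 2)) * (a i + a j)) ^ 2) ≤ N) :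
    (-((2 * ((n : ℝ) - 2) + 2 * n * (n - 1) * t) / n + 1) * ev D.scal / (n - 1)
      - Real.sqrt (((n : ℝ) - 2) / (2 * (n - 1))) * Real.sqrt N) * ∑ i, a i ^ 2 ≤
      ev (D.bochnerFun t) := by
  have hn3 : (3 : ℝ) ≤ n := by exact_mod_cast hn
  have hn2 : (n : ℝ) - 2 ≠ 0 := by linarith
  have hn1 : (n : ℝ) - 1 ≠ 0 := by linarith
  have hn0 : (n : ℝ) ≠ 0 := by linarith
  have hnn : n ≠ 0 := by omega
  have hH : D.H.map ev = 1 := by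
    have := congrArg (fun M => M.map ev) D.GH
    simpa [Matrix.map_mul, hG] using this
  have hH' : ∀ i j, ev (D.H i j) = if i = j then 1 else 0 := fun i j => by
    have := congrFun (congrFun hH i) j
    rwa [map_apply, one_apply] at this
  have htf : ∀ i j, ev (D.tf i j) = if i = j then a i else 0 := fun i j => by
    have := congrFun (congrFun ha i) j
    rwa [map_apply, diagonal_apply] at this
  set R := ev D.scal with hR
  set ρ : Fin n → ℝ := fun i => a i + R / n with hρ
  have hric : D.ricEnd.map ev = diagonal ρ := by
    have : D.ricEnd = D.tf + (algebraMap ℝ 𝒜 (1 / n) * D.scal) • 1 := by rw [tf, sub_add_cancel]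
    ext i j
    rw [this, map_apply, Matrix.add_apply, map_add, htf, Matrix.smul_apply, one_apply, diagonal_apply]
    split_ifs with h
    · simp only [smul_eq_mul, mul_one, map_mul, AlgHom.commutes, hρ, ← hR]
      simp; ring
    · simp
  have hRic : ∀ j, ev (D.Ric j j) = ρ j := fun j => by
    have : D.Ric.map ev = diagonal ρ := by
      rw [← D.G_mul_ricEnd, Matrix.map_mul, hG, one_mul, hric]
    have := congrFun (congrFun this j) j
    rwa [map_apply, diagonal_apply_eq] at this
  set r : Fin n → Fin n → ℝ := fun i j => ev (D.Rm i j i j) with hr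
  have hΩ : ∀ i j k l, ev (D.Ω i j k l) = ev (D.Rm i j k l) := fun i j k l => by
    rw [Ω_apply, map_sum]
    simp [hH']
  have hrs : ∀ i j, r i j = r j i := fun i j => by
    simp only [hr]; rw [D.Rm_antisymm_left, D.Rm_antisymm_right, neg_neg]
  have hrd : ∀ i, r i i = 0 := fun i => by
    have := congrArg ev (D.Rm_antisymm_left i i i i)
    rw [map_neg] at this
    simp only [hr]; linarith
  have hrsum : ∀ j, ∑ l, r l j = ρ j := fun j => by
    rw [← hRic, D.Ric_eq, map_sum]
    exact Finset.sum_congr rfl fun l _ => (hΩ _ _ _ _).symm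
  have hasum : ∑ i, a i = 0 := by
    have := congrArg ev (D.trace_tf hnn)
    rw [map_zero, trace, map_sum] at this
    rw [← this]
    exact Finset.sum_congr rfl fun i _ => by rw [diag_apply, htf, if_pos rfl]
  -- the gradient terms
  set T : Fin n → Fin n → Fin n → ℝ := fun k i j => ev (D.cov k D.tf i j) with hT
  have hTs : ∀ k i j, T k i j = T k j i := fun k i j => by
    have h1 : (D.cov k D.tf).map ev = (D.G * D.cov k D.tf).map ev := by
      rw [Matrix.map_mul, hG, one_mul]
    have h2 : ((D.cov k D.tf).map ev)ᵀ = (D.cov k D.tf).map ev := by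
      rw [h1, ← transpose_map, G_mul_cov_tf_symm]
    exact congrFun (congrFun h2 j) i
  have hTt : ∀ k, ∑ i, T k i i = 0 := fun k => by
    have := congrArg ev (D.trace_cov k D.tf)
    rw [D.trace_tf hnn, map_zero, map_zero, trace, map_sum] at this
    exact this
  set v : Fin n → ℝ := fun i => ev (D.d i D.scal) with hv
  have hTd : ∀ i, ∑ k, T k k i = ((n : ℝ) - 2) / (2 * n) * v i := fun i => by
    have := congrArg ev (D.dvgEnd_tf hnn i)
    rw [dvgEnd, map_sum, map_mul, AlgHom.commutes] at this
    exact this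
  have hcot := cotton_inequality (by omega) T _ v hTs hTt hTd
  have e1 : ev (∑ l, ∑ m, D.H l m * (D.cov l D.tf * D.cov m D.tf).trace) =
      ∑ l, ∑ i, ∑ j, T l i j * T l j i := by
    simp only [map_sum, map_mul, hH', ite_mul, one_mul, zero_mul, Finset.sum_ite_eq,
      Finset.mem_univ, if_true, trace, diag_apply, mul_apply, hT]
  have e2 : ev (∑ k, ∑ j, (D.cov j D.tf * D.cov k D.tf * D.H) k j) =
      ∑ k, ∑ j, ∑ i, T j k i * T k i j := by
    simp only [map_sum]
    refine Finset.sum_congr rfl fun k _ => Finset.sum_congr rfl fun j _ => ?_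
    rw [mul_apply]
    simp only [map_sum, map_mul, hH', mul_ite, mul_one, mul_zero, Finset.sum_ite_eq',
      Finset.mem_univ, if_true, mul_apply, hT]
  have e3 : ev D.dscalSq = ∑ i, v i ^ 2 := by
    simp only [dscalSq, map_sum, map_mul, hH', ite_mul, one_mul, zero_mul, Finset.sum_ite_eq,
      Finset.mem_univ, if_true, sq, hv]
  have e4 : ev (D.gradEnd t * D.tf * D.ricEnd).trace =
      ∑ i, (2 * ρ i + 2 * t * R) * a i * ρ i := by
    have hg : (D.gradEnd t).map ev = diagonal fun i => 2 * ρ i + 2 * t * R := by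
      have h1 : ∀ i j, ev (D.ricEnd i j) = if i = j then ρ i else 0 := fun i j => by
        have := congrFun (congrFun hric i) j
        rwa [map_apply, diagonal_apply] at this
      ext i j
      rw [map_apply, gradEnd, Matrix.add_apply, map_add, Matrix.smul_apply, Matrix.smul_apply,
        one_apply, diagonal_apply, smul_eq_mul, map_mul, h1]
      split_ifs with h
      · simp only [smul_eq_mul, mul_one, map_mul, AlgHom.commutes, ← hR, map_ofNat]
        simp
      · simp
    have : ev (D.gradEnd t * D.tf * D.ricEnd).trace =
        ((D.gradEnd t * D.tf * D.ricEnd).map ev).trace := by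
      simp only [trace, map_sum]; rfl
    rw [this, Matrix.map_mul, Matrix.map_mul, hg, ha, hric, diagonal_mul_diagonal,
      diagonal_mul_diagonal, trace_diagonal]
  have e5 : ev (∑ k, ∑ j, ((D.Ω k j * D.tf - D.tf * D.Ω k j) * (D.tf * D.H)) k j) =
      ∑ j, ρ j * a j ^ 2 - ∑ k, ∑ j, r k j * (a k * a j) := by
    have h : ∀ k j, ev (((D.Ω k j * D.tf - D.tf * D.Ω k j) * (D.tf * D.H)) k j) =
        r k j * a j ^ 2 - r k j * (a k * a j) := fun k j => by
      have h1 : (((D.Ω k j * D.tf - D.tf * D.Ω k j) * (D.tf * D.H)).map ev) =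
          ((D.Ω k j).map ev * diagonal a - diagonal a * (D.Ω k j).map ev) * diagonal a := by
        rw [Matrix.map_mul, Matrix.map_mul, hH, mul_one, Matrix.map_sub _ (by simp), Matrix.map_mul,
          Matrix.map_mul, ha]
      have h2 := congrFun (congrFun h1 k) j
      rw [map_apply] at h2
      rw [h2, mul_diagonal, Matrix.sub_apply, mul_diagonal, diagonal_mul, map_apply, hΩ]
      simp only [hr]; ring
    simp only [map_sum, h, Finset.sum_sub_distrib]
    congr 1
    rw [Finset.sum_comm]
    refine Finset.sum_congr rfl fun j _ => ?_
    rw [← Finset.sum_mul, hrsum]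
  have hb : ev (D.bochnerFun t) = (∑ l, ∑ i, ∑ j, T l i j * T l j i)
      - (∑ k, ∑ j, ∑ i, T j k i * T k i j)
      - (2 / n + 2 * t + (n - 2) / (2 * n)) * ((n - 2) / (2 * n)) * ∑ i, v i ^ 2
      - ∑ i, (2 * ρ i + 2 * t * R) * a i * ρ i
      + (∑ j, ρ j * a j ^ 2 - ∑ k, ∑ j, r k j * (a k * a j)) := by
    rw [bochnerFun, map_add, map_sub, map_sub, map_sub, e1, e2, e4, e5, map_mul, e3,
      AlgHom.commutes]
    rfl
  -- the Weyl term
  set w : Fin n → Fin n → ℝ := fun i j => if i = j then 0 else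
    r i j - 1 / ((n : ℝ) - 2) * (ρ i + ρ j) + R / (((n : ℝ) - 1) * (n - 2)) with hw
  have hρsum : ∑ i, ρ i = R := by
    simp only [hρ, Finset.sum_add_distrib, hasum, Finset.sum_const, Finset.card_univ,
      Fintype.card_fin, nsmul_eq_mul]
    field_simp; ring
  have hrow : ∀ i (f : Fin n → ℝ), ∑ j, (if i = j then 0 else f j) = ∑ j, f j - f i := fun i f => by
    have : f i = ∑ j, if i = j then f j else 0 := by simp
    rw [this, ← Finset.sum_sub_distrib]
    exact Finset.sum_congr rfl fun j _ => by split_ifs <;> simp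
  -- The Weyl tensor is trace-free: the row sums of `r` are the Ricci eigenvalues, and the other two
  -- terms of `w` subtract exactly these.
  have hwrow : ∀ i, ∑ j, w i j = 0 := fun i => by
    simp only [hw, hrow]
    have h1 : ∑ j, r i j = ρ i := by rw [← hrsum i]; exact Finset.sum_congr rfl fun j _ => hrs i j
    simp only [Finset.sum_add_distrib, Finset.sum_sub_distrib, h1, ← Finset.mul_sum, hρsum,
      Finset.sum_const, Finset.card_univ, Fintype.card_fin, nsmul_eq_mul, hrd]
    field_simp
    ring
  have hws : ∀ i j, w i j = w j i := fun i j => by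
    simp only [hw, hrs i j, eq_comm (a := i) (b := j), add_comm (ρ i)]
  have hwcol : ∀ j, ∑ i, w i j = 0 := fun j => by
    rw [← hwrow j]; exact Finset.sum_congr rfl fun i _ => hws i j
  have hweyl := weyl_inequality hn a hasum w hwrow hwcol (fun i => by simp [hw]) N (by
    refine le_trans (le_of_eq ?_) hN
    congr 1
    refine Finset.sum_congr rfl fun i _ => Finset.sum_congr rfl fun j _ => ?_
    by_cases h : i = j
    · simp [h]
    · simp only [hw, if_neg h, hρ, hr])
  set s := ∑ i, a i ^ 2 with hs
  set p3 := ∑ i, a i ^ 3 with hp3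
  -- The decomposition of the curvature holds only off the diagonal. As ∑ a = 0, the omitted
  -- diagonal is what produces the cubic sum and the multiple of R ∑ a².
  have hra : ∑ k, ∑ j, r k j * (a k * a j) = ∑ k, ∑ j, w k j * (a k * a j)
      - 2 / (n - 2) * p3 - R / (n * (n - 1)) * s := by
    have h1 : ∀ k j, w k j * (a k * a j) = if k = j then 0 else
        (r k j - 1 / ((n : ℝ) - 2) * (ρ k + ρ j) + R / (((n : ℝ) - 1) * (n - 2))) * (a k * a j) :=
      fun k j => by simp only [hw]; split_ifs <;> simp
    simp only [h1]
    rw [sum_offdiag]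
    have h2 : ∀ k j, (r k j - 1 / ((n : ℝ) - 2) * (ρ k + ρ j) + R / (((n : ℝ) - 1) * (n - 2)))
        * (a k * a j) = r k j * (a k * a j) - (1 / ((n : ℝ) - 2) * a k ^ 2) * a j
          - a k * (1 / ((n : ℝ) - 2) * a j ^ 2)
          + (R / (((n : ℝ) - 1) * (n - 2)) - 2 * (R / n) / (n - 2)) * a k * a j := fun k j => by
      simp only [hρ]; ring
    have h3 : ∀ k, (r k k - 1 / ((n : ℝ) - 2) * (ρ k + ρ k) + R / (((n : ℝ) - 1) * (n - 2)))
        * (a k * a k) = (-(2 / ((n : ℝ) - 2))) * a k ^ 3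
          + (R / (((n : ℝ) - 1) * (n - 2)) - 2 * (R / n) / (n - 2)) * a k ^ 2 := fun k => by
      rw [hrd]; simp only [hρ]; ring
    simp only [h3]
    simp only [h2, Finset.sum_add_distrib, Finset.sum_sub_distrib, ← Finset.mul_sum,
      ← Finset.sum_mul, hasum]
    rw [← hs, ← hp3]
    generalize ∑ k, ∑ j, r k j * (a k * a j) = Z
    field_simp
    ring
  have h4 : ∑ i, (2 * ρ i + 2 * t * R) * a i * ρ i =
      2 * p3 + (4 / n + 2 * t) * R * s := by
    have : ∀ i, (2 * ρ i + 2 * t * R) * a i * ρ i = 2 * a i ^ 3 + (4 / n + 2 * t) * R * a i ^ 2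
        + (2 * R / n + 2 * t * R) * (R / n) * a i := fun i => by simp only [hρ]; ring
    simp only [this, Finset.sum_add_distrib, ← Finset.mul_sum, hasum]
    ring
  have h5 : ∑ j, ρ j * a j ^ 2 = p3 + R / n * s := by
    have : ∀ j, ρ j * a j ^ 2 = a j ^ 3 + R / n * a j ^ 2 := fun j => by simp only [hρ]; ring
    simp only [this, Finset.sum_add_distrib, ← Finset.mul_sum]
    rfl
  rw [h4, h5, hra] at hb
  have hV : 0 ≤ ∑ i, v i ^ 2 := by positivity
  set V := ∑ i, v i ^ 2
  -- The coefficient of |dR|² against the gain from `cotton_inequality`; equality holds at t =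
  -- -n/(4(n-1)), the borderline value of `ht`.
  have hcoef : (2 / n + 2 * t + ((n : ℝ) - 2) / (2 * n)) * ((n - 2) / (2 * n)) ≤
      (((n : ℝ) - 2) / (2 * n)) ^ 2 / (n - 1) := by
    have hk : 0 ≤ ((n : ℝ) - 2) / (2 * n) := div_nonneg (by linarith) (by linarith)
    have h6 : (2 / n + 2 * t + ((n : ℝ) - 2) / (2 * n)) ≤ (((n : ℝ) - 2) / (2 * n)) / (n - 1) := by
      have : (((n : ℝ) - 2) / (2 * n)) / (n - 1) = 2 / n + 2 * (-((n : ℝ) / (4 * (n - 1))))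
          + ((n : ℝ) - 2) / (2 * n) := by field_simp; ring
      rw [this]; linarith
    calc _ ≤ (((n : ℝ) - 2) / (2 * n)) / (n - 1) * ((n - 2) / (2 * n)) :=
          mul_le_mul_of_nonneg_right h6 hk
      _ = _ := by ring
  have hVV := mul_le_mul_of_nonneg_right hcoef hV
  have habs := (abs_le.mp hweyl).2
  -- The cubic coefficients -2, 1 and 2/(n-2) add up to -(n-4)/(n-2), the combination controlled by
  -- `weyl_inequality`.
  have hp : (2 : ℝ) / (n - 2) = 1 - ((n : ℝ) - 4) / (n - 2) := by field_simp; ring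
  have hfin : -((2 * ((n : ℝ) - 2) + 2 * n * (n - 1) * t) / n + 1) * R / (n - 1)
      = -(4 / n + 2 * t) * R + R / n + R / (n * (n - 1)) := by field_simp; ring
  rw [hb, hfin, hp]
  linarith

end MetricData
end QuadCurv
end

/-! ### Nonnegativity of the Bochner integrand under the pinching condition. -/

noncomputable section

namespace QuadCurv

open Matrix

namespace MetricData

variable {n : ℕ} {𝒜 : Type*} [CommRing 𝒜] [Algebra ℝ 𝒜] (D : MetricData n 𝒜) (ev : 𝒜 →ₐ[ℝ] ℝ)

lemma map_algebraMap_ev (P : Matrix (Fin n) (Fin n) ℝ) :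
    (P.map (algebraMap ℝ 𝒜)).map ev = P := by
  ext i j; simp

/-- Under the pinching condition the integrand of the Bochner-type formula is nonnegative, and it
vanishes only where the trace-free Ricci tensor does. -/
lemma bochnerFun_nonneg (hn : 3 ≤ n) (t : ℝ) (ht : t ≤ -((n : ℝ) / (4 * (n - 1))))
    {G Ric A : Matrix (Fin n) (Fin n) ℝ} {R : ℝ} {Rm : Fin n → Fin n → Fin n → Fin n → ℝ}
    (hG : D.G.map ev = G) (hGpos : G.PosDef) (hRic : D.Ric.map ev = Ric) (hR : ev D.scal = R)
    (hRm : ∀ i j k l, ev (D.Rm i j k l) = Rm i j k l) (hA : ∀ i j, A i j = Ric i j - R / n * G i j)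
    (hpinch : Real.sqrt (normSq₄ G fun i j k l =>
        (Rm i j k l - 1 / ((n : ℝ) - 2) * kulkarniNomizu Ric G i j k l
          + R / (((n : ℝ) - 1) * ((n : ℝ) - 2)) * (G i k * G j l - G i l * G j k))
        - ((n : ℝ) - 4) / (Real.sqrt (2 * n) * ((n : ℝ) - 2)) * kulkarniNomizu A G i j k l)
      < -Real.sqrt (2 / (((n : ℝ) - 1) * ((n : ℝ) - 2))) *
          ((2 * ((n : ℝ) - 2) + 2 * n * ((n : ℝ) - 1) * t) / n + 1) * R) :
    0 ≤ ev (D.bochnerFun t) ∧ (ev (D.bochnerFun t) = 0 → D.tf.map ev = 0) := by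
  have hn3 : (3 : ℝ) ≤ n := by exact_mod_cast hn
  have hn2 : (n : ℝ) - 2 ≠ 0 := by linarith
  have hn1 : (n : ℝ) - 1 ≠ 0 := by linarith
  have hn0 : (n : ℝ) ≠ 0 := by linarith
  have hGA : (D.G * D.tf).map ev = A := by
    rw [G_mul_tf]
    ext i j
    rw [hA, ← hRic, ← hG, ← hR]
    simp only [map_apply, Matrix.sub_apply, Matrix.smul_apply, smul_eq_mul, map_sub, map_mul,
      AlgHom.commutes, Algebra.algebraMap_self, RingHom.id_apply]
    ring
  have hAs : Aᵀ = A := by rw [← hGA, ← transpose_map, G_mul_tf_symm]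
  -- The constant frame `P` adapts the coordinates to the evaluation point; since the integrand and
  -- the pinching norm are invariant, both can be computed in it.
  obtain ⟨P, a, hP, hPG, hPA⟩ := exists_frame hGpos hAs
  set D' := D.frame P hP with hD'
  set c : CoordChange D D' := D.frameChange P hP with hc
  have hJ : c.J.map ev = P := map_algebraMap_ev ev P
  have hpull : ∀ M, c.pull M = M := fun M => by ext i j; rfl
  have hG' : D'.G.map ev = 1 := by
    rw [c.G_eq, Matrix.map_mul, Matrix.map_mul, transpose_map, hJ]
    change Pᵀ * (c.pull D.G).map ev * P = 1
    rw [hpull, hG, hPG]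
  have htf' : D'.tf.map ev = diagonal a := by
    have h1 : D'.G * D'.tf = c.Jᵀ * (D.G * D.tf) * c.J := by
      rw [c.tf_eq, c.G_eq, CoordChange.conj, hpull]
      change c.Jᵀ * c.pull D.G * c.J * _ = _
      rw [hpull]
      simp only [mul_assoc, c.J_mul_Ji_mul]
    have h2 := congrArg (fun M => M.map ev) h1
    simp only [Matrix.map_mul] at h2
    rw [hG', one_mul, transpose_map, hJ, ← Matrix.map_mul, hGA, hPA] at h2
    exact h2
  have hRic' : Pᵀ * Ric * P = D'.Ric.map ev := by
    rw [c.Ric_eq, Matrix.map_mul, Matrix.map_mul, transpose_map, hJ, hpull, hRic]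
  have hscal' : ev D'.scal = R := by rw [c.scal_eq, ← hR]; rfl
  have hRm' : ∀ i j k l, ev (D'.Rm i j k l) = frame₄ P Rm i j k l := fun i j k l => by
    have hJ' : ∀ p i, ev (c.J p i) = P p i := fun p i => congrFun (congrFun hJ p) i
    rw [c.Rm_eq, frame₄]
    simp only [map_sum, map_mul, hJ']
    refine Finset.sum_congr rfl fun p _ => Finset.sum_congr rfl fun q _ =>
      Finset.sum_congr rfl fun r _ => Finset.sum_congr rfl fun s _ => ?_
    rw [← hRm]; rfl
  have hinv : G⁻¹ = P * Pᵀ := by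
    refine Matrix.inv_eq_left_inv ?_
    rw [mul_assoc]
    exact mul_eq_one_comm.mp hPG
  have hRicd : Pᵀ * Ric * P = diagonal fun i => a i + R / n := by
    have : Ric = A + (R / n) • G := by
      ext i j; rw [Matrix.add_apply, Matrix.smul_apply, hA, smul_eq_mul]; ring
    rw [this, mul_add, add_mul, hPA, mul_smul_comm, smul_mul_assoc, hPG]
    ext i j
    rw [Matrix.add_apply, Matrix.smul_apply, diagonal_apply, diagonal_apply, one_apply]
    split_ifs <;> simp
  set S := frame₄ P (fun i j k l =>
        (Rm i j k l - 1 / ((n : ℝ) - 2) * kulkarniNomizu Ric G i j k l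
          + R / (((n : ℝ) - 1) * ((n : ℝ) - 2)) * (G i k * G j l - G i l * G j k))
        - ((n : ℝ) - 4) / (Real.sqrt (2 * n) * ((n : ℝ) - 2)) * kulkarniNomizu A G i j k l) with hS
  have hSe : ∀ i j k l, S i j k l = ev (D'.Rm i j k l)
      - 1 / ((n : ℝ) - 2) * kulkarniNomizu (diagonal fun i => a i + R / n : Matrix (Fin n) (Fin n) ℝ)
          (1 : Matrix (Fin n) (Fin n) ℝ) i j k l
      + R / (((n : ℝ) - 1) * ((n : ℝ) - 2)) * ((1 : Matrix (Fin n) (Fin n) ℝ) i k *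
          (1 : Matrix (Fin n) (Fin n) ℝ) j l - (1 : Matrix (Fin n) (Fin n) ℝ) i l *
          (1 : Matrix (Fin n) (Fin n) ℝ) j k)
      - ((n : ℝ) - 4) / (Real.sqrt (2 * n) * ((n : ℝ) - 2)) *
        kulkarniNomizu (diagonal a : Matrix (Fin n) (Fin n) ℝ)
          (1 : Matrix (Fin n) (Fin n) ℝ) i j k l := fun i j k l => by
    rw [hS, frame₄_sub, frame₄_smul, frame₄_add, frame₄_smul, frame₄_sub, frame₄_sub, frame₄_smul]
    rw [frame₄_mul_13_24, frame₄_mul_14_23]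
    have k1 := frame₄_kulkarniNomizu P Ric G i j k l
    have k2 := frame₄_kulkarniNomizu P A G i j k l
    rw [hPG, hRicd] at k1
    rw [hPG, hPA] at k2
    rw [hPG, hRm', ← k1, ← k2]
  have hSij : ∀ i j, i ≠ j → S i j i j = ev (D'.Rm i j i j)
      - 1 / ((n : ℝ) - 2) * ((a i + R / n) + (a j + R / n))
      + R / (((n : ℝ) - 1) * (n - 2))
      - ((n : ℝ) - 4) / (Real.sqrt (2 * n) * ((n : ℝ) - 2)) * (a i + a j) := fun i j h => by
    rw [hSe]
    simp [kulkarniNomizu, h, h.symm]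
  have hSanti : ∀ i j, S i j j i = -S i j i j := fun i j => by
    rw [hSe, hSe, D'.Rm_antisymm_right, map_neg]
    simp only [kulkarniNomizu]
    ring
  have hnorm := normSq₄_eq_frame hinv (fun i j k l =>
        (Rm i j k l - 1 / ((n : ℝ) - 2) * kulkarniNomizu Ric G i j k l
          + R / (((n : ℝ) - 1) * ((n : ℝ) - 2)) * (G i k * G j l - G i l * G j k))
        - ((n : ℝ) - 4) / (Real.sqrt (2 * n) * ((n : ℝ) - 2)) * kulkarniNomizu A G i j k l)
  rw [← hS] at hnorm
  set N := ∑ i, ∑ j, ∑ k, ∑ l, S i j k l ^ 2 with hNdef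
  rw [hnorm] at hpinch
  have hmain := D'.bochnerFun_lower_bound ev hn t ht hG' a htf' N (by
    refine le_trans (le_of_eq ?_) (two_mul_sum_le_sum_sq S hSanti)
    congr 1
    refine Finset.sum_congr rfl fun i _ => Finset.sum_congr rfl fun j _ => ?_
    by_cases h : i = j
    · simp [h]
    · rw [if_neg h, if_neg h, hSij i j h, hscal'])
  have hb : ev (D'.bochnerFun t) = ev (D.bochnerFun t) := by rw [c.bochnerFun_eq]; rfl
  rw [hb, hscal'] at hmain
  -- The pinching condition multiplied by √((n-2)/(2(n-1))): the product of the two square roots is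
  -- 1/(n-1), which matches the coefficient of R in the lower bound.
  have hpos : 0 < -((2 * ((n : ℝ) - 2) + 2 * n * (n - 1) * t) / n + 1) * R / (n - 1)
      - Real.sqrt (((n : ℝ) - 2) / (2 * (n - 1))) * Real.sqrt N := by
    have h1 : 0 < Real.sqrt (((n : ℝ) - 2) / (2 * (n - 1))) :=
      Real.sqrt_pos.mpr (div_pos (by linarith) (by linarith))
    have h2 := mul_lt_mul_of_pos_left hpinch h1
    have h3 : Real.sqrt (((n : ℝ) - 2) / (2 * (n - 1))) *
        Real.sqrt (2 / (((n : ℝ) - 1) * ((n : ℝ) - 2))) = 1 / (n - 1) := by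
      rw [← Real.sqrt_mul (div_nonneg (by linarith) (by linarith))]
      have : ((n : ℝ) - 2) / (2 * (n - 1)) * (2 / (((n : ℝ) - 1) * ((n : ℝ) - 2)))
          = (1 / (n - 1)) ^ 2 := by field_simp
      rw [this, Real.sqrt_sq (div_nonneg zero_le_one (by linarith))]
    have h4 : Real.sqrt (((n : ℝ) - 2) / (2 * (n - 1))) *
        (-Real.sqrt (2 / (((n : ℝ) - 1) * ((n : ℝ) - 2))) *
          ((2 * ((n : ℝ) - 2) + 2 * n * ((n : ℝ) - 1) * t) / n + 1) * R) =
        -((2 * ((n : ℝ) - 2) + 2 * n * (n - 1) * t) / n + 1) * R / (n - 1) := by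
      linear_combination (-((2 * ((n : ℝ) - 2) + 2 * n * (n - 1) * t) / n + 1) * R) * h3
    rw [h4] at h2
    linarith
  have hs : 0 ≤ ∑ i, a i ^ 2 := by positivity
  refine ⟨le_trans (mul_nonneg hpos.le hs) hmain, fun h0 => ?_⟩
  rw [h0] at hmain
  have hs0 : ∑ i, a i ^ 2 = 0 := le_antisymm
    (by by_contra hcon; push Not at hcon; exact absurd hmain (not_le.mpr (mul_pos hpos hcon))) hs
  have ha0 : a = 0 := by
    ext i
    have := (Finset.sum_eq_zero_iff_of_nonneg fun i _ => sq_nonneg (a i)).mp hs0 i (Finset.mem_univ i)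
    exact pow_eq_zero_iff two_ne_zero |>.mp this
  have h1 : D.tf = c.J * D'.tf * c.Ji := by
    rw [c.tf_eq, CoordChange.conj, hpull]
    simp only [mul_assoc, c.J_mul_Ji_mul, c.J_mul_Ji, mul_one]
  rw [h1, Matrix.map_mul, Matrix.map_mul, htf', ha0]
  simp

end MetricData
end QuadCurv
end

noncomputable section

namespace QuadCurv

open Matrix TopologicalSpace

/-! ### The ring of smooth functions on an open set -/

section SmoothFn

variable {X : Type*} [NormedAddCommGroup X] [NormedSpace ℝ X]

/-- Extension by zero. -/
def extZero {X : Type*} [TopologicalSpace X] {U : Opens X} (f : U → ℝ) (y : X) : ℝ := open Classical in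
  if h : y ∈ U then f ⟨y, h⟩ else 0

lemma extZero_apply {X : Type*} [TopologicalSpace X] {U : Opens X} (f : U → ℝ) {y : X} (h : y ∈ U) : extZero f y = f ⟨y, h⟩ := by
  simp [extZero, h]

/-- The algebra of smooth functions on an open subset of a normed space. -/
def SmoothFn (U : Opens X) : Subalgebra ℝ (U → ℝ) where
  -- Extending by zero supplies a function on the whole space to differentiate. As `U` is open, the
  -- values outside do not influence derivatives at points of `U`.
  carrier := {f | ContDiffOn ℝ ∞ (extZero f) U}
  mul_mem' {f g} hf hg := by
    refine ContDiffOn.congr (ContDiffOn.mul hf hg) fun y hy => ?_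
    simp [extZero_apply _ hy]
  add_mem' {f g} hf hg := by
    refine ContDiffOn.congr (ContDiffOn.add hf hg) fun y hy => ?_
    simp [extZero_apply _ hy]
  algebraMap_mem' r := by
    refine ContDiffOn.congr (contDiffOn_const (c := r)) fun y hy => ?_
    simp [extZero_apply _ hy]

namespace SmoothFn

variable {U : Opens X}

/-- The restriction of a function which is smooth on `U`. -/
def of (U : Opens X) (F : X → ℝ) (hF : ContDiffOn ℝ ∞ F U) : SmoothFn U :=
  ⟨fun y => F y, ContDiffOn.congr hF fun y hy => by simp [extZero_apply _ hy]⟩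

/-- Evaluation at a point. -/
def ev (y : U) : SmoothFn U →ₐ[ℝ] ℝ :=
  (Pi.evalAlgHom ℝ (fun _ : U => ℝ) y).comp (SmoothFn U).val

/-- A smooth function on `U`, extended by zero. -/
def extFn (f : SmoothFn U) : X → ℝ := extZero f.1

lemma extFn_apply (f : SmoothFn U) (y : U) : (extFn f) y = ev y f := extZero_apply _ y.2

@[simp] lemma ev_of (F : X → ℝ) (hF : ContDiffOn ℝ ∞ F U) (y : U) : ev y (of U F hF) = F y := rfl

lemma contDiffOn_extFn (f : SmoothFn U) : ContDiffOn ℝ ∞ (extFn f) U := f.2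

lemma differentiableAt_extFn (f : SmoothFn U) (y : U) : DifferentiableAt ℝ (extFn f) y :=
  ((contDiffOn_extFn f).contDiffAt (U.isOpen.mem_nhds y.2)).differentiableAt (by simp)

lemma funext {f g : SmoothFn U} (h : ∀ y : U, ev y f = ev y g) : f = g :=
  Subtype.ext (_root_.funext h)

lemma contDiffOn_fderiv_apply {F : X → ℝ} (hF : ContDiffOn ℝ ∞ F U) (v : X) :
    ContDiffOn ℝ ∞ (fun y => fderiv ℝ F y v) U :=
  (hF.fderiv_of_isOpen U.isOpen (by simp)).clm_apply contDiffOn_const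

lemma extFn_eventuallyEq {f : SmoothFn U} {F : X → ℝ} (h : ∀ y : U, ev y f = F y) (y : U) :
    (extFn f) =ᶠ[nhds (y : X)] F := by
  filter_upwards [U.isOpen.mem_nhds y.2] with z hz
  exact (extFn_apply f ⟨z, hz⟩).trans (h ⟨z, hz⟩)

/-- The derivative in the direction `v`. -/
def dir (v : X) : Derivation ℝ (SmoothFn U) (SmoothFn U) :=
  Derivation.mk'
    { toFun := fun f => of U (fun y => fderiv ℝ (extFn f) y v) (contDiffOn_fderiv_apply (contDiffOn_extFn f) v)
      map_add' := fun f g => by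
        refine funext fun y => ?_
        rw [map_add, ev_of, ev_of, ev_of]
        have h : extFn (f + g) =ᶠ[nhds (y : X)] (extFn f) + (extFn g) := extFn_eventuallyEq (fun z => by
          rw [map_add, Pi.add_apply, extFn_apply, extFn_apply]) y
        rw [h.fderiv_eq, fderiv_add (differentiableAt_extFn f y) (differentiableAt_extFn g y)]
        rfl
      map_smul' := fun r f => by
        refine funext fun y => ?_
        rw [map_smul, RingHom.id_apply, ev_of, ev_of]
        have h : extFn (r • f) =ᶠ[nhds (y : X)] r • (extFn f) := extFn_eventuallyEq (fun z => by
          rw [map_smul, Pi.smul_apply, extFn_apply]) y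
        rw [h.fderiv_eq, fderiv_const_smul (differentiableAt_extFn f y)]
        rfl }
    fun f g => by
      refine funext fun y => ?_
      change fderiv ℝ (extFn (f * g)) y v = ev y f * fderiv ℝ (extFn g) y v + ev y g * fderiv ℝ (extFn f) y v
      have h : extFn (f * g) =ᶠ[nhds (y : X)] (extFn f) * (extFn g) := extFn_eventuallyEq (fun z => by
        rw [map_mul, Pi.mul_apply, extFn_apply, extFn_apply]) y
      rw [h.fderiv_eq, fderiv_mul (differentiableAt_extFn f y) (differentiableAt_extFn g y),
        extFn_apply, extFn_apply]
      rfl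

lemma ev_dir (v : X) (f : SmoothFn U) (y : U) : ev y (dir v f) = fderiv ℝ (extFn f) y v := rfl

/-- Derivatives depend only on germs, so any function agreeing with `f` on the open set `U` may
replace its extension by zero. -/
lemma ev_dir_of_eq (v : X) {f : SmoothFn U} {F : X → ℝ} (h : ∀ y : U, ev y f = F y) (y : U) :
    ev y (dir v f) = fderiv ℝ F y v := by
  rw [ev_dir, (extFn_eventuallyEq h y).fderiv_eq]

lemma dir_comm (v w : X) (f : SmoothFn U) : dir v (dir w f) = dir w (dir v f) := by
  refine funext fun y => ?_
  have hc : ContDiffAt ℝ ∞ (extFn f) y := (contDiffOn_extFn f).contDiffAt (U.isOpen.mem_nhds y.2)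
  have hd : DifferentiableAt ℝ (fderiv ℝ (extFn f)) y :=
    (((contDiffOn_extFn f).fderiv_of_isOpen U.isOpen (m := ∞) (by simp)).contDiffAt
      (U.isOpen.mem_nhds y.2)).differentiableAt (by simp)
  have key : ∀ v w : X, ev y (dir v (dir w f)) = fderiv ℝ (fderiv ℝ (extFn f)) y v w := fun v w => by
    rw [ev_dir_of_eq v (F := fun z => fderiv ℝ (extFn f) z w) (fun z => ev_dir w f z)]
    rw [fderiv_clm_apply hd (differentiableAt_const w)]
    simp
  rw [key, key]
  exact (hc.isSymmSndFDerivAt (by simpa using ENat.LEInfty.out)).eq v w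

end SmoothFn

end SmoothFn

/-! ### Smoothness of determinants and inverses -/

section MatrixSmooth

variable {X : Type*} [NormedAddCommGroup X] [NormedSpace ℝ X] {n : ℕ}

lemma contDiffOn_det {k : WithTop ℕ∞} {M : X → Matrix (Fin n) (Fin n) ℝ} {U : Set X}
    (hM : ∀ i j, ContDiffOn ℝ k (fun x => M x i j) U) : ContDiffOn ℝ k (fun x => (M x).det) U := by
  simp only [det_apply]
  refine ContDiffOn.sum fun σ _ => ?_
  refine ContDiffOn.const_smul _ ?_
  exact contDiffOn_prod fun i _ => hM _ _

lemma contDiffOn_inv {k : WithTop ℕ∞} {M : X → Matrix (Fin n) (Fin n) ℝ} {U : Set X}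
    (hM : ∀ i j, ContDiffOn ℝ k (fun x => M x i j) U) (hd : ∀ x ∈ U, (M x).det ≠ 0) (i j : Fin n) :
    ContDiffOn ℝ k (fun x => (M x)⁻¹ i j) U := by
  have h : ∀ x, (M x)⁻¹ i j = ((M x).det)⁻¹ * (M x).adjugate i j := fun x => by
    rw [inv_def, Ring.inverse_eq_inv', Matrix.smul_apply, smul_eq_mul]
  simp only [h, adjugate_apply]
  refine ((contDiffOn_det hM).inv hd).mul (contDiffOn_det fun p q => ?_)
  by_cases hp : p = j
  · subst hp
    simp only [updateRow_self]
    exact contDiffOn_const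
  · simp only [updateRow_ne hp]
    exact hM p q

end MatrixSmooth

lemma normSq₂_eq_trace {n : ℕ} (g T : Matrix (Fin n) (Fin n) ℝ) :
    normSq₂ g T = (Tᵀ * g⁻¹ * T * (g⁻¹)ᵀ).trace := by
  simp only [normSq₂, trace, diag_apply, mul_apply, transpose_apply, Finset.sum_mul]
  rw [Finset.sum_comm]
  refine Finset.sum_congr rfl fun j _ => ?_
  have h : ∀ i, ∑ a, ∑ b, g⁻¹ i a * g⁻¹ j b * T i j * T a b
      = ∑ b, ∑ a, g⁻¹ i a * g⁻¹ j b * T i j * T a b := fun i => Finset.sum_comm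
  simp only [h]
  rw [Finset.sum_comm]
  refine Finset.sum_congr rfl fun b _ => ?_
  rw [Finset.sum_comm]
  refine Finset.sum_congr rfl fun a _ => Finset.sum_congr rfl fun i _ => ?_
  ring

/-- A symmetric invertible matrix of smooth functions, with coordinate directions `e`, as an
abstract metric. -/
def metricData {X : Type*} [NormedAddCommGroup X] [NormedSpace ℝ X] {n : ℕ} (U : Opens X)
    (e : Fin n → X) (G : X → Matrix (Fin n) (Fin n) ℝ)
    (hG : ∀ i j, ContDiffOn ℝ ∞ (fun x => G x i j) U) (hs : ∀ x ∈ U, (G x)ᵀ = G x)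
    (hd : ∀ x ∈ U, (G x).det ≠ 0) : MetricData n (SmoothFn U) where
  d i := SmoothFn.dir (e i)
  d_comm i j f := SmoothFn.dir_comm _ _ f
  G := Matrix.of fun i j => SmoothFn.of U (fun x => G x i j) (hG i j)
  H := Matrix.of fun i j => SmoothFn.of U (fun x => (G x)⁻¹ i j) (contDiffOn_inv hG hd i j)
  G_symm := by
    ext1 i j
    refine SmoothFn.funext fun y => ?_
    exact congrFun (congrFun (hs y y.2) i) j
  GH := by
    ext1 i j
    refine SmoothFn.funext fun y => ?_
    have h := congrFun (congrFun (mul_nonsing_inv (G y) (isUnit_iff_ne_zero.mpr (hd y y.2))) i) j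
    rw [mul_apply] at h ⊢
    rw [map_sum]
    simp only [map_mul, of_apply, SmoothFn.ev_of]
    rw [h, one_apply, one_apply]
    split_ifs <;> simp

/-! ### Comparison of the coordinate formulas with the abstract calculus. -/

section Bridge

variable {X : Type*} [NormedAddCommGroup X] [NormedSpace ℝ X] {n : ℕ} {U : Opens X}
    {e : Fin n → X} {G : X → Matrix (Fin n) (Fin n) ℝ}
    {hG : ∀ i j, ContDiffOn ℝ ∞ (fun x => G x i j) U} {hs : ∀ x ∈ U, (G x)ᵀ = G x}
    {hd : ∀ x ∈ U, (G x).det ≠ 0}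

/-- `G'` is, on the open set `V`, the restriction of `G` along the map `emb`, which is compatible
with the coordinate directions. -/
structure IsSlice (U : Opens X) (e : Fin n → X) (G : X → Matrix (Fin n) (Fin n) ℝ)
    (emb : EuclideanSpace ℝ (Fin n) → X) (V : Set (EuclideanSpace ℝ (Fin n)))
    (G' : EuclideanSpace ℝ (Fin n) → Matrix (Fin n) (Fin n) ℝ) : Prop where
  isOpen : IsOpen V
  mem : ∀ z ∈ V, emb z ∈ U
  eq : ∀ z ∈ V, G' z = G (emb z)
  -- Both uses satisfy this: `emb` the identity, for a single metric, and `emb y = (s, y)`, for the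
  -- member at time s of a family.
  deriv : ∀ z ∈ V, ∃ L : EuclideanSpace ℝ (Fin n) →L[ℝ] X, HasFDerivAt emb L z ∧
    ∀ i, L (EuclideanSpace.single i 1) = e i

namespace IsSlice

variable {emb : EuclideanSpace ℝ (Fin n) → X} {V : Set (EuclideanSpace ℝ (Fin n))}
  {G' : EuclideanSpace ℝ (Fin n) → Matrix (Fin n) (Fin n) ℝ} (h : IsSlice U e G emb V G')

include h

/-- The chain rule along `emb` is the only analytic input: after it, the coordinate and abstract
expressions for Γ, Rm, Ric and R agree term by term. -/
lemma partialDeriv_eq {f : EuclideanSpace ℝ (Fin n) → ℝ} {F : SmoothFn U}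
    (hf : ∀ z (hz : z ∈ V), f z = SmoothFn.ev ⟨emb z, h.mem z hz⟩ F) {z} (hz : z ∈ V) (i : Fin n) :
    partialDeriv i f z = SmoothFn.ev ⟨emb z, h.mem z hz⟩ (SmoothFn.dir (e i) F) := by
  obtain ⟨L, hL, hLe⟩ := h.deriv z hz
  have hev : f =ᶠ[nhds z] SmoothFn.extFn F ∘ emb := by
    filter_upwards [h.isOpen.mem_nhds hz] with w hw
    exact (hf w hw).trans (SmoothFn.extFn_apply F ⟨emb w, h.mem w hw⟩).symm
  have hF := SmoothFn.differentiableAt_extFn F ⟨emb z, h.mem z hz⟩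
  rw [partialDeriv, hev.fderiv_eq, (hF.hasFDerivAt.comp z hL).fderiv, SmoothFn.ev_dir, ← hLe i]
  rfl

lemma christoffel_eq {z} (hz : z ∈ V) (m k l : Fin n) : christoffel G' m k l z =
    SmoothFn.ev ⟨emb z, h.mem z hz⟩ ((metricData U e G hG hs hd).Γ k m l) := by
  have hp : ∀ i a b, partialDeriv i (fun w => G' w a b) z =
      SmoothFn.ev ⟨emb z, h.mem z hz⟩ ((metricData U e G hG hs hd).d i
        ((metricData U e G hG hs hd).G a b)) := fun i a b =>
    h.partialDeriv_eq (F := (metricData U e G hG hs hd).G a b) (fun w hw => by rw [h.eq w hw]; rfl) hz i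
  rw [christoffel, MetricData.Γ, of_apply, map_smul, smul_eq_mul, map_sum]
  congr 1
  refine Finset.sum_congr rfl fun p _ => ?_
  rw [hp, hp, hp, map_mul, map_sub, map_add, h.eq z hz]
  rfl

lemma riemann_eq {z} (hz : z ∈ V) (i j k l : Fin n) : riemann G' z i j k l =
    SmoothFn.ev ⟨emb z, h.mem z hz⟩ ((metricData U e G hG hs hd).Rm i j k l) := by
  have hp : ∀ i m j l, partialDeriv i (christoffel G' m j l) z =
      SmoothFn.ev ⟨emb z, h.mem z hz⟩ ((metricData U e G hG hs hd).d i
        ((metricData U e G hG hs hd).Γ j m l)) := fun i m j l =>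
    h.partialDeriv_eq (F := (metricData U e G hG hs hd).Γ j m l)
      (fun w hw => h.christoffel_eq hw m j l) hz i
  rw [riemann, MetricData.Rm, mul_apply, map_sum]
  refine Finset.sum_congr rfl fun m _ => ?_
  rw [map_mul, MetricData.Ω]
  simp only [Matrix.sub_apply, Matrix.add_apply, MetricData.dM_apply, mul_apply, map_sub, map_add,
    map_sum, map_mul, ← hp, ← h.christoffel_eq (hG := hG) (hs := hs) (hd := hd) hz,
    Finset.sum_sub_distrib, h.eq z hz]
  rw [add_sub_assoc]
  rfl

lemma ricci_eq {z} (hz : z ∈ V) (i k : Fin n) : ricci G' z i k =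
    SmoothFn.ev ⟨emb z, h.mem z hz⟩ ((metricData U e G hG hs hd).Ric i k) := by
  rw [ricci, MetricData.Ric, of_apply, map_sum]
  refine Finset.sum_congr rfl fun j _ => ?_
  rw [map_sum]
  refine Finset.sum_congr rfl fun l _ => ?_
  rw [map_mul, h.riemann_eq (hG := hG) (hs := hs) (hd := hd) hz, h.eq z hz]
  rfl

lemma scalar_eq {z} (hz : z ∈ V) : scalar G' z =
    SmoothFn.ev ⟨emb z, h.mem z hz⟩ (metricData U e G hG hs hd).scal := by
  rw [scalar, MetricData.scal, trace, map_sum]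
  refine Finset.sum_congr rfl fun i _ => ?_
  rw [diag_apply, MetricData.ricEnd, mul_apply, map_sum]
  refine Finset.sum_congr rfl fun k _ => ?_
  have : (metricData U e G hG hs hd).Ric k i = (metricData U e G hG hs hd).Ric i k :=
    congrFun (congrFun (metricData U e G hG hs hd).Ric_symm i) k
  rw [map_mul, this, h.ricci_eq (hG := hG) (hs := hs) (hd := hd) hz, h.eq z hz]
  rfl

lemma normSq₂_eq {z} (hz : z ∈ V) : normSq₂ (G' z) (ricci G' z) =
    SmoothFn.ev ⟨emb z, h.mem z hz⟩
      ((metricData U e G hG hs hd).ricEnd * (metricData U e G hG hs hd).ricEnd).trace := by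
  set D := metricData U e G hG hs hd with hD
  set ε := SmoothFn.ev ⟨emb z, h.mem z hz⟩ with hε
  have hH : (G' z)⁻¹ = D.H.map ε := by
    rw [h.eq z hz]; rfl
  have hT : ricci G' z = D.Ric.map ε := by
    funext i k
    exact h.ricci_eq hz i k
  have hHs : (D.H.map ε)ᵀ = D.H.map ε := by
    rw [← transpose_map, D.H_symm]
  have hTs : (D.Ric.map ε)ᵀ = D.Ric.map ε := by
    rw [← transpose_map, D.Ric_symm]
  have e : ε (D.ricEnd * D.ricEnd).trace
      = ((D.H.map ε * D.Ric.map ε) * (D.H.map ε * D.Ric.map ε)).trace := by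
    rw [← Matrix.map_mul, ← Matrix.map_mul]
    exact AddMonoidHom.map_trace (ε : SmoothFn U →+ ℝ) _
  rw [e, hT]
  refine (normSq₂_eq_trace (G' z) (D.Ric.map ε)).trans ?_
  rw [hH, hHs, hTs, trace_mul_comm, Matrix.mul_assoc, Matrix.mul_assoc]

end IsSlice

end Bridge
end QuadCurv
end

noncomputable section

namespace QuadCurv

namespace MetricData

open Matrix

/-! ### Variation of the curvature along a derivation -/

section Variation

variable {n : ℕ} {𝒜 : Type*} [CommRing 𝒜] [Algebra ℝ 𝒜] (D : MetricData n 𝒜)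
  (δ : Derivation ℝ 𝒜 𝒜)

lemma map_derivation_mul (M N : Matrix (Fin n) (Fin n) 𝒜) :
    (M * N).map δ = M.map δ * N + M * N.map δ := by
  ext i j
  simp only [map_apply, mul_apply, Matrix.add_apply, map_sum, Derivation.leibniz, smul_eq_mul,
    ← Finset.sum_add_distrib]
  exact Finset.sum_congr rfl fun _ _ => by ring

lemma map_derivation_add (M N : Matrix (Fin n) (Fin n) 𝒜) :
    (M + N).map δ = M.map δ + N.map δ := by
  ext i j; simp

lemma map_derivation_sub (M N : Matrix (Fin n) (Fin n) 𝒜) :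
    (M - N).map δ = M.map δ - N.map δ := by
  ext i j; simp

lemma map_derivation_one : (1 : Matrix (Fin n) (Fin n) 𝒜).map δ = 0 := by
  ext i j; rcases eq_or_ne i j with h | h <;> simp [h]

lemma derivation_trace (M : Matrix (Fin n) (Fin n) 𝒜) : δ M.trace = (M.map δ).trace := by
  simp [trace, diag]

variable {D δ} (hδ : ∀ k f, δ (D.d k f) = D.d k (δ f))

include hδ in
lemma map_derivation_dM (k : Fin n) (M : Matrix (Fin n) (Fin n) 𝒜) :
    (D.dM k M).map δ = D.dM k (M.map δ) := by
  ext i j; simp [hδ]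

include hδ in
-- Apply δ to ∂G = ΓᵀG + GΓ. The varied Γ then satisfies the equation to which the Koszul formula
-- applies.
lemma derivation_Γ {S : Matrix (Fin n) (Fin n) 𝒜} (hS : D.G.map δ = D.G * S) (k : Fin n) :
    ((D.Γ k).map δ)ᵀ * D.G + D.G * (D.Γ k).map δ = D.G * D.cov k S := by
  rw [← covLow_G_mul, ← hS, covLow, ← map_derivation_dM hδ, dM_G, map_derivation_add,
    map_derivation_mul, map_derivation_mul, ← transpose_map]
  abel

include hδ in
-- The Palatini identity; the corrections at the form indices are absent because they cancel under
-- antisymmetrisation.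
lemma derivation_Ω (i j : Fin n) : (D.Ω i j).map δ =
    D.cov i ((D.Γ j).map δ) - D.cov j ((D.Γ i).map δ) := by
  simp only [Ω, cov, map_derivation_add, map_derivation_sub, map_derivation_mul,
    map_derivation_dM hδ]
  abel

include hδ in
lemma derivation_Ric : D.Ric.map δ = D.linRic fun k => (D.Γ k).map δ := by
  ext i k
  rw [map_apply, D.Ric_eq, map_sum, linRic, of_apply]
  refine Finset.sum_congr rfl fun l _ => ?_
  rw [← derivation_Ω hδ]
  rfl

lemma derivation_H {S : Matrix (Fin n) (Fin n) 𝒜} (hS : D.G.map δ = D.G * S) :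
    D.H.map δ = -(S * D.H) := by
  have h : D.G.map δ * D.H + D.G * D.H.map δ = 0 := by
    rw [← map_derivation_mul, D.GH, map_derivation_one]
  rw [hS, mul_assoc, ← mul_add] at h
  have h' := congrArg (D.H * ·) h
  simp only [← mul_assoc, D.HG, one_mul, mul_zero] at h'
  exact eq_neg_of_add_eq_zero_right h'

/-- The integrand `|Ric|² + t R²`. -/
def lagrangian (D : MetricData n 𝒜) (t : ℝ) : 𝒜 :=
  (D.ricEnd * D.ricEnd).trace + algebraMap ℝ 𝒜 t * D.scal ^ 2

include hδ in
-- The integrand is a function of the Ricci endomorphism alone, with gradient `gradEnd`. Varying H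
-- Ric gives the linearised Ricci tensor, and the variation of the inverse metric contributes -S
-- Ric.
lemma derivation_lagrangian {S : Matrix (Fin n) (Fin n) 𝒜} (hS : D.G.map δ = D.G * S) (t : ℝ) :
    δ (D.lagrangian t) = (D.gradEnd t * (D.H * D.linRic fun k => (D.Γ k).map δ)).trace
      - (D.gradEnd t * S * D.ricEnd).trace := by
  have h1 : D.ricEnd.map δ = D.H * (D.linRic fun k => (D.Γ k).map δ) - S * D.ricEnd := by
    rw [ricEnd, map_derivation_mul, derivation_H hS, derivation_Ric hδ, neg_mul, mul_assoc]
    abel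
  have h2 : δ (D.lagrangian t) = (D.gradEnd t * D.ricEnd.map δ).trace := by
    rw [lagrangian, map_add, derivation_trace, map_derivation_mul, trace_add, Derivation.leibniz,
      Derivation.leibniz_pow, Derivation.map_algebraMap, gradEnd, add_mul, trace_add,
      smul_mul_assoc, smul_mul_assoc, one_mul, trace_smul, trace_smul, ← derivation_trace,
      trace_mul_comm (D.ricEnd.map δ), scal]
    simp only [smul_eq_mul, nsmul_eq_mul, Nat.cast_ofNat]
    ring
  rw [h2, h1, mul_sub, trace_sub, mul_assoc (D.gradEnd t) S]

end Variation

/-! ### Restriction to a slice -/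

section Slice

variable {n : ℕ} {𝒜 ℬ : Type*} [CommRing 𝒜] [Algebra ℝ 𝒜] [CommRing ℬ] [Algebra ℝ ℬ]
  {D : MetricData n 𝒜} {D₀ : MetricData n ℬ} (c : CoordChange D D₀) (hJ : c.J = 1)

include hJ

lemma CoordChange.conj_of_J (M : Matrix (Fin n) (Fin n) 𝒜) : c.conj M = c.pull M := by
  have h : c.Ji = 1 := by simpa [hJ] using c.J_mul_Ji
  rw [CoordChange.conj, h, hJ, one_mul, mul_one]

lemma CoordChange.cov_pull (k : Fin n) (M : Matrix (Fin n) (Fin n) 𝒜) :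
    D₀.cov k (c.pull M) = c.pull (D.cov k M) := by
  rw [← c.conj_of_J hJ, c.cov_conj, hJ]
  simp [Matrix.one_apply, c.conj_of_J hJ]

lemma CoordChange.linRic_pull (C : Fin n → Matrix (Fin n) (Fin n) 𝒜) :
    D₀.linRic (fun k => c.pull (C k)) = c.pull (D.linRic C) := by
  ext i k
  rw [c.pull_apply, linRic, linRic, of_apply, of_apply, map_sum]
  refine Finset.sum_congr rfl fun l _ => ?_
  rw [c.cov_pull hJ, c.cov_pull hJ, ← c.pull_sub, c.pull_apply]

lemma CoordChange.gradEnd_pull (t : ℝ) : D₀.gradEnd t = c.pull (D.gradEnd t) := by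
  rw [gradEnd, gradEnd, c.pull_add, c.pull_smul, c.pull_smul, c.pull_one, c.ricEnd_eq,
    c.conj_of_J hJ, c.scal_eq, map_mul, map_mul, AlgHom.commutes, map_ofNat]

lemma CoordChange.H_pull : D₀.H = c.pull D.H := by
  have h : c.Ji = 1 := by simpa [hJ] using c.J_mul_Ji
  rw [c.H_eq, h, one_mul, transpose_one, mul_one]

lemma CoordChange.G_pull : D₀.G = c.pull D.G := by
  rw [c.G_eq, hJ, transpose_one, one_mul, mul_one]; rfl

/-- The first variation of `|Ric|² + t R²` along a family of metrics whose velocity at the slice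
is `ρ` times the trace-free Ricci tensor. The vector field `V` in the divergence term vanishes
where `ρ` vanishes to first order. -/
lemma CoordChange.first_variation (hn : n ≠ 0) {δ : Derivation ℝ 𝒜 𝒜}
    (hδ : ∀ k f, δ (D.d k f) = D.d k (δ f)) (t : ℝ) (ρ : ℬ)
    (hS : c.pull (D.H * D.G.map δ) = ρ • D₀.tf) :
    ∃ V : Fin n → ℬ, (∀ ev : ℬ →ₐ[ℝ] ℝ, ev ρ = 0 → (∀ k, ev (D₀.d k ρ) = 0) → ∀ l, ev (V l) = 0) ∧
      c.Φ (δ (D.lagrangian t)) = D₀.dvg V + (ρ * D₀.bochnerFun t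
        + ∑ k, D₀.d k ρ * D₀.bochnerVec t k) := by
  have hS' : D.G.map δ = D.G * (D.H * D.G.map δ) := by rw [← mul_assoc, D.GH, one_mul]
  set C : Fin n → Matrix (Fin n) (Fin n) ℬ := fun k => c.pull ((D.Γ k).map δ) with hC_def
  have hC : ∀ k m l, C k m l = C l m k := fun k m l => by
    simp only [hC_def, c.pull_apply, map_apply, D.Γ_symm k m l]
  have hK : ∀ k, (C k)ᵀ * D₀.G + D₀.G * C k = D₀.G * D₀.cov k (ρ • D₀.tf) := fun k => by
    rw [← hS, c.cov_pull hJ, c.G_pull hJ, ← c.pull_mul, ← c.pull_mul, ← derivation_Γ hδ hS',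
      c.pull_add, c.pull_mul, c.pull_mul, c.pull_transpose]
  have key := D₀.first_variation hn t ρ hC hK
  -- The vector field is read off from `key`. It is linear in ρ and `C`, and `C` is linear in the
  -- first jet of ρ, whence the vanishing claim.
  refine ⟨_, fun ev h0 h1 l => ?_, Eq.trans ?_ (key.trans (add_assoc _ _ _))⟩
  · have hcov : ∀ k p q, ev (D₀.cov k (ρ • D₀.tf) p q) = 0 := fun k p q => by
      rw [cov_smul, Matrix.add_apply, Matrix.smul_apply, Matrix.smul_apply, smul_eq_mul,
        smul_eq_mul, map_add, map_mul, map_mul, h0, h1, zero_mul, zero_mul, add_zero]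
    have hGC : ∀ k q l, ev ((D₀.G * C k) q l) = 0 := fun k q l => by
      have : ∀ k p q, ev ((D₀.G * D₀.cov k (ρ • D₀.tf)) p q) = 0 := fun k p q => by
        simp only [mul_apply, map_sum, map_mul, hcov, mul_zero, Finset.sum_const_zero]
      rw [D₀.koszul hC hK, map_smul, map_sub, map_add, this, this, this]
      simp
    have hCz : ∀ k m l, ev (C k m l) = 0 := fun k m l => by
      have : C k = D₀.H * (D₀.G * C k) := by rw [← mul_assoc, D₀.HG, one_mul]
      rw [this, mul_apply, map_sum]
      exact Finset.sum_eq_zero fun p _ => by rw [map_mul, hGC, mul_zero]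
    rw [map_sub, map_mul, h0, zero_mul, sub_zero, map_sum]
    refine Finset.sum_eq_zero fun i _ => ?_
    rw [map_sum]
    exact Finset.sum_eq_zero fun k _ => by rw [map_mul, hCz, mul_zero]
  · rw [derivation_lagrangian hδ hS', map_sub, ← c.pull_trace, ← c.pull_trace, c.pull_mul,
      c.pull_mul, c.pull_mul, c.pull_mul, ← c.linRic_pull hJ, ← c.gradEnd_pull hJ, ← c.H_pull hJ,
      hS, ← c.conj_of_J hJ D.ricEnd, ← c.ricEnd_eq, mul_smul_comm, smul_mul_assoc, trace_smul,
      smul_eq_mul]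

end Slice

end MetricData
end QuadCurv
end

noncomputable section

namespace QuadCurv

open Matrix TopologicalSpace

/-! ### The derivative of a determinant -/

section Jacobi

variable {n : ℕ} {𝒜 : Type*} [CommRing 𝒜] [Algebra ℝ 𝒜]

/-- The ring homomorphism `f ↦ f + ε δ f` into the dual numbers. -/
def derivationHom (δ : Derivation ℝ 𝒜 𝒜) : 𝒜 →+* DualNumber 𝒜 where
  toFun f := TrivSqZeroExt.inl f + TrivSqZeroExt.inr (δ f)
  map_one' := by simp
  map_zero' := by simp
  map_mul' f g := by
    ext
    · simp
    · simp [mul_comm]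
  map_add' f g := by
    ext <;> simp

/-- Jacobi's formula, for a derivation. -/
lemma derivation_det (δ : Derivation ℝ 𝒜 𝒜) {G H : Matrix (Fin n) (Fin n) 𝒜} (h : G * H = 1) :
    δ G.det = G.det * (H * G.map δ).trace := by
  -- G + ε δG = G(1 + ε H δG), and det(1 + ε A) = 1 + ε tr A because ε² = 0.
  have h1 : G.map (derivationHom δ) = G.map (algebraMap 𝒜 (DualNumber 𝒜)) *
      (1 + (DualNumber.eps : DualNumber 𝒜) • (H * G.map δ).map (algebraMap 𝒜 (DualNumber 𝒜))) := by
    rw [mul_add, mul_one, mul_smul_comm, ← Matrix.map_mul, ← mul_assoc, h, one_mul]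
    ext i j <;> simp [derivationHom, TrivSqZeroExt.algebraMap_eq_inl]
  have h2 := congrArg Matrix.det h1
  rw [det_mul, det_one_add_smul, ← RingHom.mapMatrix_apply, ← RingHom.map_det,
    ← RingHom.mapMatrix_apply, ← RingHom.map_det, ← AddMonoidHom.map_trace] at h2
  rw [pow_two, DualNumber.eps_mul_eps, mul_zero, add_zero] at h2
  have h3 := congrArg TrivSqZeroExt.snd h2
  simpa [derivationHom, TrivSqZeroExt.algebraMap_eq_inl, trace, TrivSqZeroExt.fst_sum] using h3

lemma MetricData.derivation_det_G (D : MetricData n 𝒜) (k : Fin n) :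
    D.d k D.G.det = D.G.det * (2 * (D.Γ k).trace) := by
  rw [derivation_det (D.d k) D.GH]
  congr 1
  have h : D.G.map (D.d k) = (D.Γ k)ᵀ * D.G + D.G * D.Γ k := D.dM_G k
  have h1 : (D.H * ((D.Γ k)ᵀ * D.G)).trace = (D.Γ k).trace := by
    rw [← mul_assoc, trace_mul_comm, ← mul_assoc, D.GH, one_mul, trace_transpose]
  rw [h, mul_add, trace_add, h1, ← mul_assoc, D.HG, one_mul, two_mul]

/-- The divergence in terms of a square root of the determinant of the metric. -/
lemma MetricData.mul_dvg (D : MetricData n 𝒜) {w : 𝒜} (hw : IsUnit w) (hw2 : w * w = D.G.det)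
    (V : Fin n → 𝒜) : w * D.dvg V = ∑ k, D.d k (w * V k) := by
  have h : ∀ k, D.d k w = w * (D.Γ k).trace := fun k => by
    have h1 := D.derivation_det_G k
    rw [← hw2, Derivation.leibniz, smul_eq_mul] at h1
    have h2 : w * (D.d k w) + w * D.d k w = w * (w * (D.Γ k).trace) + w * (w * (D.Γ k).trace) := by
      linear_combination h1
    have h3 : w * D.d k w = w * (w * (D.Γ k).trace) := by
      rw [← MetricData.half_smul_add_half_smul (w * D.d k w), ← smul_add, h2, smul_add,
        MetricData.half_smul_add_half_smul]
    exact hw.mul_left_cancel h3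
  rw [MetricData.dvg, Finset.mul_sum]
  refine Finset.sum_congr rfl fun k _ => ?_
  rw [Derivation.leibniz, h, smul_eq_mul, smul_eq_mul]
  ring

end Jacobi

/-! ### The divergence theorem in a coordinate domain -/

section Divergence

/-- Integration by parts against the constant function 1; compact support removes the boundary term.
-/
lemma integral_fderiv_eq_zero {E : Type*} [NormedAddCommGroup E] [NormedSpace ℝ E]
    [FiniteDimensional ℝ E] [MeasurableSpace E] [BorelSpace E] (μ : Measure E)
    [μ.IsAddHaarMeasure] {f : E → ℝ} (hf : ContDiff ℝ ∞ f) (hc : HasCompactSupport f) (v : E) :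
    ∫ x, fderiv ℝ f x v ∂μ = 0 := by
  have hi : Integrable f μ := hf.continuous.integrable_of_hasCompactSupport hc
  have hi' : Integrable (fun x => fderiv ℝ f x v) μ := by
    refine Continuous.integrable_of_hasCompactSupport ?_ (hc.fderiv_apply (𝕜 := ℝ) v)
    exact (hf.continuous_fderiv (by simp)).clm_apply continuous_const
  have h := integral_mul_fderiv_eq_neg_fderiv_mul_of_integrable (μ := μ) (f := fun _ : E => (1 : ℝ))
    (g := f) (v := v) (by simp) (by simpa using hi') (by simpa using hi)
    (fun x _ => differentiableAt_const _) (fun x _ => (hf.differentiable (by simp)).differentiableAt)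
  simpa using h

variable {X : Type*} [NormedAddCommGroup X] [NormedSpace ℝ X] {U : Opens X}

lemma SmoothFn.contDiff_extFn {f : SmoothFn U} {K : Set X} (hK : IsCompact K) (hKU : K ⊆ U)
    (hf : ∀ y : U, (y : X) ∉ K → SmoothFn.ev y f = 0) : ContDiff ℝ ∞ (SmoothFn.extFn f) := by
  rw [contDiff_iff_contDiffAt]
  intro y
  by_cases hy : y ∈ U
  · exact (SmoothFn.contDiffOn_extFn f).contDiffAt (U.isOpen.mem_nhds hy)
  · have : SmoothFn.extFn f =ᶠ[nhds y] fun _ => 0 := by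
      filter_upwards [hK.isClosed.isOpen_compl.mem_nhds (fun h => hy (hKU h))] with z hz
      by_cases hzU : z ∈ U
      · exact (SmoothFn.extFn_apply f ⟨z, hzU⟩).trans (hf ⟨z, hzU⟩ hz)
      · simp [SmoothFn.extFn, extZero, hzU]
    exact contDiffAt_const.congr_of_eventuallyEq this

lemma SmoothFn.hasCompactSupport_extFn {f : SmoothFn U} {K : Set X} (hK : IsCompact K)
    (hf : ∀ y : U, (y : X) ∉ K → SmoothFn.ev y f = 0) : HasCompactSupport (SmoothFn.extFn f) := by
  refine HasCompactSupport.intro hK fun y hy => ?_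
  by_cases hyU : y ∈ U
  · exact (SmoothFn.extFn_apply f ⟨y, hyU⟩).trans (hf ⟨y, hyU⟩ hy)
  · simp [SmoothFn.extFn, extZero, hyU]

lemma SmoothFn.extFn_of_notMem (f : SmoothFn U) {y : X} (hy : y ∉ U) : SmoothFn.extFn f y = 0 := by
  simp [SmoothFn.extFn, extZero, hy]

lemma SmoothFn.extFn_of_mem (f : SmoothFn U) {y : X} (hy : y ∈ U) :
    SmoothFn.extFn f y = SmoothFn.ev ⟨y, hy⟩ f := SmoothFn.extFn_apply f ⟨y, hy⟩

/-- The standard coordinate directions of `ℝⁿ`. -/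
abbrev stdDir (n : ℕ) (i : Fin n) : EuclideanSpace ℝ (Fin n) := EuclideanSpace.single i 1

/-- The divergence theorem for compactly supported vector fields in a coordinate domain. -/
lemma integral_dvg_eq_zero {n : ℕ} {U : Opens (EuclideanSpace ℝ (Fin n))}
    {G : EuclideanSpace ℝ (Fin n) → Matrix (Fin n) (Fin n) ℝ}
    {hG : ∀ i j, ContDiffOn ℝ ∞ (fun x => G x i j) U} {hs : ∀ x ∈ U, (G x)ᵀ = G x}
    {hd : ∀ x ∈ U, (G x).det ≠ 0} (hpos : ∀ x ∈ U, 0 < (G x).det)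
    (V : Fin n → SmoothFn U) {K : Set (EuclideanSpace ℝ (Fin n))} (hK : IsCompact K)
    (hKU : K ⊆ U) (hV : ∀ (y : U) k, (y : EuclideanSpace ℝ (Fin n)) ∉ K → SmoothFn.ev y (V k) = 0) :
    ∫ y, Real.sqrt (G y).det * SmoothFn.extFn ((metricData U (stdDir n) G hG hs hd).dvg V) y = 0 := by
  set D := metricData U (stdDir n) G hG hs hd with hD
  have hsm : ContDiffOn ℝ ∞ (fun y => Real.sqrt (G y).det) U :=
    (contDiffOn_det hG).sqrt fun y hy => (hpos y hy).ne'
  set w : SmoothFn U := SmoothFn.of U _ hsm with hw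
  have hwu : IsUnit w := by
    refine IsUnit.of_mul_eq_one (SmoothFn.of U _ (hsm.inv fun y hy => (Real.sqrt_pos.2 (hpos y hy)).ne'))
      (SmoothFn.funext fun y => ?_)
    rw [map_mul, map_one]
    exact mul_inv_cancel₀ (Real.sqrt_pos.2 (hpos y y.2)).ne'
  have hww : w * w = D.G.det := SmoothFn.funext fun y => by
    rw [map_mul, AlgHom.map_det]
    exact Real.mul_self_sqrt (hpos y y.2).le
  have hVk : ∀ k (y : U), (y : EuclideanSpace ℝ (Fin n)) ∉ K → SmoothFn.ev y (w * V k) = 0 :=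
    fun k y hy => by rw [map_mul, hV y k hy, mul_zero]
  have h1 : ∀ y, Real.sqrt (G y).det * SmoothFn.extFn (D.dvg V) y
      = ∑ k, fderiv ℝ (SmoothFn.extFn (w * V k)) y (stdDir n k) := fun y => by
    by_cases hy : y ∈ U
    · have h := congrArg (SmoothFn.ev ⟨y, hy⟩) (D.mul_dvg hwu hww V)
      rw [map_mul, map_sum] at h
      rw [SmoothFn.extFn_of_mem _ hy]
      exact h
    · rw [SmoothFn.extFn_of_notMem _ hy, mul_zero]
      refine (Finset.sum_eq_zero fun k _ => ?_).symm
      have : SmoothFn.extFn (w * V k) =ᶠ[nhds y] fun _ => 0 := by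
        filter_upwards [hK.isClosed.isOpen_compl.mem_nhds (fun h => hy (hKU h))] with z hz
        by_cases hzU : z ∈ U
        · exact (SmoothFn.extFn_of_mem _ hzU).trans (hVk k ⟨z, hzU⟩ hz)
        · exact SmoothFn.extFn_of_notMem _ hzU
      rw [this.fderiv_eq]
      simp
  simp only [h1]
  rw [integral_finsetSum]
  · refine Finset.sum_eq_zero fun k _ => ?_
    exact integral_fderiv_eq_zero volume (SmoothFn.contDiff_extFn hK hKU (hVk k))
      (SmoothFn.hasCompactSupport_extFn hK (hVk k)) _
  · intro k _
    refine Continuous.integrable_of_hasCompactSupport ?_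
      ((SmoothFn.hasCompactSupport_extFn hK (hVk k)).fderiv_apply (𝕜 := ℝ) _)
    exact ((SmoothFn.contDiff_extFn hK hKU (hVk k)).continuous_fderiv (by simp)).clm_apply
      continuous_const

end Divergence

end QuadCurv
end

noncomputable section

namespace QuadCurv

open Matrix TopologicalSpace

/-! ### Smooth changes of coordinates -/

section Change

variable {X Y : Type*} [NormedAddCommGroup X] [NormedSpace ℝ X] [NormedAddCommGroup Y]
  [NormedSpace ℝ Y] {n : ℕ} {U : Opens X} {V : Opens Y}

/-- Composition with a smooth map. -/
def SmoothFn.comp (φ : Y → X) (hφ : ContDiffOn ℝ ∞ φ V) (hm : ∀ z ∈ V, φ z ∈ U) :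
    SmoothFn U →ₐ[ℝ] SmoothFn V where
  toFun f := SmoothFn.of V (fun z => SmoothFn.extFn f (φ z))
    ((SmoothFn.contDiffOn_extFn f).comp hφ hm)
  map_one' := SmoothFn.funext fun z =>
    (SmoothFn.extFn_of_mem 1 (hm z z.2)).trans (by rw [map_one, map_one])
  map_zero' := SmoothFn.funext fun z =>
    (SmoothFn.extFn_of_mem 0 (hm z z.2)).trans (by rw [map_zero, map_zero])
  map_mul' f g := SmoothFn.funext fun z => by
    rw [map_mul, SmoothFn.ev_of, SmoothFn.ev_of, SmoothFn.ev_of]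
    simp only [SmoothFn.extFn_of_mem _ (hm z z.2), map_mul]
  map_add' f g := SmoothFn.funext fun z => by
    rw [map_add, SmoothFn.ev_of, SmoothFn.ev_of, SmoothFn.ev_of]
    simp only [SmoothFn.extFn_of_mem _ (hm z z.2), map_add]
  commutes' r := SmoothFn.funext fun z =>
    (SmoothFn.extFn_of_mem _ (hm z z.2)).trans (by rw [AlgHom.commutes, AlgHom.commutes])

lemma SmoothFn.ev_comp (φ : Y → X) (hφ : ContDiffOn ℝ ∞ φ V) (hm : ∀ z ∈ V, φ z ∈ U)
    (f : SmoothFn U) (z : V) :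
    SmoothFn.ev z (SmoothFn.comp φ hφ hm f) = SmoothFn.ev ⟨φ z, hm z z.2⟩ f :=
  SmoothFn.extFn_of_mem f (hm z z.2)

variable {e : Fin n → X} {e' : Fin n → Y} {G : X → Matrix (Fin n) (Fin n) ℝ}
  {G' : Y → Matrix (Fin n) (Fin n) ℝ}
  {hG : ∀ i j, ContDiffOn ℝ ∞ (fun x => G x i j) U} {hs : ∀ x ∈ U, (G x)ᵀ = G x}
  {hd : ∀ x ∈ U, (G x).det ≠ 0}
  {hG' : ∀ i j, ContDiffOn ℝ ∞ (fun x => G' x i j) V} {hs' : ∀ x ∈ V, (G' x)ᵀ = G' x}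
  {hd' : ∀ x ∈ V, (G' x).det ≠ 0}

/-- The change of coordinates defined by a smooth map with Jacobian matrix `J`. -/
def coordChange (φ : Y → X) (hφ : ContDiffOn ℝ ∞ φ V) (hm : ∀ z ∈ V, φ z ∈ U)
    (J : Y → Matrix (Fin n) (Fin n) ℝ) (hJ : ∀ i j, ContDiffOn ℝ ∞ (fun z => J z i j) V)
    (hφJ : ∀ z ∈ V, ∀ k, fderiv ℝ φ z (e' k) = ∑ p, J z p k • e p)
    (hJJ : ∀ z ∈ V, ∀ k p l, fderiv ℝ (fun z => J z p l) z (e' k)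
      = fderiv ℝ (fun z => J z p k) z (e' l))
    (hGG : ∀ z ∈ V, G' z = (J z)ᵀ * G (φ z) * J z) :
    (metricData U e G hG hs hd).CoordChange (metricData V e' G' hG' hs' hd') where
  Φ := SmoothFn.comp φ hφ hm
  J := Matrix.of fun i j => SmoothFn.of V (fun z => J z i j) (hJ i j)
  -- The relation G' = JᵀGJ and the nondegeneracy of `G'` force the Jacobian to be invertible.
  Ji := Matrix.of fun i j => SmoothFn.of V (fun z => (J z)⁻¹ i j) (contDiffOn_inv hJ
    (fun z hz h => hd' z hz (by rw [hGG z hz, det_mul, h, mul_zero])) i j)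
  J_mul_Ji := by
    ext1 i j
    refine SmoothFn.funext fun y => ?_
    have hJd : (J y).det ≠ 0 := fun h => hd' y y.2 (by rw [hGG y y.2, det_mul, h, mul_zero])
    have h := congrFun (congrFun (mul_nonsing_inv (J y) (isUnit_iff_ne_zero.mpr hJd)) i) j
    rw [mul_apply] at h ⊢
    rw [map_sum]
    simp only [map_mul, of_apply, SmoothFn.ev_of]
    rw [h, one_apply, one_apply]
    split_ifs <;> simp
  d_Φ k f := SmoothFn.funext fun z => by
    have h1 : SmoothFn.ev z (SmoothFn.dir (e' k) (SmoothFn.comp φ hφ hm f))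
        = fderiv ℝ (SmoothFn.extFn f ∘ φ) z (e' k) :=
      SmoothFn.ev_dir_of_eq _ (fun y => rfl) z
    have h2 : DifferentiableAt ℝ (SmoothFn.extFn f) (φ z) :=
      SmoothFn.differentiableAt_extFn f ⟨φ z, hm z z.2⟩
    have h3 : DifferentiableAt ℝ φ z :=
      (hφ.contDiffAt (V.isOpen.mem_nhds z.2)).differentiableAt (by simp)
    refine h1.trans ?_
    rw [fderiv_comp _ h2 h3, ContinuousLinearMap.comp_apply, hφJ z z.2, map_sum, map_sum]
    refine Finset.sum_congr rfl fun p _ => ?_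
    rw [map_smul, smul_eq_mul, map_mul, SmoothFn.ev_comp]
    rfl
  d_J k p l := SmoothFn.funext fun z => by
    refine (SmoothFn.ev_dir_of_eq _ (fun y => rfl) z).trans ((hJJ z z.2 k p l).trans ?_)
    exact (SmoothFn.ev_dir_of_eq _ (fun y => rfl) z).symm
  G_eq := by
    ext1 i j
    refine SmoothFn.funext fun z => ?_
    have h := congrFun (congrFun (hGG z z.2) i) j
    simp only [mul_apply, map_sum, map_mul, transpose_apply, map_apply, SmoothFn.ev_comp] at h ⊢
    exact h

end Change

/-! ### The matrix exponential -/

section Exp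

variable {n : ℕ}

attribute [local instance] Matrix.linftyOpNormedRing Matrix.linftyOpNormedAlgebra
  Matrix.linftyOpNormedAddCommGroup Matrix.linftyOpNormedSpace

/-- The entry of a matrix, as a continuous linear map. -/
def entryCLM (i j : Fin n) : Matrix (Fin n) (Fin n) ℝ →L[ℝ] ℝ :=
  LinearMap.toContinuousLinearMap (Matrix.entryLinearMap ℝ ℝ i j)

lemma contDiffOn_matrix_iff {X : Type*} [NormedAddCommGroup X] [NormedSpace ℝ X]
    {k : WithTop ℕ∞} {M : X → Matrix (Fin n) (Fin n) ℝ} {U : Set X} :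
    ContDiffOn ℝ k M U ↔ ∀ i j, ContDiffOn ℝ k (fun x => M x i j) U := by
  refine ⟨fun h i j => (entryCLM i j).contDiff.comp_contDiffOn h, fun h => ?_⟩
  have : M = fun x => ∑ i, ∑ j, M x i j • Matrix.single i j (1 : ℝ) := by
    funext x
    conv_lhs => rw [matrix_eq_sum_single (M x)]
    simp
  rw [this]
  exact ContDiffOn.sum fun i _ => ContDiffOn.sum fun j _ => (h i j).smul contDiffOn_const

lemma contDiffOn_exp_apply {X : Type*} [NormedAddCommGroup X] [NormedSpace ℝ X]
    {M : X → Matrix (Fin n) (Fin n) ℝ} {U : Set X}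
    (hM : ∀ i j, ContDiffOn ℝ ∞ (fun x => M x i j) U) (i j : Fin n) :
    ContDiffOn ℝ ∞ (fun x => NormedSpace.exp (M x) i j) U := by
  have h : ContDiff ℝ ∞ (NormedSpace.exp : Matrix (Fin n) (Fin n) ℝ → _) :=
    contDiff_iff_contDiffAt.2 fun x => (NormedSpace.exp_analytic (𝕂 := ℝ) x).contDiffAt
  exact contDiffOn_matrix_iff.1 (h.comp_contDiffOn (contDiffOn_matrix_iff.2 hM)) i j

lemma hasDerivAt_exp_smul_apply (N : Matrix (Fin n) (Fin n) ℝ) (s : ℝ) (i j : Fin n) :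
    HasDerivAt (fun s : ℝ => NormedSpace.exp (s • N) i j) ((NormedSpace.exp (s • N) * N) i j) s :=
  (entryCLM i j).hasFDerivAt.comp_hasDerivAt s (hasDerivAt_exp_smul_const (𝕂 := ℝ) N s)

/-- The exponential of a trace-free matrix has determinant one. -/
lemma det_exp_of_trace_eq_zero {N : Matrix (Fin n) (Fin n) ℝ} (hN : N.trace = 0) :
    (NormedSpace.exp N).det = 1 := by
  -- The curve exp(sN) becomes a matrix over the smooth functions on ℝ, with inverse exp(-sN).
  -- Jacobi's formula there gives the derivative of its determinant as the determinant times tr N =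
  -- 0.
  have hsm : ∀ (c : ℝ) (i j : Fin n),
      ContDiffOn ℝ ∞ (fun s : ℝ => NormedSpace.exp (s • (c • N)) i j) (⊤ : Opens ℝ) := fun c =>
    contDiffOn_exp_apply fun i j => by
      simp only [Matrix.smul_apply, smul_eq_mul]
      fun_prop
  set P : Matrix (Fin n) (Fin n) (SmoothFn (⊤ : Opens ℝ)) :=
    Matrix.of fun i j => SmoothFn.of ⊤ _ (hsm 1 i j) with hP
  set Q : Matrix (Fin n) (Fin n) (SmoothFn (⊤ : Opens ℝ)) :=
    Matrix.of fun i j => SmoothFn.of ⊤ _ (hsm (-1) i j) with hQ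
  have hPev : ∀ y, P.map (SmoothFn.ev y) = NormedSpace.exp ((y : ℝ) • N) := fun y => by
    ext i j; simp [hP]
  have hQev : ∀ y, Q.map (SmoothFn.ev y) = NormedSpace.exp (-((y : ℝ) • N)) := fun y => by
    ext i j; simp [hQ]
  have hPQ : P * Q = 1 := by
    ext1 i j
    refine SmoothFn.funext fun y => ?_
    have : (P * Q).map (SmoothFn.ev y) = (1 : Matrix (Fin n) (Fin n) _).map (SmoothFn.ev y) := by
      rw [Matrix.map_mul, hPev, hQev, ← Matrix.exp_add_of_commute _ _ (Commute.refl ((y : ℝ) • N)).neg_right,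
        add_neg_cancel, NormedSpace.exp_zero]
      simp
    exact congrFun (congrFun this i) j
  have hdP : ∀ y, (P.map (SmoothFn.dir (1 : ℝ))).map (SmoothFn.ev y)
      = NormedSpace.exp ((y : ℝ) • N) * N := fun y => by
    ext i j
    refine (SmoothFn.ev_dir_of_eq (F := fun s : ℝ => NormedSpace.exp (s • N) i j) 1
      (fun z => by simp [hP]) y).trans ?_
    rw [(hasDerivAt_exp_smul_apply N y i j).hasFDerivAt.fderiv]
    simp
  have hder := derivation_det (SmoothFn.dir (1 : ℝ)) hPQ
  have hz : SmoothFn.dir (1 : ℝ) P.det = 0 := by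
    rw [hder]
    refine SmoothFn.funext fun y => ?_
    have h1 : SmoothFn.ev y (Q * P.map (SmoothFn.dir (1 : ℝ))).trace
        = ((Q * P.map (SmoothFn.dir (1 : ℝ))).map (SmoothFn.ev y)).trace :=
      AddMonoidHom.map_trace (SmoothFn.ev y : SmoothFn (⊤ : Opens ℝ) →+ ℝ) _
    rw [map_mul, h1, Matrix.map_mul, hdP, hQev, ← mul_assoc,
      ← Matrix.exp_add_of_commute _ _ (Commute.refl ((y : ℝ) • N)).neg_left, neg_add_cancel, NormedSpace.exp_zero,
      one_mul, hN, mul_zero, map_zero]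
  have hev : ∀ y : (⊤ : Opens ℝ), SmoothFn.ev y P.det = (NormedSpace.exp ((y : ℝ) • N)).det :=
    fun y => by
      rw [← hPev, AlgHom.map_det]; rfl
  have hdet : ∀ s : ℝ, HasDerivAt (fun s : ℝ => (NormedSpace.exp (s • N)).det) 0 s := fun s => by
    have h1 : DifferentiableAt ℝ (fun s : ℝ => (NormedSpace.exp (s • N)).det) s := by
      refine ((contDiffOn_det (U := Set.univ) fun i j => ?_).contDiffAt Filter.univ_mem).differentiableAt
        (n := ∞) (by simp)
      simpa using hsm 1 i j
    have h2 := SmoothFn.ev_dir_of_eq (1 : ℝ) (F := fun s : ℝ => (NormedSpace.exp (s • N)).det) hev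
      (⟨s, Opens.mem_top s⟩ : (⊤ : Opens ℝ))
    rw [hz, map_zero] at h2
    have h3 := h1.hasDerivAt
    rwa [← fderiv_apply_one_eq_deriv, ← h2] at h3
  have hc := is_const_of_deriv_eq_zero (fun s => (hdet s).differentiableAt) (fun s => (hdet s).deriv) 1 0
  simpa using hc

end Exp

end QuadCurv
end

/-! ### Metrics on open subsets of ℝⁿ, and the first variation integrated over one chart. -/

noncomputable section

namespace QuadCurv

open Matrix TopologicalSpace

/-- A smooth Riemannian metric on an open subset of `ℝⁿ`. -/
structure LocalMetric (n : ℕ) where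
  U : Opens (EuclideanSpace ℝ (Fin n))
  G : EuclideanSpace ℝ (Fin n) → Matrix (Fin n) (Fin n) ℝ
  smooth : ∀ i j, ContDiffOn ℝ ∞ (fun y => G y i j) U
  posDef : ∀ y ∈ U, (G y).PosDef

namespace LocalMetric

variable {n : ℕ} (m : LocalMetric n)

lemma symm (y) (hy : y ∈ m.U) : (m.G y)ᵀ = m.G y := by
  have h := (m.posDef y hy).isHermitian
  rwa [IsHermitian, conjTranspose_eq_transpose_of_trivial] at h

lemma det_pos (y) (hy : y ∈ m.U) : 0 < (m.G y).det := (m.posDef y hy).det_pos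

/-- The metric as a matrix of smooth functions. -/
def data : MetricData n (SmoothFn m.U) :=
  metricData m.U (stdDir n) m.G m.smooth m.symm fun y hy => (m.det_pos y hy).ne'

lemma isSlice : IsSlice m.U (stdDir n) m.G id m.U m.G where
  isOpen := m.U.isOpen
  mem _ hz := hz
  eq _ _ := rfl
  deriv z _ := ⟨ContinuousLinearMap.id ℝ _, hasFDerivAt_id z, fun _ => rfl⟩

lemma map_tf_trace (hn : n ≠ 0) (y : m.U) : (m.data.tf.map (SmoothFn.ev y)).trace = 0 := by
  have := congrArg (SmoothFn.ev y) (m.data.trace_tf hn)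
  rw [map_zero] at this
  rw [← this]
  exact (AddMonoidHom.map_trace (SmoothFn.ev y : SmoothFn m.U →+ ℝ) _).symm

/-! ### The volume preserving variation in the direction of the trace-free Ricci tensor -/

variable (ρ : SmoothFn m.U)

/-- `ρ` times the trace-free Ricci endomorphism. -/
def velocity (y : EuclideanSpace ℝ (Fin n)) : Matrix (Fin n) (Fin n) ℝ :=
  Matrix.of fun i j => SmoothFn.extFn (ρ * m.data.tf i j) y

/-- The gauge transformation `exp (s / 2 • velocity)`. -/
def gauge (s : ℝ) (y : EuclideanSpace ℝ (Fin n)) : Matrix (Fin n) (Fin n) ℝ :=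
  -- The gauge enters `varG` twice, so the factor 1/2 makes the velocity of the metric exactly ρ L.
  NormedSpace.exp (s • ((1 / 2 : ℝ) • m.velocity ρ y))

/-- The family of metrics obtained from the gauge transformations. -/
def varG (s : ℝ) (y : EuclideanSpace ℝ (Fin n)) : Matrix (Fin n) (Fin n) ℝ :=
  (m.gauge ρ s y)ᵀ * m.G y * m.gauge ρ s y

variable {ρ}

lemma velocity_of_mem (y : m.U) : m.velocity ρ y =
    SmoothFn.ev y ρ • m.data.tf.map (SmoothFn.ev y) := by
  ext i j
  simp only [velocity, of_apply, SmoothFn.extFn_apply, map_mul, Matrix.smul_apply, map_apply,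
    smul_eq_mul]

lemma velocity_of_eq_zero {y : EuclideanSpace ℝ (Fin n)} (h : SmoothFn.extFn ρ y = 0) :
    m.velocity ρ y = 0 := by
  ext i j
  by_cases hy : y ∈ m.U
  · rw [SmoothFn.extFn_of_mem _ hy] at h
    simp [velocity, SmoothFn.extFn_of_mem _ hy, h]
  · simp [velocity, SmoothFn.extFn_of_notMem _ hy]

lemma gauge_of_eq_zero {y : EuclideanSpace ℝ (Fin n)} (h : SmoothFn.extFn ρ y = 0) (s : ℝ) :
    m.gauge ρ s y = 1 := by
  rw [gauge, m.velocity_of_eq_zero h]; simp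

lemma gauge_zero (y : EuclideanSpace ℝ (Fin n)) : m.gauge ρ 0 y = 1 := by
  rw [gauge]; simp

lemma gauge_mul_gauge_neg (s : ℝ) (y : EuclideanSpace ℝ (Fin n)) :
    m.gauge ρ s y * m.gauge ρ (-s) y = 1 := by
  rw [gauge, gauge, neg_smul, ← Matrix.exp_add_of_commute _ _
    (Commute.refl (s • ((1 / 2 : ℝ) • m.velocity ρ y))).neg_right,
    add_neg_cancel, NormedSpace.exp_zero]

/-- The exponent is trace-free, so the volume density is preserved at each point and for every `s`,
not merely to first order. -/
lemma det_gauge (hn : n ≠ 0) (s : ℝ) (y : EuclideanSpace ℝ (Fin n)) : (m.gauge ρ s y).det = 1 := by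
  by_cases hy : y ∈ m.U
  · refine det_exp_of_trace_eq_zero ?_
    rw [m.velocity_of_mem ⟨y, hy⟩, trace_smul, trace_smul, trace_smul, m.map_tf_trace hn,
      smul_zero, smul_zero, smul_zero]
  · rw [m.gauge_of_eq_zero (SmoothFn.extFn_of_notMem ρ hy), det_one]

lemma varG_zero (y : EuclideanSpace ℝ (Fin n)) : m.varG ρ 0 y = m.G y := by
  rw [varG, m.gauge_zero, transpose_one, one_mul, mul_one]

lemma det_varG (hn : n ≠ 0) (s : ℝ) (y : EuclideanSpace ℝ (Fin n)) :
    (m.varG ρ s y).det = (m.G y).det := by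
  rw [varG, det_mul, det_mul, det_transpose, m.det_gauge hn, one_mul, mul_one]

lemma varG_symm (s : ℝ) {y} (hy : y ∈ m.U) : (m.varG ρ s y)ᵀ = m.varG ρ s y := by
  rw [varG, transpose_mul, transpose_mul, transpose_transpose, m.symm y hy, mul_assoc]

/-- The domain of the family of metrics. -/
def cylinder : Opens (ℝ × EuclideanSpace ℝ (Fin n)) :=
  ⟨{p | p.2 ∈ m.U}, m.U.isOpen.preimage continuous_snd⟩

lemma contDiffOn_velocity (i j : Fin n) : ContDiffOn ℝ ∞ (fun y => m.velocity ρ y i j) m.U :=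
  SmoothFn.contDiffOn_extFn _

lemma contDiffOn_gauge (i j : Fin n) :
    ContDiffOn ℝ ∞ (fun p : ℝ × EuclideanSpace ℝ (Fin n) => m.gauge ρ p.1 p.2 i j) m.cylinder := by
  refine contDiffOn_exp_apply (fun i j => ?_) i j
  simp only [Matrix.smul_apply, smul_eq_mul]
  exact contDiff_fst.contDiffOn.mul (contDiffOn_const.mul
    ((m.contDiffOn_velocity i j).comp contDiff_snd.contDiffOn fun p hp => hp))

lemma contDiffOn_varG (i j : Fin n) :
    ContDiffOn ℝ ∞ (fun p : ℝ × EuclideanSpace ℝ (Fin n) => m.varG ρ p.1 p.2 i j) m.cylinder := by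
  simp only [varG, mul_apply, transpose_apply, Finset.sum_mul]
  refine ContDiffOn.sum fun k _ => ContDiffOn.sum fun l _ => ?_
  exact ((m.contDiffOn_gauge l i).mul ((m.smooth l k).comp contDiff_snd.contDiffOn fun p hp => hp)).mul
    (m.contDiffOn_gauge k j)

variable (ρ) in
/-- The family of metrics as a matrix of smooth functions. -/
def varData (hn : n ≠ 0) : MetricData n (SmoothFn m.cylinder) :=
  metricData m.cylinder (fun i => ((0 : ℝ), stdDir n i)) (fun p => m.varG ρ p.1 p.2)
    m.contDiffOn_varG (fun p hp => m.varG_symm p.1 hp)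
    (fun p hp => by rw [m.det_varG hn]; exact (m.det_pos p.2 hp).ne')

lemma isSlice_varG (s : ℝ) : IsSlice m.cylinder (fun i => ((0 : ℝ), stdDir n i))
    (fun p => m.varG ρ p.1 p.2) (fun y => (s, y)) m.U (m.varG ρ s) where
  isOpen := m.U.isOpen
  mem _ hz := hz
  eq _ _ := rfl
  deriv z _ := ⟨ContinuousLinearMap.inr ℝ ℝ _, hasFDerivAt_prodMk_right s z, fun _ => rfl⟩

variable (ρ) in
/-- The slice `s = 0` of the family of metrics. -/
def sliceChange (hn : n ≠ 0) : (m.varData ρ hn).CoordChange m.data :=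
  coordChange (fun y => ((0 : ℝ), y)) (contDiff_prodMk_right (0 : ℝ)).contDiffOn (fun z hz => hz)
    (fun _ => 1) (fun i j => contDiffOn_const)
    (fun z _ k => by
      rw [(hasFDerivAt_prodMk_right (𝕜 := ℝ) (0 : ℝ) z).fderiv]
      simp [Matrix.one_apply])
    (fun z hz k p l => by simp)
    (fun z hz => by rw [m.varG_zero, transpose_one, one_mul, mul_one])

lemma sliceChange_J (hn : n ≠ 0) : (m.sliceChange ρ hn).J = 1 := by
  ext1 i j
  refine SmoothFn.funext fun y => ?_
  change (1 : Matrix (Fin n) (Fin n) ℝ) i j = _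
  rw [one_apply, one_apply]
  split_ifs <;> simp

lemma ev_sliceChange (hn : n ≠ 0) (f : SmoothFn m.cylinder) (y : m.U) :
    SmoothFn.ev y ((m.sliceChange ρ hn).Φ f) =
      SmoothFn.ev ⟨((0 : ℝ), (y : EuclideanSpace ℝ (Fin n))), y.2⟩ f :=
  SmoothFn.ev_comp (fun y => ((0 : ℝ), y)) (contDiff_prodMk_right (0 : ℝ)).contDiffOn
    (fun z hz => hz) f y

lemma hasDerivAt_gauge_zero (y : EuclideanSpace ℝ (Fin n)) (i j : Fin n) :
    HasDerivAt (fun s => m.gauge ρ s y i j) (((1 / 2 : ℝ) • m.velocity ρ y) i j) 0 := by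
  have := hasDerivAt_exp_smul_apply ((1 / 2 : ℝ) • m.velocity ρ y) 0 i j
  rwa [zero_smul, NormedSpace.exp_zero, one_mul] at this

/-- The two gauge factors contribute transposed halves, which agree because the lowered trace-free
Ricci tensor is symmetric. -/
lemma hasDerivAt_varG_zero {y : EuclideanSpace ℝ (Fin n)} (hy : y ∈ m.U) (i j : Fin n) :
    HasDerivAt (fun s => m.varG ρ s y i j) ((m.G y * m.velocity ρ y) i j) 0 := by
  have h1 : HasDerivAt (fun s => ∑ k, (∑ l, m.gauge ρ s y l i * m.G y l k) * m.gauge ρ s y k j)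
      (∑ k, ((∑ l, ((1 / 2 : ℝ) • m.velocity ρ y) l i * m.G y l k) * m.gauge ρ 0 y k j
        + (∑ l, m.gauge ρ 0 y l i * m.G y l k) * ((1 / 2 : ℝ) • m.velocity ρ y) k j)) 0 := by
    refine HasDerivAt.fun_sum fun k _ => ?_
    refine HasDerivAt.mul ?_ (m.hasDerivAt_gauge_zero y k j)
    exact HasDerivAt.fun_sum fun l _ => (m.hasDerivAt_gauge_zero y l i).mul_const _
  have hsym : (m.velocity ρ y)ᵀ * m.G y = m.G y * m.velocity ρ y := by
    have h2 : (m.data.tf.map (SmoothFn.ev ⟨y, hy⟩))ᵀ * m.G y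
        = m.G y * m.data.tf.map (SmoothFn.ev ⟨y, hy⟩) := by
      have h3 : (m.G y * m.data.tf.map (SmoothFn.ev ⟨y, hy⟩))
          = (m.data.G * m.data.tf).map (SmoothFn.ev ⟨y, hy⟩) := by
        rw [Matrix.map_mul]; rfl
      conv_lhs => rw [← m.symm y hy]
      rw [← transpose_mul, h3, ← transpose_map, m.data.G_mul_tf_symm]
    rw [m.velocity_of_mem ⟨y, hy⟩, transpose_smul, smul_mul_assoc, h2, mul_smul_comm]
  have h4 : ∑ k, ((∑ l, ((1 / 2 : ℝ) • m.velocity ρ y) l i * m.G y l k) * m.gauge ρ 0 y k j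
        + (∑ l, m.gauge ρ 0 y l i * m.G y l k) * ((1 / 2 : ℝ) • m.velocity ρ y) k j)
      = (m.G y * m.velocity ρ y) i j := by
    have h5 : ∑ k, ((∑ l, ((1 / 2 : ℝ) • m.velocity ρ y) l i * m.G y l k) * m.gauge ρ 0 y k j
        + (∑ l, m.gauge ρ 0 y l i * m.G y l k) * ((1 / 2 : ℝ) • m.velocity ρ y) k j)
        = (((1 / 2 : ℝ) • m.velocity ρ y)ᵀ * m.G y * m.gauge ρ 0 y
          + (m.gauge ρ 0 y)ᵀ * m.G y * ((1 / 2 : ℝ) • m.velocity ρ y)) i j := by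
      rw [Finset.sum_add_distrib]
      simp only [Matrix.add_apply, mul_apply, transpose_apply]
    rw [h5, m.gauge_zero, transpose_one, one_mul, mul_one, transpose_smul, smul_mul_assoc, hsym,
      mul_smul_comm, ← add_smul]
    norm_num
  rw [h4] at h1
  refine h1.congr_of_eventuallyEq (Filter.Eventually.of_forall fun s => ?_)
  simp only [varG, mul_apply, transpose_apply]

variable (ρ) in
/-- The integrand `ρ f + dρ(W)` of the Bochner-type formula. -/
def bochnerIntegrand (t : ℝ) : SmoothFn m.U :=
  ρ * m.data.bochnerFun t + ∑ k, m.data.d k ρ * m.data.bochnerVec t k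

/-- The abstract first variation with δ = ∂_s on ℝ × U, restricted to s = 0. The vanishing of `V`
with the first jet of ρ later confines its support. -/
lemma slice_first_variation (hn : n ≠ 0) (t : ℝ) :
    ∃ V : Fin n → SmoothFn m.U, (∀ y, SmoothFn.ev y ρ = 0 →
        (∀ k, SmoothFn.ev y (m.data.d k ρ) = 0) → ∀ l, SmoothFn.ev y (V l) = 0) ∧
      (m.sliceChange ρ hn).Φ (SmoothFn.dir ((1 : ℝ), 0) ((m.varData ρ hn).lagrangian t))
        = m.data.dvg V + m.bochnerIntegrand ρ t := by
  obtain ⟨V, h1, h2⟩ := (m.sliceChange ρ hn).first_variation (m.sliceChange_J hn) hn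
    (δ := SmoothFn.dir ((1 : ℝ), 0)) (fun k f => SmoothFn.dir_comm _ _ f) t ρ (by
      ext1 i j
      refine SmoothFn.funext fun y => ?_
      have hδ : ∀ p q, SmoothFn.ev ⟨((0 : ℝ), (y : EuclideanSpace ℝ (Fin n))), y.2⟩
          (SmoothFn.dir (U := m.cylinder) ((1 : ℝ), (0 : EuclideanSpace ℝ (Fin n)))
            ((m.varData ρ hn).G p q)) = (m.G y * m.velocity ρ y) p q := fun p q => by
        rw [SmoothFn.ev_dir_of_eq (F := fun p' => m.varG ρ p'.1 p'.2 p q) _ (fun z => rfl)]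
        have hd : DifferentiableAt ℝ (fun p' : ℝ × EuclideanSpace ℝ (Fin n) =>
            m.varG ρ p'.1 p'.2 p q) ((0 : ℝ), (y : EuclideanSpace ℝ (Fin n))) :=
          ((m.contDiffOn_varG p q).contDiffAt (m.cylinder.isOpen.mem_nhds y.2)).differentiableAt
            (by simp)
        have h3 := hd.hasFDerivAt.comp_hasDerivAt (0 : ℝ)
          ((hasDerivAt_id (0 : ℝ)).prodMk (hasDerivAt_const (0 : ℝ) (y : EuclideanSpace ℝ (Fin n))))
        exact h3.unique (m.hasDerivAt_varG_zero y.2 p q)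
      have h6 : SmoothFn.ev y ((m.sliceChange ρ hn).pull ((m.varData ρ hn).H *
          (m.varData ρ hn).G.map (SmoothFn.dir ((1 : ℝ), 0))) i j)
          = ((m.G y)⁻¹ * (m.G y * m.velocity ρ y)) i j := by
        rw [MetricData.CoordChange.pull_apply]
        rw [m.ev_sliceChange hn, mul_apply, mul_apply, map_sum]
        refine Finset.sum_congr rfl fun p _ => ?_
        rw [map_mul, map_apply, hδ]
        congr 1
        change (m.varG ρ 0 y)⁻¹ i p = _
        rw [m.varG_zero]
      rw [h6, ← mul_assoc, nonsing_inv_mul _ (isUnit_iff_ne_zero.mpr (m.det_pos y y.2).ne'),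
        one_mul, m.velocity_of_mem]
      simp)
  exact ⟨V, fun y => h1 (SmoothFn.ev y), h2⟩

lemma lagrangian_eq (hn : n ≠ 0) (t : ℝ) {s : ℝ}
    {G' : EuclideanSpace ℝ (Fin n) → Matrix (Fin n) (Fin n) ℝ}
    (h : IsSlice m.cylinder (fun i => ((0 : ℝ), stdDir n i)) (fun p => m.varG ρ p.1 p.2)
      (fun y => (s, y)) m.U G') {y : EuclideanSpace ℝ (Fin n)} (hy : y ∈ m.U) :
    normSq₂ (G' y) (ricci G' y) + t * scalar G' y ^ 2
      = SmoothFn.extFn ((m.varData ρ hn).lagrangian t) (s, y) := by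
  have hy' : ((s, y) : ℝ × EuclideanSpace ℝ (Fin n)) ∈ m.cylinder := hy
  rw [SmoothFn.extFn_of_mem _ hy', MetricData.lagrangian, map_add, map_mul, map_pow,
    AlgHom.commutes, h.normSq₂_eq hy, h.scalar_eq hy]
  rfl

lemma hasDerivAt_lagrangian (hn : n ≠ 0) (t s : ℝ) {y : EuclideanSpace ℝ (Fin n)} (hy : y ∈ m.U) :
    HasDerivAt (fun s => SmoothFn.extFn ((m.varData ρ hn).lagrangian t) (s, y))
      (SmoothFn.extFn (SmoothFn.dir ((1 : ℝ), 0) ((m.varData ρ hn).lagrangian t)) (s, y)) s := by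
  have hy' : ((s, y) : ℝ × EuclideanSpace ℝ (Fin n)) ∈ m.cylinder := hy
  rw [SmoothFn.extFn_of_mem _ hy', SmoothFn.ev_dir]
  exact (SmoothFn.differentiableAt_extFn _ ⟨(s, y), hy'⟩).hasFDerivAt.comp_hasDerivAt s
    ((hasDerivAt_id s).prodMk (hasDerivAt_const s y))

end LocalMetric

lemma SmoothFn.ev_dir_eq_zero {X : Type*} [NormedAddCommGroup X] [NormedSpace ℝ X] {U : Opens X}
    {f : SmoothFn U} {K : Set X} (hK : IsClosed K)
    (hf : ∀ y : U, (y : X) ∉ K → SmoothFn.ev y f = 0) (v : X) (y : U) (hy : (y : X) ∉ K) :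
    SmoothFn.ev y (SmoothFn.dir v f) = 0 := by
  have : SmoothFn.extFn f =ᶠ[nhds (y : X)] fun _ => 0 := by
    filter_upwards [hK.isOpen_compl.mem_nhds hy, U.isOpen.mem_nhds y.2] with z hz hzU
    exact (SmoothFn.extFn_of_mem f hzU).trans (hf ⟨z, hzU⟩ hz)
  rw [SmoothFn.ev_dir, this.fderiv_eq]
  simp

namespace LocalMetric

variable {n : ℕ} (m : LocalMetric n) {ρ : SmoothFn m.U}

lemma integrable_sqrt_det_mul {f : SmoothFn m.U} {K : Set (EuclideanSpace ℝ (Fin n))}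
    (hK : IsCompact K) (hKU : K ⊆ m.U)
    (hf : ∀ y : m.U, (y : EuclideanSpace ℝ (Fin n)) ∉ K → SmoothFn.ev y f = 0) :
    Integrable fun y => Real.sqrt (m.G y).det * SmoothFn.extFn f y := by
  set w : SmoothFn m.U := SmoothFn.of m.U _
    ((contDiffOn_det m.smooth).sqrt fun y hy => (m.det_pos y hy).ne') with hw
  have hz : ∀ y : m.U, (y : EuclideanSpace ℝ (Fin n)) ∉ K → SmoothFn.ev y (w * f) = 0 :=
    fun y hy => by rw [map_mul, hf y hy, mul_zero]
  have h : (fun y => Real.sqrt (m.G y).det * SmoothFn.extFn f y) = SmoothFn.extFn (w * f) := by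
    funext y
    by_cases hy : y ∈ m.U
    · rw [SmoothFn.extFn_of_mem _ hy, SmoothFn.extFn_of_mem _ hy, map_mul]; rfl
    · rw [SmoothFn.extFn_of_notMem _ hy, SmoothFn.extFn_of_notMem _ hy, mul_zero]
  rw [h]
  exact (SmoothFn.contDiff_extFn hK hKU hz).continuous.integrable_of_hasCompactSupport
    (SmoothFn.hasCompactSupport_extFn hK hz)

/-- The integrated first variation. -/
lemma integral_first_variation (hn : n ≠ 0) (t : ℝ) {K : Set (EuclideanSpace ℝ (Fin n))}
    (hK : IsCompact K) (hKU : K ⊆ m.U)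
    (hρ : ∀ y : m.U, (y : EuclideanSpace ℝ (Fin n)) ∉ K → SmoothFn.ev y ρ = 0) :
    ∫ y, Real.sqrt (m.G y).det *
        SmoothFn.extFn (SmoothFn.dir ((1 : ℝ), 0) ((m.varData ρ hn).lagrangian t)) (0, y)
      = ∫ y, Real.sqrt (m.G y).det * SmoothFn.extFn (m.bochnerIntegrand ρ t) y := by
  obtain ⟨V, hV, h⟩ := m.slice_first_variation (ρ := ρ) hn t
  have hdρ : ∀ k (y : m.U), (y : EuclideanSpace ℝ (Fin n)) ∉ K →
      SmoothFn.ev y (m.data.d k ρ) = 0 := fun k => SmoothFn.ev_dir_eq_zero hK.isClosed hρ _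
  have hVK : ∀ (y : m.U) k, (y : EuclideanSpace ℝ (Fin n)) ∉ K → SmoothFn.ev y (V k) = 0 :=
    fun y k hy => hV y (hρ y hy) (fun k => hdρ k y hy) k
  have hdvg : ∀ y : m.U, (y : EuclideanSpace ℝ (Fin n)) ∉ K →
      SmoothFn.ev y (m.data.dvg V) = 0 := fun y hy => by
    rw [MetricData.dvg, map_sum]
    refine Finset.sum_eq_zero fun k _ => ?_
    rw [map_add, map_mul, hVK y k hy, mul_zero, add_zero]
    exact SmoothFn.ev_dir_eq_zero hK.isClosed (fun y hy => hVK y k hy) _ y hy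
  have hbI : ∀ y : m.U, (y : EuclideanSpace ℝ (Fin n)) ∉ K →
      SmoothFn.ev y (m.bochnerIntegrand ρ t) = 0 := fun y hy => by
    rw [bochnerIntegrand, map_add, map_mul, hρ y hy, zero_mul, zero_add, map_sum]
    exact Finset.sum_eq_zero fun k _ => by rw [map_mul, hdρ k y hy, zero_mul]
  have hsplit : ∀ y, Real.sqrt (m.G y).det *
      SmoothFn.extFn (SmoothFn.dir ((1 : ℝ), 0) ((m.varData ρ hn).lagrangian t)) (0, y)
      = Real.sqrt (m.G y).det * SmoothFn.extFn (m.data.dvg V) y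
        + Real.sqrt (m.G y).det * SmoothFn.extFn (m.bochnerIntegrand ρ t) y := fun y => by
    rw [← mul_add]
    congr 1
    by_cases hy : y ∈ m.U
    · have hy' : (((0 : ℝ), y) : ℝ × EuclideanSpace ℝ (Fin n)) ∈ m.cylinder := hy
      rw [SmoothFn.extFn_of_mem _ hy, SmoothFn.extFn_of_mem _ hy, SmoothFn.extFn_of_mem _ hy',
        ← map_add, ← h, m.ev_sliceChange hn]
    · have hy' : (((0 : ℝ), y) : ℝ × EuclideanSpace ℝ (Fin n)) ∉ m.cylinder := hy
      rw [SmoothFn.extFn_of_notMem _ hy, SmoothFn.extFn_of_notMem _ hy,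
        SmoothFn.extFn_of_notMem _ hy', add_zero]
  simp only [hsplit]
  rw [integral_add (m.integrable_sqrt_det_mul hK hKU hdvg) (m.integrable_sqrt_det_mul hK hKU hbI)]
  -- `V` vanishes off the compact set `K`, so its divergence integrates to zero against √det G.
  have h0 := integral_dvg_eq_zero (hG := m.smooth) (hs := m.symm)
    (hd := fun y hy => (m.det_pos y hy).ne') m.det_pos V hK hKU hVK
  rw [data] at *
  rw [h0, zero_add]

end LocalMetric

end QuadCurv
end

/-! ### Metrics on the manifold read in charts, and transition maps. -/

noncomputable section

namespace QuadCurv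

open Matrix TopologicalSpace

section Charts

variable {n : ℕ} {M : Type*} [TopologicalSpace M] [ChartedSpace (EuclideanSpace ℝ (Fin n)) M]
  [IsManifold (𝓡 n) ∞ M]

/-- The coordinate vector field `∂_i` of the preferred chart at `a`, as a field on `M`. -/
def frameVec (a : M) (i : Fin n) (x : M) : TangentSpace (𝓡 n) x :=
  (trivializationAt (EuclideanSpace ℝ (Fin n)) (fun x : M => TangentSpace (𝓡 n) x) a).symmL ℝ x
    (stdDir n i)

/-- The derivative of the inverse chart is the local frame of the tangent bundle trivialisation.
This links the coordinate components of `g` to smoothness in the bundle sense. -/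
lemma coordVector_eq_frameVec (a : M) (i : Fin n) {y : EuclideanSpace ℝ (Fin n)}
    (hy : y ∈ (chartAt (EuclideanSpace ℝ (Fin n)) a).target) :
    coordVector a i y = frameVec a i ((chartAt (EuclideanSpace ℝ (Fin n)) a).symm y) := by
  have hx := (chartAt (EuclideanSpace ℝ (Fin n)) a).map_target hy
  rw [frameVec, TangentBundle.symmL_trivializationAt hx]
  have h1 : extChartAt (𝓡 n) a ((chartAt (EuclideanSpace ℝ (Fin n)) a).symm y) = y := by
    simp [extChartAt, (chartAt (EuclideanSpace ℝ (Fin n)) a).right_inv hy]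
  have h2 : Set.range (𝓡 n) = Set.univ := by simp
  rw [h2, mfderivWithin_univ]
  exact congrArg (fun z => (mfderiv (𝓡 n) (𝓡 n) (chartAt (EuclideanSpace ℝ (Fin n)) a).symm z
    (EuclideanSpace.single i (1 : ℝ) : EuclideanSpace ℝ (Fin n)) : EuclideanSpace ℝ (Fin n))) h1.symm

section

variable {P EP HP : Type*} [NormedAddCommGroup EP] [NormedSpace ℝ EP] [TopologicalSpace HP]
  {IP : ModelWithCorners ℝ EP HP} [TopologicalSpace P] [ChartedSpace HP P]

lemma contMDiffAt_bilinForm_iff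
    {B : P → EuclideanSpace ℝ (Fin n) →L[ℝ] EuclideanSpace ℝ (Fin n) →L[ℝ] ℝ} {p₀ : P} :
    ContMDiffAt IP 𝓘(ℝ, EuclideanSpace ℝ (Fin n) →L[ℝ] EuclideanSpace ℝ (Fin n) →L[ℝ] ℝ) ∞ B p₀ ↔
      ∀ i j, ContMDiffAt IP 𝓘(ℝ, ℝ) ∞ (fun p => B p (stdDir n i) (stdDir n j)) p₀ := by
  refine ⟨fun h i j => (h.clm_apply contMDiffAt_const).clm_apply contMDiffAt_const, fun h => ?_⟩
  have hB : B = fun p => ∑ i, ∑ j, B p (stdDir n i) (stdDir n j) •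
      ((EuclideanSpace.proj i : EuclideanSpace ℝ (Fin n) →L[ℝ] ℝ).smulRight
        (EuclideanSpace.proj j : EuclideanSpace ℝ (Fin n) →L[ℝ] ℝ)) := by
    funext p
    ext v w
    have hv : ∀ v : EuclideanSpace ℝ (Fin n), v = ∑ i, v i • stdDir n i := fun v => by
      ext k; simp [Finset.sum_apply, Pi.single_apply]
    conv_lhs => rw [hv v, hv w]
    simp only [map_sum, map_smul, _root_.sum_apply, _root_.smul_apply,
      ContinuousLinearMap.smulRight_apply, smul_eq_mul, PiLp.proj_apply]
    rw [Finset.sum_comm]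
    refine Finset.sum_congr rfl fun i _ => ?_
    rw [Finset.mul_sum]
    exact Finset.sum_congr rfl fun j _ => by ring
  rw [hB]
  refine ContMDiffAt.sum fun i _ => ContMDiffAt.sum fun j _ => ?_
  exact (h i j).smul contMDiffAt_const

set_option synthInstance.maxHeartbeats 400000 in
-- Smoothness is tested on components in one frame. The base map `b` is arbitrary, so this serves
-- both a metric pulled back by a chart and a family over ℝ × M.
lemma contMDiffAt_bilin_iff {b : P → M}
    {Q : ∀ p, TangentSpace (𝓡 n) (b p) →L[ℝ] TangentSpace (𝓡 n) (b p) →L[ℝ] ℝ} {p₀ : P} {a : M}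
    (hb : ContMDiffAt IP (𝓡 n) ∞ b p₀)
    (ha : b p₀ ∈ (chartAt (EuclideanSpace ℝ (Fin n)) a).source) :
    ContMDiffAt IP
      ((𝓡 n).prod 𝓘(ℝ, EuclideanSpace ℝ (Fin n) →L[ℝ] EuclideanSpace ℝ (Fin n) →L[ℝ] ℝ)) ∞
      (fun p => Bundle.TotalSpace.mk'
        (EuclideanSpace ℝ (Fin n) →L[ℝ] EuclideanSpace ℝ (Fin n) →L[ℝ] ℝ)
        (E := fun x : M => TangentSpace (𝓡 n) x →L[ℝ] TangentSpace (𝓡 n) x →L[ℝ] ℝ)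
        (b p) (Q p)) p₀ ↔
      ∀ i j, ContMDiffAt IP 𝓘(ℝ, ℝ) ∞ (fun p => Q p (frameVec a i (b p)) (frameVec a j (b p))) p₀ := by
  set e := trivializationAt (EuclideanSpace ℝ (Fin n) →L[ℝ] EuclideanSpace ℝ (Fin n) →L[ℝ] ℝ)
    (fun x : M => TangentSpace (𝓡 n) x →L[ℝ] TangentSpace (𝓡 n) x →L[ℝ] ℝ) a with he
  have hsrc : Bundle.TotalSpace.mk'
        (EuclideanSpace ℝ (Fin n) →L[ℝ] EuclideanSpace ℝ (Fin n) →L[ℝ] ℝ)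
        (E := fun x : M => TangentSpace (𝓡 n) x →L[ℝ] TangentSpace (𝓡 n) x →L[ℝ] ℝ)
        (b p₀) (Q p₀) ∈ e.source := by
    rw [e.mem_source]
    change b p₀ ∈ e.baseSet
    simpa [he] using ha
  have hev : ∀ᶠ p in nhds p₀, b p ∈ (chartAt (EuclideanSpace ℝ (Fin n)) a).source :=
    hb.continuousAt.eventually
      ((chartAt (EuclideanSpace ℝ (Fin n)) a).open_source.mem_nhds ha)
  have happ : ∀ p, b p ∈ (chartAt (EuclideanSpace ℝ (Fin n)) a).source → ∀ v w,
      (e (Bundle.TotalSpace.mk'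
        (EuclideanSpace ℝ (Fin n) →L[ℝ] EuclideanSpace ℝ (Fin n) →L[ℝ] ℝ)
        (E := fun x : M => TangentSpace (𝓡 n) x →L[ℝ] TangentSpace (𝓡 n) x →L[ℝ] ℝ)
        (b p) (Q p))).2 v w = Q p
        ((trivializationAt (EuclideanSpace ℝ (Fin n)) (fun x : M => TangentSpace (𝓡 n) x) a).symmL
          ℝ (b p) v)
        ((trivializationAt (EuclideanSpace ℝ (Fin n)) (fun x : M => TangentSpace (𝓡 n) x) a).symmL
          ℝ (b p) w) := fun p hp v w => by
    rw [he, hom_trivializationAt_apply]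
    refine (inCoordinates_apply_eq₂ (F₃ := ℝ) (E₃ := Bundle.Trivial M ℝ) hp hp
      (Set.mem_univ _)).trans ?_
    rw [Bundle.Trivialization.symmL_apply _ hp, Bundle.Trivialization.symmL_apply _ hp]
    simp
  rw [e.contMDiffAt_iff hsrc]
  have hpr : ContMDiffAt IP (𝓡 n) ∞ (fun p => (Bundle.TotalSpace.mk'
        (EuclideanSpace ℝ (Fin n) →L[ℝ] EuclideanSpace ℝ (Fin n) →L[ℝ] ℝ)
        (E := fun x : M => TangentSpace (𝓡 n) x →L[ℝ] TangentSpace (𝓡 n) x →L[ℝ] ℝ)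
        (b p) (Q p)).proj) p₀ := hb
  rw [and_iff_right hpr, contMDiffAt_bilinForm_iff]
  refine forall₂_congr fun i j => ?_
  refine Filter.EventuallyEq.contMDiffAt_iff ?_
  filter_upwards [hev] with p hp
  exact happ p hp _ _

end

/-! ### The metric in a chart -/

section LocalMetric

lemma contMDiffAt_chart_symm (a : M) {y : EuclideanSpace ℝ (Fin n)}
    (hy : y ∈ (chartAt (EuclideanSpace ℝ (Fin n)) a).target) :
    ContMDiffAt (𝓡 n) (𝓡 n) ∞ (chartAt (EuclideanSpace ℝ (Fin n)) a).symm y :=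
  contMDiffOn_chart_symm.contMDiffAt
    ((chartAt (EuclideanSpace ℝ (Fin n)) a).open_target.mem_nhds hy)

lemma contMDiffAt_chart (a : M) {x : M}
    (hx : x ∈ (chartAt (EuclideanSpace ℝ (Fin n)) a).source) :
    ContMDiffAt (𝓡 n) (𝓡 n) ∞ (chartAt (EuclideanSpace ℝ (Fin n)) a) x :=
  contMDiffOn_chart.contMDiffAt
    ((chartAt (EuclideanSpace ℝ (Fin n)) a).open_source.mem_nhds hx)

lemma coordMetric_apply (g : Metric n M) (a : M) {y : EuclideanSpace ℝ (Fin n)}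
    (hy : y ∈ (chartAt (EuclideanSpace ℝ (Fin n)) a).target) (i j : Fin n) :
    coordMetric g a y i j = g.inner _
      (frameVec a i ((chartAt (EuclideanSpace ℝ (Fin n)) a).symm y))
      (frameVec a j ((chartAt (EuclideanSpace ℝ (Fin n)) a).symm y)) := by
  rw [coordMetric, of_apply, coordVector_eq_frameVec a i hy, coordVector_eq_frameVec a j hy]

lemma contDiffOn_coordMetric (g : Metric n M) (a : M) (i j : Fin n) :
    ContDiffOn ℝ ∞ (fun y => coordMetric g a y i j)
      (chartAt (EuclideanSpace ℝ (Fin n)) a).target := by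
  intro y hy
  have hb := contMDiffAt_chart_symm a hy
  have h := (contMDiffAt_bilin_iff (Q := fun y => g.inner _) hb
    ((chartAt (EuclideanSpace ℝ (Fin n)) a).map_target hy)).1 (g.contMDiff.contMDiffAt.comp y hb) i j
  refine (contMDiffAt_iff_contDiffAt.1 h).contDiffWithinAt.congr_of_mem (fun z hz => ?_) hy
  exact coordMetric_apply g a hz i j

lemma sum_smul_frameVec (a : M) (x : M) (v : EuclideanSpace ℝ (Fin n)) :
    (trivializationAt (EuclideanSpace ℝ (Fin n)) (fun x : M => TangentSpace (𝓡 n) x) a).symmL ℝ x v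
      = ∑ i, v i • frameVec a i x := by
  have hv : v = ∑ i, v i • stdDir n i := by
    ext k; simp [Finset.sum_apply, Pi.single_apply]
  conv_lhs => rw [hv]
  rw [map_sum]
  exact Finset.sum_congr rfl fun i _ => map_smul _ _ _

lemma posDef_coordMetric (g : Metric n M) (a : M) {y : EuclideanSpace ℝ (Fin n)}
    (hy : y ∈ (chartAt (EuclideanSpace ℝ (Fin n)) a).target) : (coordMetric g a y).PosDef := by
  set x := (chartAt (EuclideanSpace ℝ (Fin n)) a).symm y with hx
  have hxs : x ∈ (chartAt (EuclideanSpace ℝ (Fin n)) a).source :=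
    (chartAt (EuclideanSpace ℝ (Fin n)) a).map_target hy
  refine PosDef.of_dotProduct_mulVec_pos ?_ fun v hv => ?_
  · ext i j
    simp only [conjTranspose_apply, star_trivial]
    rw [coordMetric_apply g a hy, coordMetric_apply g a hy, g.symm]
  · set w := (trivializationAt (EuclideanSpace ℝ (Fin n))
      (fun x : M => TangentSpace (𝓡 n) x) a).symmL ℝ x (WithLp.toLp 2 v) with hw
    have hwne : w ≠ 0 := fun h0 => hv (by
      have := (trivializationAt (EuclideanSpace ℝ (Fin n))
        (fun x : M => TangentSpace (𝓡 n) x) a).continuousLinearMapAt_symmL (R := ℝ) hxs (WithLp.toLp 2 v)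
      rw [← hw, h0, map_zero] at this
      simpa using this.symm)
    have h1 : star v ⬝ᵥ (coordMetric g a y *ᵥ v) = g.inner x w w := by
      rw [hw, sum_smul_frameVec]
      simp only [map_sum, map_smul, _root_.sum_apply, _root_.smul_apply, dotProduct, mulVec,
        star_trivial, smul_eq_mul, coordMetric_apply g a hy, Finset.mul_sum, Pi.star_apply]
      rw [Finset.sum_comm]
      refine Finset.sum_congr rfl fun i _ => Finset.sum_congr rfl fun j _ => ?_
      ring
    rw [h1]
    exact g.pos x w hwne

/-- The metric `g` in the preferred chart at `a`. -/
def localMetric (g : Metric n M) (a : M) : LocalMetric n where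
  U := ⟨(chartAt (EuclideanSpace ℝ (Fin n)) a).target,
    (chartAt (EuclideanSpace ℝ (Fin n)) a).open_target⟩
  G := coordMetric g a
  smooth := contDiffOn_coordMetric g a
  posDef _ hy := posDef_coordMetric g a hy

end LocalMetric

/-! ### Transition maps -/

section Transition

/-- The transition map from the preferred chart at `b` to the one at `a`. -/
def transition (a b : M) : EuclideanSpace ℝ (Fin n) → EuclideanSpace ℝ (Fin n) :=
  chartAt (EuclideanSpace ℝ (Fin n)) a ∘ (chartAt (EuclideanSpace ℝ (Fin n)) b).symm

/-- The domain of the transition map. -/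
def overlap (a b : M) : Opens (EuclideanSpace ℝ (Fin n)) :=
  ⟨((chartAt (EuclideanSpace ℝ (Fin n)) b).symm.trans (chartAt (EuclideanSpace ℝ (Fin n)) a)).source,
    ((chartAt (EuclideanSpace ℝ (Fin n)) b).symm.trans
      (chartAt (EuclideanSpace ℝ (Fin n)) a)).open_source⟩

omit [IsManifold (𝓡 n) ∞ M] in
lemma mem_overlap {a b : M} {z : EuclideanSpace ℝ (Fin n)} : z ∈ overlap a b ↔
    z ∈ (chartAt (EuclideanSpace ℝ (Fin n)) b).target ∧
      (chartAt (EuclideanSpace ℝ (Fin n)) b).symm z ∈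
        (chartAt (EuclideanSpace ℝ (Fin n)) a).source := by
  change z ∈ ((chartAt (EuclideanSpace ℝ (Fin n)) b).symm.trans
    (chartAt (EuclideanSpace ℝ (Fin n)) a)).source ↔ _
  rw [OpenPartialHomeomorph.trans_source]
  rfl

lemma contDiffOn_transition (a b : M) : ContDiffOn ℝ ∞ (transition (n := n) a b) (overlap (n := n) a b) := by
  intro z hz
  obtain ⟨h1, h2⟩ := mem_overlap.1 hz
  exact (contMDiffAt_iff_contDiffAt.1
    ((contMDiffAt_chart a h2).comp z (contMDiffAt_chart_symm b h1))).contDiffWithinAt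

/-- The Jacobian matrix of the transition map. -/
def jacobian (a b : M) (z : EuclideanSpace ℝ (Fin n)) : Matrix (Fin n) (Fin n) ℝ :=
  Matrix.of fun p k => (fderiv ℝ (transition (n := n) a b) z (stdDir n k)) p

lemma frameVec_transition {a b : M} {z : EuclideanSpace ℝ (Fin n)} (hz : z ∈ overlap a b)
    (k : Fin n) : frameVec b k ((chartAt (EuclideanSpace ℝ (Fin n)) b).symm z) =
      ∑ p, jacobian a b z p k • frameVec a p ((chartAt (EuclideanSpace ℝ (Fin n)) b).symm z) := by
  obtain ⟨h1, h2⟩ := mem_overlap.1 hz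
  set x := (chartAt (EuclideanSpace ℝ (Fin n)) b).symm z with hx
  let e := trivializationAt (EuclideanSpace ℝ (Fin n)) (fun x : M => TangentSpace (𝓡 n) x) a
  have h3 : e.continuousLinearMapAt ℝ x (frameVec b k x)
      = fderiv ℝ (transition (n := n) a b) z (stdDir n k) := by
    rw [TangentBundle.continuousLinearMapAt_trivializationAt h2, hx,
      ← coordVector_eq_frameVec b k h1]
    have hc := mfderiv_comp (I := 𝓡 n) (I' := 𝓡 n) (I'' := 𝓡 n) z
      ((contMDiffAt_chart a h2).mdifferentiableAt (by simp))
      ((contMDiffAt_chart_symm b h1).mdifferentiableAt (by simp))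
    have h4 := congrArg (fun L => L (stdDir n k)) hc
    rw [mfderiv_eq_fderiv] at h4
    exact h4.symm
  have h5 := e.symmL_continuousLinearMapAt (R := ℝ) h2 (frameVec b k x)
  rw [h3] at h5
  exact h5.symm.trans (sum_smul_frameVec a x _)

lemma coordMetric_transition (g : Metric n M) {a b : M} {z : EuclideanSpace ℝ (Fin n)}
    (hz : z ∈ overlap a b) : coordMetric g b z =
      (jacobian a b z)ᵀ * coordMetric g a (transition a b z) * jacobian a b z := by
  obtain ⟨h1, h2⟩ := mem_overlap.1 hz
  have h3 : transition a b z ∈ (chartAt (EuclideanSpace ℝ (Fin n)) a).target :=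
    (chartAt (EuclideanSpace ℝ (Fin n)) a).map_source h2
  have h4 : (chartAt (EuclideanSpace ℝ (Fin n)) a).symm (transition a b z)
      = (chartAt (EuclideanSpace ℝ (Fin n)) b).symm z :=
    (chartAt (EuclideanSpace ℝ (Fin n)) a).left_inv h2
  have h5 : ∀ p q, coordMetric g a (transition a b z) p q = g.inner _
      (frameVec a p ((chartAt (EuclideanSpace ℝ (Fin n)) b).symm z))
      (frameVec a q ((chartAt (EuclideanSpace ℝ (Fin n)) b).symm z)) := fun p q => by
    rw [coordMetric_apply g a h3, h4]
  ext i j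
  rw [coordMetric_apply g b h1, frameVec_transition hz, frameVec_transition hz]
  simp only [map_sum, map_smul, _root_.sum_apply, _root_.smul_apply, mul_apply, transpose_apply,
    smul_eq_mul, h5, Finset.sum_mul]
  refine Finset.sum_congr rfl fun p _ => ?_
  rw [Finset.mul_sum]
  exact Finset.sum_congr rfl fun q _ => by ring

end Transition

end Charts
end QuadCurv
end

/-! ### Chart independence and continuity of the curvature quantities. -/

noncomputable section

namespace QuadCurv

open Matrix TopologicalSpace

namespace MetricData.CoordChange

variable {n : ℕ} {𝒜 ℬ : Type*} [CommRing 𝒜] [Algebra ℝ 𝒜] [CommRing ℬ] [Algebra ℝ ℬ]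
  {D : MetricData n 𝒜} {D' : MetricData n ℬ} (c : CoordChange D D')

lemma trace_ricEnd_mul_ricEnd_eq :
    (D'.ricEnd * D'.ricEnd).trace = c.Φ (D.ricEnd * D.ricEnd).trace := by
  rw [c.ricEnd_eq, ← c.conj_mul, c.conj_trace]

lemma bochnerIntegrand_eq (t : ℝ) (ρ : 𝒜) :
    c.Φ ρ * D'.bochnerFun t + ∑ k, D'.d k (c.Φ ρ) * D'.bochnerVec t k =
      c.Φ (ρ * D.bochnerFun t + ∑ k, D.d k ρ * D.bochnerVec t k) := by
  rw [c.sum_mul_bochnerVec t _ _ (fun k => c.d_Φ k ρ), c.bochnerFun_eq, map_add, map_mul, map_sum]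
  simp only [map_mul]

end MetricData.CoordChange

namespace LocalMetric

variable {n : ℕ} (m : LocalMetric n)

lemma bochnerIntegrand_add (t : ℝ) (ρ σ : SmoothFn m.U) :
    m.bochnerIntegrand (ρ + σ) t = m.bochnerIntegrand ρ t + m.bochnerIntegrand σ t := by
  simp only [bochnerIntegrand, map_add, add_mul, Finset.sum_add_distrib]
  ring

lemma bochnerIntegrand_sum {ι : Type*} (s : Finset ι) (t : ℝ) (ρ : ι → SmoothFn m.U) :
    m.bochnerIntegrand (∑ i ∈ s, ρ i) t = ∑ i ∈ s, m.bochnerIntegrand (ρ i) t := by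
  induction s using Finset.cons_induction with
  | empty => simp [bochnerIntegrand]
  | cons i s hi ih => rw [Finset.sum_cons, Finset.sum_cons, bochnerIntegrand_add, ih]

lemma bochnerIntegrand_one (t : ℝ) : m.bochnerIntegrand 1 t = m.data.bochnerFun t := by
  simp [bochnerIntegrand]

end LocalMetric

section Charts

variable {n : ℕ} {M : Type*} [TopologicalSpace M] [ChartedSpace (EuclideanSpace ℝ (Fin n)) M]
  [IsManifold (𝓡 n) ∞ M]

/-- The metric `g` in the preferred chart at `b`, on the domain of the transition map to the
chart at `a`. -/
def overlapMetric (g : Metric n M) (a b : M) : LocalMetric n where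
  U := overlap a b
  G := coordMetric g b
  smooth i j := (contDiffOn_coordMetric g b i j).mono fun _ hz => (mem_overlap.1 hz).1
  posDef _ hz := posDef_coordMetric g b (mem_overlap.1 hz).1

omit [IsManifold (𝓡 n) ∞ M] in
lemma transition_mem {a b : M} {z : EuclideanSpace ℝ (Fin n)} (hz : z ∈ overlap a b) :
    transition a b z ∈ (chartAt (EuclideanSpace ℝ (Fin n)) a).target :=
  (chartAt (EuclideanSpace ℝ (Fin n)) a).map_source (mem_overlap.1 hz).2

lemma contDiffOn_jacobian (a b : M) (p k : Fin n) :
    ContDiffOn ℝ ∞ (fun z => jacobian a b z p k) (overlap (n := n) a b) := by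
  have h := ((contDiffOn_transition (n := n) a b).fderiv_of_isOpen (m := ∞) (overlap a b).isOpen
    (by simp)).clm_apply (contDiffOn_const (c := stdDir n k))
  exact (EuclideanSpace.proj (𝕜 := ℝ) p).contDiff.comp_contDiffOn h

/-- The change from the chart at `a` to the chart at `b`. -/
def transitionChange (g : Metric n M) (a b : M) :
    (localMetric g a).data.CoordChange (overlapMetric g a b).data :=
  coordChange (transition a b) (contDiffOn_transition a b) (fun _ hz => transition_mem hz)
    (jacobian a b) (contDiffOn_jacobian a b)
    (fun z _ k => by
      ext q
      simp [jacobian, Finset.sum_apply, Pi.single_apply])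
    (fun z hz k p l => by
      have hf := contDiffOn_transition (n := n) a b
      have hd : DifferentiableAt ℝ (fderiv ℝ (transition (n := n) a b)) z :=
        ((hf.fderiv_of_isOpen (m := ∞) (overlap a b).isOpen (by simp)).contDiffAt
          ((overlap a b).isOpen.mem_nhds hz)).differentiableAt (by simp)
      have key : ∀ k l, fderiv ℝ (fun z => jacobian a b z p l) z (stdDir n k)
          = (fderiv ℝ (fderiv ℝ (transition (n := n) a b)) z (stdDir n k) (stdDir n l)) p :=
        fun k l => by
          have h1 := (EuclideanSpace.proj (𝕜 := ℝ) p).hasFDerivAt.comp z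
            (hd.hasFDerivAt.clm_apply (hasFDerivAt_const (stdDir n l) z))
          have h2 : HasFDerivAt (fun z => jacobian a b z p l) _ z := h1
          rw [h2.fderiv]
          simp
      rw [key, key, ((hf.contDiffAt ((overlap a b).isOpen.mem_nhds hz)).isSymmSndFDerivAt
        (by simpa using ENat.LEInfty.out)).eq])
    (fun z hz => coordMetric_transition g hz)

/-- Restriction from the chart at `b` to the overlap with the chart at `a`. -/
def restrictionChange (g : Metric n M) (a b : M) :
    (localMetric g b).data.CoordChange (overlapMetric g a b).data :=
  coordChange id contDiff_id.contDiffOn (fun _ hz => (mem_overlap.1 hz).1)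
    (fun _ => 1) (fun _ _ => contDiffOn_const)
    (fun z _ k => by
      rw [fderiv_id]
      ext q
      simp [Matrix.one_apply])
    (fun _ _ _ _ _ => by simp)
    (fun z _ => by rw [transpose_one, one_mul, mul_one]; rfl)

/-- Two charts are compared on their overlap, into whose ring of functions both change homomorphisms
map; invariants agree because they have the same image there. -/
lemma eq_of_change (g : Metric n M) {a b : M} {z : EuclideanSpace ℝ (Fin n)}
    (hz : z ∈ overlap a b) {fa : SmoothFn (localMetric g a).U} {fb : SmoothFn (localMetric g b).U}
    (h : (transitionChange g a b).Φ fa = (restrictionChange g a b).Φ fb) :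
    SmoothFn.extFn fb z = SmoothFn.extFn fa (transition a b z) := by
  have h1 : SmoothFn.ev (U := overlap (n := n) a b) ⟨z, hz⟩ ((transitionChange g a b).Φ fa)
      = SmoothFn.extFn fa (transition a b z) := rfl
  have h2 : SmoothFn.ev (U := overlap (n := n) a b) ⟨z, hz⟩ ((restrictionChange g a b).Φ fb)
      = SmoothFn.extFn fb z := rfl
  rw [← h1, ← h2, h]

omit [IsManifold (𝓡 n) ∞ M] in
lemma mem_overlap_self {a x : M} (hx : x ∈ (chartAt (EuclideanSpace ℝ (Fin n)) a).source) :
    coordPoint n x ∈ overlap (n := n) a x := by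
  refine mem_overlap.2 ⟨mem_chart_target _ x, ?_⟩
  rwa [coordPoint, (chartAt (EuclideanSpace ℝ (Fin n)) x).left_inv (mem_chart_source _ x)]

omit [IsManifold (𝓡 n) ∞ M] in
lemma transition_coordPoint (a x : M) :
    transition a x (coordPoint n x) = chartAt (EuclideanSpace ℝ (Fin n)) a x := by
  rw [coordPoint, transition, Function.comp_apply,
    (chartAt (EuclideanSpace ℝ (Fin n)) x).left_inv (mem_chart_source _ x)]

lemma coordPoint_mem (g : Metric n M) (x : M) : coordPoint n x ∈ (localMetric g x).U :=
  mem_chart_target _ x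

/-- The definition uses a chart that varies with `x`. Expressing the value in a fixed chart is what
gives continuity and allows integration. -/
lemma scalarCurvature_eq (g : Metric n M) {a x : M}
    (hx : x ∈ (chartAt (EuclideanSpace ℝ (Fin n)) a).source) :
    scalarCurvature g x = SmoothFn.extFn (localMetric g a).data.scal
      (chartAt (EuclideanSpace ℝ (Fin n)) a x) := by
  rw [← transition_coordPoint, ← eq_of_change g (mem_overlap_self hx)
    (((transitionChange g a x).scal_eq).symm.trans (restrictionChange g a x).scal_eq),
    SmoothFn.extFn_of_mem _ (coordPoint_mem g x)]
  exact (localMetric g x).isSlice.scalar_eq (coordPoint_mem g x)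

lemma normSq_ricciAt_eq (g : Metric n M) {a x : M}
    (hx : x ∈ (chartAt (EuclideanSpace ℝ (Fin n)) a).source) :
    normSq₂ (metricAt g x) (ricciAt g x) = SmoothFn.extFn
      ((localMetric g a).data.ricEnd * (localMetric g a).data.ricEnd).trace
      (chartAt (EuclideanSpace ℝ (Fin n)) a x) := by
  rw [← transition_coordPoint, ← eq_of_change g (mem_overlap_self hx)
    (((transitionChange g a x).trace_ricEnd_mul_ricEnd_eq).symm.trans
      (restrictionChange g a x).trace_ricEnd_mul_ricEnd_eq),
    SmoothFn.extFn_of_mem _ (coordPoint_mem g x)]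
  exact (localMetric g x).isSlice.normSq₂_eq (coordPoint_mem g x)

/-- A smooth function on `M` in the preferred chart at `a`. -/
def localFn (g : Metric n M) (ρ : M → ℝ) (hρ : ContMDiff (𝓡 n) 𝓘(ℝ, ℝ) ∞ ρ) (a : M) :
    SmoothFn (localMetric g a).U :=
  SmoothFn.of _ (ρ ∘ (chartAt (EuclideanSpace ℝ (Fin n)) a).symm) fun _ hy =>
    (contMDiffAt_iff_contDiffAt.1
      (hρ.contMDiffAt.comp _ (contMDiffAt_chart_symm a hy))).contDiffWithinAt

/-- The integrand `ρ f + dρ(W)` of the Bochner-type formula, as a function on `M`. -/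
def bochnerAt (g : Metric n M) (t : ℝ) (ρ : M → ℝ) (hρ : ContMDiff (𝓡 n) 𝓘(ℝ, ℝ) ∞ ρ) (x : M) : ℝ :=
  SmoothFn.extFn ((localMetric g x).bochnerIntegrand (localFn g ρ hρ x) t) (coordPoint n x)

lemma bochnerAt_eq (g : Metric n M) (t : ℝ) (ρ : M → ℝ) (hρ : ContMDiff (𝓡 n) 𝓘(ℝ, ℝ) ∞ ρ)
    {a x : M} (hx : x ∈ (chartAt (EuclideanSpace ℝ (Fin n)) a).source) :
    bochnerAt g t ρ hρ x = SmoothFn.extFn ((localMetric g a).bochnerIntegrand (localFn g ρ hρ a) t)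
      (chartAt (EuclideanSpace ℝ (Fin n)) a x) := by
  rw [← transition_coordPoint, bochnerAt]
  refine eq_of_change g (mem_overlap_self hx) ?_
  rw [LocalMetric.bochnerIntegrand, LocalMetric.bochnerIntegrand,
    ← MetricData.CoordChange.bochnerIntegrand_eq, ← MetricData.CoordChange.bochnerIntegrand_eq]
  have h : (transitionChange g a x).Φ (localFn g ρ hρ a)
      = (restrictionChange g a x).Φ (localFn g ρ hρ x) := by
    refine SmoothFn.funext fun z => ?_
    have h1 : SmoothFn.ev (U := overlap (n := n) a x) z
        ((transitionChange g a x).Φ (localFn g ρ hρ a))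
        = SmoothFn.extFn (localFn g ρ hρ a) (transition a x z) := rfl
    have h2 : SmoothFn.ev (U := overlap (n := n) a x) z
        ((restrictionChange g a x).Φ (localFn g ρ hρ x))
        = SmoothFn.extFn (localFn g ρ hρ x) z := rfl
    have hz1 : transition a x z ∈ (localMetric g a).U := transition_mem z.2
    have hz2 : (z : EuclideanSpace ℝ (Fin n)) ∈ (localMetric g x).U := (mem_overlap.1 z.2).1
    refine h1.trans (Eq.trans ?_ h2.symm)
    rw [SmoothFn.extFn_of_mem _ hz1, SmoothFn.extFn_of_mem _ hz2]
    change ρ ((chartAt (EuclideanSpace ℝ (Fin n)) a).symm (transition a x z)) = _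
    rw [transition, Function.comp_apply,
      (chartAt (EuclideanSpace ℝ (Fin n)) a).left_inv (mem_overlap.1 z.2).2]
    rfl
  rw [h]

lemma continuous_of_local {q : M → ℝ} (g : Metric n M) (f : ∀ a, SmoothFn (localMetric g a).U)
    (h : ∀ a x, x ∈ (chartAt (EuclideanSpace ℝ (Fin n)) a).source →
      q x = SmoothFn.extFn (f a) (chartAt (EuclideanSpace ℝ (Fin n)) a x)) : Continuous q := by
  rw [continuous_iff_continuousAt]
  intro a
  have h1 : ContinuousAt (SmoothFn.extFn (f a)) (chartAt (EuclideanSpace ℝ (Fin n)) a a) :=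
    (SmoothFn.differentiableAt_extFn (f a) ⟨_, coordPoint_mem g a⟩).continuousAt
  have h2 : ContinuousAt (chartAt (EuclideanSpace ℝ (Fin n)) a) a :=
    (chartAt (EuclideanSpace ℝ (Fin n)) a).continuousAt (mem_chart_source _ a)
  refine (h1.comp h2).congr ?_
  filter_upwards [(chartAt (EuclideanSpace ℝ (Fin n)) a).open_source.mem_nhds (mem_chart_source _ a)]
    with x hx
  exact (h a x hx).symm

lemma continuous_scalarCurvature (g : Metric n M) : Continuous (scalarCurvature g) :=
  continuous_of_local g _ fun _ _ hx => scalarCurvature_eq g hx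

lemma continuous_normSq_ricciAt (g : Metric n M) :
    Continuous fun x => normSq₂ (metricAt g x) (ricciAt g x) :=
  continuous_of_local g _ fun _ _ hx => normSq_ricciAt_eq g hx

lemma continuous_bochnerAt (g : Metric n M) (t : ℝ) (ρ : M → ℝ)
    (hρ : ContMDiff (𝓡 n) 𝓘(ℝ, ℝ) ∞ ρ) : Continuous (bochnerAt g t ρ hρ) :=
  continuous_of_local g _ fun _ _ hx => bochnerAt_eq g t ρ hρ hx

end Charts
end QuadCurv
end

noncomputable section

namespace QuadCurv

open Matrix TopologicalSpace

/-! ### The Riemannian volume -/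

section Volume

variable {n : ℕ} {M : Type*} [TopologicalSpace M] [ChartedSpace (EuclideanSpace ℝ (Fin n)) M]
  [IsManifold (𝓡 n) ∞ M] [MeasurableSpace M] [BorelSpace M]

local notation "𝔼" => EuclideanSpace ℝ (Fin n)

lemma aemeasurable_chart_symm (g : Metric n M) (a : M) :
    AEMeasurable (chartAt 𝔼 a).symm ((volume.restrict (chartAt 𝔼 a).target).withDensity
      fun y => ENNReal.ofReal (Real.sqrt (coordMetric g a y).det)) :=
  ((chartAt 𝔼 a).continuousOn_symm.aemeasurable (chartAt 𝔼 a).open_target.measurableSet).mono_ac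
    (withDensity_absolutelyContinuous _ _)

lemma chartVolume_apply (g : Metric n M) (a : M) {A : Set M} (hA : MeasurableSet A) :
    chartVolume g a A = ∫⁻ y in (chartAt 𝔼 a).symm ⁻¹' A ∩ (chartAt 𝔼 a).target,
      ENNReal.ofReal (Real.sqrt (coordMetric g a y).det) := by
  rw [chartVolume, Measure.map_apply_of_aemeasurable (aemeasurable_chart_symm g a) hA,
    withDensity_apply', Measure.restrict_restrict' (chartAt 𝔼 a).open_target.measurableSet]

lemma chartVolume_inter_source (g : Metric n M) (a : M) {A : Set M} (hA : MeasurableSet A) :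
    chartVolume g a (A ∩ (chartAt 𝔼 a).source) = chartVolume g a A := by
  rw [chartVolume_apply g a hA,
    chartVolume_apply g a (hA.inter (chartAt 𝔼 a).open_source.measurableSet)]
  congr 2
  ext y
  simp only [Set.mem_inter_iff, Set.mem_preimage]
  exact ⟨fun h => ⟨h.1.1, h.2⟩, fun h => ⟨⟨h.1, (chartAt 𝔼 a).map_target h.2⟩, h.2⟩⟩

omit [IsManifold (𝓡 n) ∞ M] in
lemma measurableSet_chart_preimage (a : M) {A : Set M} (hA : MeasurableSet A) :
    MeasurableSet ((chartAt 𝔼 a).symm ⁻¹' A ∩ (chartAt 𝔼 a).target) := by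
  have h : Measurable ((chartAt 𝔼 a).target.domRestrict (chartAt 𝔼 a).symm) :=
    (continuousOn_iff_continuous_domRestrict.1 (chartAt 𝔼 a).continuousOn_symm).measurable
  have h2 := (MeasurableEmbedding.subtype_coe
    (chartAt 𝔼 a).open_target.measurableSet).measurableSet_image.2 (h hA)
  convert h2 using 1
  ext y
  simp [and_comm, Set.domRestrict]

omit [IsManifold (𝓡 n) ∞ M] [MeasurableSpace M] [BorelSpace M] in
lemma det_fderiv_transition (a b : M) (z : 𝔼) :
    (fderiv ℝ (transition (n := n) a b) z).det = (jacobian a b z).det := by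
  rw [ContinuousLinearMap.det, ← LinearMap.det_toMatrix (EuclideanSpace.basisFun (Fin n) ℝ).toBasis]
  rfl

/-- Change of variables: √det G acquires the factor |det J|, which is the Jacobian of the transition
map. -/
lemma chartVolume_inter (g : Metric n M) (a b : M) {A : Set M} (hA : MeasurableSet A) :
    chartVolume g b (A ∩ (chartAt 𝔼 a).source) = chartVolume g a (A ∩ (chartAt 𝔼 b).source) := by
  set A' := A ∩ (chartAt 𝔼 a).source ∩ (chartAt 𝔼 b).source with hA'
  have hm : MeasurableSet A' := (hA.inter (chartAt 𝔼 a).open_source.measurableSet).inter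
    (chartAt 𝔼 b).open_source.measurableSet
  have h1 : chartVolume g b (A ∩ (chartAt 𝔼 a).source) = chartVolume g b A' :=
    (chartVolume_inter_source g b (hA.inter (chartAt 𝔼 a).open_source.measurableSet)).symm
  have h2 : chartVolume g a (A ∩ (chartAt 𝔼 b).source) = chartVolume g a A' := by
    rw [hA', Set.inter_right_comm]
    exact (chartVolume_inter_source g a (hA.inter (chartAt 𝔼 b).open_source.measurableSet)).symm
  rw [h1, h2, chartVolume_apply g a hm, chartVolume_apply g b hm]
  set B := (chartAt 𝔼 b).symm ⁻¹' A' ∩ (chartAt 𝔼 b).target with hB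
  have hBo : ∀ z ∈ B, z ∈ overlap (n := n) a b := fun z hz => mem_overlap.2 ⟨hz.2, hz.1.1.2⟩
  have himg : (chartAt 𝔼 a).symm ⁻¹' A' ∩ (chartAt 𝔼 a).target = transition a b '' B := by
    ext y
    constructor
    · rintro ⟨hy, hyt⟩
      refine ⟨chartAt 𝔼 b ((chartAt 𝔼 a).symm y), ⟨?_, (chartAt 𝔼 b).map_source hy.2⟩, ?_⟩
      · rw [Set.mem_preimage, (chartAt 𝔼 b).left_inv hy.2]; exact hy
      · rw [transition, Function.comp_apply, (chartAt 𝔼 b).left_inv hy.2,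
          (chartAt 𝔼 a).right_inv hyt]
    · rintro ⟨z, hz, rfl⟩
      refine ⟨?_, transition_mem (hBo z hz)⟩
      rw [Set.mem_preimage, transition, Function.comp_apply,
        (chartAt 𝔼 a).left_inv (mem_overlap.1 (hBo z hz)).2]
      exact hz.1
  have hinj : Set.InjOn (transition (n := n) a b) B := fun z hz w hw h => by
    have h3 := (chartAt 𝔼 a).injOn (mem_overlap.1 (hBo z hz)).2 (mem_overlap.1 (hBo w hw)).2 h
    exact (chartAt 𝔼 b).symm.injOn hz.2 hw.2 h3
  rw [himg, lintegral_image_eq_lintegral_abs_det_fderiv_mul volume (measurableSet_chart_preimage b hm)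
    (f' := fun z => fderiv ℝ (transition (n := n) a b) z) (fun z hz =>
      (((contDiffOn_transition (n := n) a b).contDiffAt ((overlap a b).isOpen.mem_nhds
        (hBo z hz))).differentiableAt (by simp)).hasFDerivAt.hasFDerivWithinAt) hinj]
  refine setLIntegral_congr_fun (measurableSet_chart_preimage b hm) fun z hz => ?_
  simp only [det_fderiv_transition]
  rw [← ENNReal.ofReal_mul (abs_nonneg _), coordMetric_transition g (hBo z hz), det_mul, det_mul,
    det_transpose]
  congr 1
  have h4 : (jacobian a b z).det * (coordMetric g a (transition a b z)).det * (jacobian a b z).det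
      = (jacobian a b z).det ^ 2 * (coordMetric g a (transition a b z)).det := by ring
  rw [h4, Real.sqrt_mul (sq_nonneg _), Real.sqrt_sq_eq_abs]

/-- The Riemannian volume restricts to the chart volume on the domain of each chart. -/
lemma riemannianVolume_restrict (g : Metric n M) (a : M) :
    (riemannianVolume g).restrict (chartAt 𝔼 a).source = chartVolume g a := by
  have hS : MeasurableSet (chartAt 𝔼 a).source := (chartAt 𝔼 a).open_source.measurableSet
  have hle : ∀ b, chartVolume g b ≤ riemannianVolume g := fun b => le_iSup (chartVolume g) b
  have hself : (chartVolume g a).restrict (chartAt 𝔼 a).source = chartVolume g a := by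
    ext A hA
    rw [Measure.restrict_apply hA, chartVolume_inter_source g a hA]
  -- It suffices to dominate each chart measure, which over the domain at `a` is at most
  -- `chartVolume g a`; hence no countable cover is involved.
  have hup : riemannianVolume g ≤
      chartVolume g a + (riemannianVolume g).restrict (chartAt 𝔼 a).sourceᶜ := by
    refine iSup_le fun b => ?_
    have hsplit : chartVolume g b = (chartVolume g b).restrict (chartAt 𝔼 a).source
        + (chartVolume g b).restrict (chartAt 𝔼 a).sourceᶜ :=
      (Measure.restrict_add_restrict_compl hS).symm
    have h1 : (chartVolume g b).restrict (chartAt 𝔼 a).source ≤ chartVolume g a := by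
      refine Measure.le_intro fun A hA _ => ?_
      rw [Measure.restrict_apply hA, chartVolume_inter g a b hA]
      exact measure_mono Set.inter_subset_left
    rw [hsplit]
    exact add_le_add h1 (Measure.restrict_mono subset_rfl (hle b))
  refine le_antisymm ?_ ?_
  · have := Measure.restrict_mono (subset_refl (chartAt 𝔼 a).source) hup
    refine this.trans ?_
    rw [Measure.restrict_add, hself, Measure.restrict_restrict hS, Set.inter_compl_self,
      Measure.restrict_empty, add_zero]
  · rw [← hself]
    exact Measure.restrict_mono subset_rfl (hle a)

/-- An integrand supported in one chart sees only the restriction of the volume to that chart, which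
is the chart measure. -/
lemma integral_eq_local (g : Metric n M) (a : M) {h : M → ℝ} (hc : Continuous h)
    (h0 : ∀ x ∉ (chartAt 𝔼 a).source, h x = 0) {f : 𝔼 → ℝ}
    (hf : ∀ x ∈ (chartAt 𝔼 a).source, h x = f (chartAt 𝔼 a x))
    (hf0 : ∀ y ∉ (chartAt 𝔼 a).target, f y = 0) :
    ∫ x, h x ∂(riemannianVolume g) = ∫ y, Real.sqrt (coordMetric g a y).det * f y := by
  have hT : MeasurableSet (chartAt 𝔼 a).target := (chartAt 𝔼 a).open_target.measurableSet
  rw [← setIntegral_eq_integral_of_forall_compl_eq_zero h0, riemannianVolume_restrict, chartVolume,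
    integral_map (aemeasurable_chart_symm g a) hc.aestronglyMeasurable]
  rw [integral_withDensity_eq_integral_toReal_smul₀]
  · have hz : ∀ y ∉ (chartAt 𝔼 a).target, Real.sqrt (coordMetric g a y).det * f y = 0 :=
      fun y hy => by rw [hf0 y hy, mul_zero]
    rw [← setIntegral_eq_integral_of_forall_compl_eq_zero hz]
    refine setIntegral_congr_fun hT fun y hy => ?_
    simp only [ENNReal.toReal_ofReal (Real.sqrt_nonneg _), smul_eq_mul]
    rw [hf _ ((chartAt 𝔼 a).map_target hy), (chartAt 𝔼 a).right_inv hy]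
  · have hcont : ContinuousOn (fun y => Real.sqrt (coordMetric g a y).det) (chartAt 𝔼 a).target :=
      (contDiffOn_det (contDiffOn_coordMetric g a)).continuousOn.sqrt
    exact (hcont.aemeasurable hT).ennreal_ofReal
  · exact Filter.Eventually.of_forall fun y => ENNReal.ofReal_lt_top

end Volume
end QuadCurv
end

noncomputable section

namespace QuadCurv

open Matrix TopologicalSpace

/-! ### The variation of the metric -/

section Family

variable {n : ℕ} {M : Type*} [TopologicalSpace M] [ChartedSpace (EuclideanSpace ℝ (Fin n)) M]
  [IsManifold (𝓡 n) ∞ M]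

local notation "𝔼" => EuclideanSpace ℝ (Fin n)

lemma extFn_localFn (g : Metric n M) (ρ : M → ℝ) (hρ : ContMDiff (𝓡 n) 𝓘(ℝ, ℝ) ∞ ρ) {a x : M}
    (hx : x ∈ (chartAt 𝔼 a).source) :
    SmoothFn.extFn (localFn g ρ hρ a) (chartAt 𝔼 a x) = ρ x := by
  have h : chartAt 𝔼 a x ∈ (localMetric g a).U := (chartAt 𝔼 a).map_source hx
  rw [SmoothFn.extFn_of_mem _ h]
  exact congrArg ρ ((chartAt 𝔼 a).left_inv hx)

/-- The gauge transformation of the tangent bundle that is given by `LocalMetric.gauge` in the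
preferred chart at `a` and is the identity elsewhere. -/
def gaugeEnd (g : Metric n M) (ρ : M → ℝ) (hρ : ContMDiff (𝓡 n) 𝓘(ℝ, ℝ) ∞ ρ) (a : M) (s : ℝ)
    (x : M) : TangentSpace (𝓡 n) x →L[ℝ] TangentSpace (𝓡 n) x :=
  -- Written as the identity plus a correction: outside the chart domain the inverse trivialisation
  -- has the default value zero, so the map is the identity there.
  ContinuousLinearMap.id ℝ _ +
    ((trivializationAt 𝔼 (fun x : M => TangentSpace (𝓡 n) x) a).symmL ℝ x).comp
      ((toEuclideanCLM (𝕜 := ℝ)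
          ((localMetric g a).gauge (localFn g ρ hρ a) s (chartAt 𝔼 a x) - 1)).comp
        ((trivializationAt 𝔼 (fun x : M => TangentSpace (𝓡 n) x) a).continuousLinearMapAt ℝ x))

variable (g : Metric n M) (ρ : M → ℝ) (hρ : ContMDiff (𝓡 n) 𝓘(ℝ, ℝ) ∞ ρ) (a : M)

lemma gaugeEnd_apply (s : ℝ) (x : M) (v : TangentSpace (𝓡 n) x) : gaugeEnd g ρ hρ a s x v =
    v + (trivializationAt 𝔼 (fun x : M => TangentSpace (𝓡 n) x) a).symmL ℝ x
      (toEuclideanCLM (𝕜 := ℝ)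
        ((localMetric g a).gauge (localFn g ρ hρ a) s (chartAt 𝔼 a x) - 1)
        ((trivializationAt 𝔼 (fun x : M => TangentSpace (𝓡 n) x) a).continuousLinearMapAt ℝ x v)) :=
  rfl

lemma gaugeEnd_of_notMem (s : ℝ) {x : M} (hx : x ∉ (chartAt 𝔼 a).source)
    (v : TangentSpace (𝓡 n) x) : gaugeEnd g ρ hρ a s x v = v := by
  have h0 : ∀ w, (trivializationAt 𝔼 (fun x : M => TangentSpace (𝓡 n) x) a).symmL ℝ x w = 0 :=
    fun w => by
      rw [Bundle.Trivialization.symmL_apply_of_notMem]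
      simpa using hx
  rw [gaugeEnd_apply, h0, add_zero]

lemma gaugeEnd_of_eq_zero (s : ℝ) {x : M} (hx : ρ x = 0)
    (v : TangentSpace (𝓡 n) x) : gaugeEnd g ρ hρ a s x v = v := by
  by_cases hxs : x ∈ (chartAt 𝔼 a).source
  · rw [gaugeEnd_apply, LocalMetric.gauge_of_eq_zero _ ((extFn_localFn g ρ hρ hxs).trans hx),
      sub_self, map_zero]
    simp
  · exact gaugeEnd_of_notMem g ρ hρ a s hxs v

lemma gaugeEnd_zero (x : M) (v : TangentSpace (𝓡 n) x) : gaugeEnd g ρ hρ a 0 x v = v := by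
  rw [gaugeEnd_apply, LocalMetric.gauge_zero, sub_self, map_zero]
  simp

lemma gaugeEnd_symmL (s : ℝ) {x : M} (hx : x ∈ (chartAt 𝔼 a).source) (w : 𝔼) :
    gaugeEnd g ρ hρ a s x
      ((trivializationAt 𝔼 (fun x : M => TangentSpace (𝓡 n) x) a).symmL ℝ x w)
    = (trivializationAt 𝔼 (fun x : M => TangentSpace (𝓡 n) x) a).symmL ℝ x
      (toEuclideanCLM (𝕜 := ℝ)
        ((localMetric g a).gauge (localFn g ρ hρ a) s (chartAt 𝔼 a x)) w) := by
  rw [gaugeEnd_apply, Bundle.Trivialization.continuousLinearMapAt_symmL (R := ℝ) _ hx, map_sub,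
    map_one]
  rw [← map_add]
  congr 1
  simp

lemma toEuclideanCLM_apply_of_mul_eq_one {A B : Matrix (Fin n) (Fin n) ℝ} (h : A * B = 1) (w : 𝔼) :
    toEuclideanCLM (𝕜 := ℝ) A (toEuclideanCLM (𝕜 := ℝ) B w) = w := by
  refine (WithLp.ofLp_injective 2) ?_
  rw [ofLp_toEuclideanCLM, ofLp_toEuclideanCLM, mulVec_mulVec, h, one_mulVec]

lemma gaugeEnd_gaugeEnd_neg (s : ℝ) (x : M) (v : TangentSpace (𝓡 n) x) :
    gaugeEnd g ρ hρ a s x (gaugeEnd g ρ hρ a (-s) x v) = v := by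
  by_cases hx : x ∈ (chartAt 𝔼 a).source
  · have hv := (trivializationAt 𝔼 (fun x : M => TangentSpace (𝓡 n) x) a).symmL_continuousLinearMapAt
      (R := ℝ) hx v
    rw [← hv, gaugeEnd_symmL g ρ hρ a _ hx, gaugeEnd_symmL g ρ hρ a _ hx]
    congr 1
    exact toEuclideanCLM_apply_of_mul_eq_one (LocalMetric.gauge_mul_gauge_neg _ s _) _
  · rw [gaugeEnd_of_notMem g ρ hρ a _ hx, gaugeEnd_of_notMem g ρ hρ a _ hx]

lemma gaugeEnd_frameVec (s : ℝ) {x : M} (hx : x ∈ (chartAt 𝔼 a).source) (i : Fin n) :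
    gaugeEnd g ρ hρ a s x (frameVec a i x)
    = ∑ p, (localMetric g a).gauge (localFn g ρ hρ a) s (chartAt 𝔼 a x) p i • frameVec a p x := by
  rw [frameVec, gaugeEnd_symmL g ρ hρ a s hx, sum_smul_frameVec]
  refine Finset.sum_congr rfl fun p _ => ?_
  congr 1
  simp [stdDir, ofLp_toEuclideanCLM]

/-- The scalar product `g(E v, E w)`, where `E` is the gauge transformation. -/
def varInner (s : ℝ) (x : M) : TangentSpace (𝓡 n) x →L[ℝ] TangentSpace (𝓡 n) x →L[ℝ] ℝ :=
  (ContinuousLinearMap.precomp ℝ (gaugeEnd g ρ hρ a s x)).comp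
    ((g.inner x).comp (gaugeEnd g ρ hρ a s x))

lemma varInner_apply (s : ℝ) (x : M) (v w : TangentSpace (𝓡 n) x) :
    varInner g ρ hρ a s x v w
      = g.inner x (gaugeEnd g ρ hρ a s x v) (gaugeEnd g ρ hρ a s x w) := rfl

lemma varInner_of_eq_zero (s : ℝ) {x : M} (hx : ρ x = 0) :
    varInner g ρ hρ a s x = g.inner x := by
  ext v w
  rw [varInner_apply, gaugeEnd_of_eq_zero g ρ hρ a s hx, gaugeEnd_of_eq_zero g ρ hρ a s hx]

lemma varInner_frameVec (s : ℝ) {x : M} (hx : x ∈ (chartAt 𝔼 a).source) (i j : Fin n) :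
    varInner g ρ hρ a s x (frameVec a i x) (frameVec a j x)
      = (localMetric g a).varG (localFn g ρ hρ a) s (chartAt 𝔼 a x) i j := by
  rw [varInner_apply, gaugeEnd_frameVec g ρ hρ a s hx, gaugeEnd_frameVec g ρ hρ a s hx]
  have h5 : ∀ p q, (localMetric g a).G (chartAt 𝔼 a x) p q
      = g.inner x (frameVec a p x) (frameVec a q x) := fun p q => by
    have := coordMetric_apply g a ((chartAt 𝔼 a).map_source hx) p q
    rw [(chartAt 𝔼 a).left_inv hx] at this
    exact this
  simp only [map_sum, map_smul, _root_.sum_apply, _root_.smul_apply, LocalMetric.varG, mul_apply,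
    transpose_apply, smul_eq_mul, h5, Finset.sum_mul]
  refine Finset.sum_congr rfl fun p _ => ?_
  rw [Finset.mul_sum]
  exact Finset.sum_congr rfl fun q _ => by ring

/-- Inside the chart the frame components are those of `varG`. A point outside the chart lies off
the closed support of ρ, so the family equals `g` near it. -/
lemma contMDiff_varInner (hs : tsupport ρ ⊆ (chartAt 𝔼 a).source) :
    ContMDiff (𝓘(ℝ, ℝ).prod (𝓡 n)) ((𝓡 n).prod 𝓘(ℝ, 𝔼 →L[ℝ] 𝔼 →L[ℝ] ℝ)) ∞
    (fun p : ℝ × M => Bundle.TotalSpace.mk' (𝔼 →L[ℝ] 𝔼 →L[ℝ] ℝ)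
        (E := fun x : M => TangentSpace (𝓡 n) x →L[ℝ] TangentSpace (𝓡 n) x →L[ℝ] ℝ)
        p.2 (varInner g ρ hρ a p.1 p.2)) := by
  rintro ⟨s, x⟩
  by_cases hx : x ∈ (chartAt 𝔼 a).source
  · refine (contMDiffAt_bilin_iff (a := a) (Q := fun p : ℝ × M => varInner g ρ hρ a p.1 p.2)
      contMDiffAt_snd hx).2 fun i j => ?_
    have h1 : ContMDiffAt 𝓘(ℝ, ℝ × 𝔼) 𝓘(ℝ, ℝ) ∞ (fun p : ℝ × 𝔼 =>
        (localMetric g a).varG (localFn g ρ hρ a) p.1 p.2 i j) (s, chartAt 𝔼 a x) :=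
      (((localMetric g a).contDiffOn_varG i j).contDiffAt
        ((localMetric g a).cylinder.isOpen.mem_nhds ((chartAt 𝔼 a).map_source hx))).contMDiffAt
    have h2 : ContMDiffAt (𝓘(ℝ, ℝ).prod (𝓡 n)) 𝓘(ℝ, ℝ × 𝔼) ∞
        (fun p : ℝ × M => (p.1, chartAt 𝔼 a p.2)) (s, x) := by
      refine ContMDiffAt.prodMk_space contMDiffAt_fst ?_
      exact ContMDiffAt.comp (s, x) (contMDiffAt_chart a hx) contMDiffAt_snd
    refine (ContMDiffAt.comp (s, x) h1 h2).congr_of_eventuallyEq ?_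
    filter_upwards [continuousAt_snd.preimage_mem_nhds
      ((chartAt 𝔼 a).open_source.mem_nhds hx)] with p hp
    exact varInner_frameVec g ρ hρ a p.1 hp i j
  · have hx' : x ∈ (tsupport ρ)ᶜ := fun h => hx (hs h)
    have h1 : ContMDiffAt (𝓘(ℝ, ℝ).prod (𝓡 n)) ((𝓡 n).prod 𝓘(ℝ, 𝔼 →L[ℝ] 𝔼 →L[ℝ] ℝ)) ∞
        (fun p : ℝ × M => Bundle.TotalSpace.mk' (𝔼 →L[ℝ] 𝔼 →L[ℝ] ℝ)
          (E := fun x : M => TangentSpace (𝓡 n) x →L[ℝ] TangentSpace (𝓡 n) x →L[ℝ] ℝ)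
          p.2 (g.inner p.2)) (s, x) :=
      ContMDiffAt.comp (s, x) g.contMDiff.contMDiffAt contMDiffAt_snd
    refine h1.congr_of_eventuallyEq ?_
    filter_upwards [continuousAt_snd.preimage_mem_nhds
      ((isClosed_tsupport ρ).isOpen_compl.mem_nhds hx')] with p hp
    rw [varInner_of_eq_zero g ρ hρ a p.1 (image_eq_zero_of_notMem_tsupport hp)]

/-- The variation of `g` in the direction of `ρ` times the trace-free Ricci tensor. -/
def varMetric (hs : tsupport ρ ⊆ (chartAt 𝔼 a).source) (s : ℝ) : Metric n M where
  inner := varInner g ρ hρ a s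
  symm x v w := by rw [varInner_apply, varInner_apply, g.symm]
  pos x v hv := by
    rw [varInner_apply]
    refine g.pos x _ fun h => hv ?_
    have h1 := gaugeEnd_gaugeEnd_neg g ρ hρ a (-s) x v
    rw [neg_neg, h, map_zero] at h1
    exact h1.symm
  -- The new unit ball is the image of that of `g` under the inverse gauge, a continuous linear map.
  isVonNBounded x := by
    refine ((g.isVonNBounded x).image (gaugeEnd g ρ hρ a (-s) x)).subset fun v hv => ?_
    refine ⟨gaugeEnd g ρ hρ a s x v, hv, ?_⟩
    have h1 := gaugeEnd_gaugeEnd_neg g ρ hρ a (-s) x v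
    rwa [neg_neg] at h1
  contMDiff := (contMDiff_varInner g ρ hρ a hs).comp
    (ContMDiff.prodMk contMDiff_const contMDiff_id : ContMDiff (𝓡 n) (𝓘(ℝ, ℝ).prod (𝓡 n)) ∞
      fun x : M => (s, x))

lemma isSmoothFamily_varMetric (hs : tsupport ρ ⊆ (chartAt 𝔼 a).source)
    : IsSmoothFamily (varMetric g ρ hρ a hs) :=
  contMDiff_varInner g ρ hρ a hs

lemma varMetric_zero (hs : tsupport ρ ⊆ (chartAt 𝔼 a).source)
    : varMetric g ρ hρ a hs 0 = g := by
  have h : varInner g ρ hρ a 0 = g.inner := by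
    funext x
    ext v w
    rw [varInner_apply, gaugeEnd_zero, gaugeEnd_zero]
  cases g
  simp only [varMetric, h]

lemma coordMetric_varMetric (hs : tsupport ρ ⊆ (chartAt 𝔼 a).source)
    (s : ℝ) {y : 𝔼} (hy : y ∈ (chartAt 𝔼 a).target) :
    coordMetric (varMetric g ρ hρ a hs s) a y
      = (localMetric g a).varG (localFn g ρ hρ a) s y := by
  ext i j
  rw [coordMetric_apply _ a hy]
  refine (varInner_frameVec g ρ hρ a s ((chartAt 𝔼 a).map_target hy) i j).trans ?_
  rw [(chartAt 𝔼 a).right_inv hy]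

lemma coordMetric_varMetric_of_eq_zero (hs : tsupport ρ ⊆ (chartAt 𝔼 a).source)
    (s : ℝ) (b : M) {y : 𝔼} (hy : y ∈ (chartAt 𝔼 b).target)
    (h : ρ ((chartAt 𝔼 b).symm y) = 0) :
    coordMetric (varMetric g ρ hρ a hs s) b y = coordMetric g b y := by
  ext i j
  rw [coordMetric_apply _ b hy, coordMetric_apply _ b hy]
  change varInner g ρ hρ a s _ _ _ = _
  rw [varInner_of_eq_zero g ρ hρ a s h]

/-- On the overlap with the chart at `a` both determinants carry the same squared Jacobian, so the
identity passes to every chart; elsewhere ρ = 0. -/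
lemma det_coordMetric_varMetric (hs : tsupport ρ ⊆ (chartAt 𝔼 a).source)
    (hn : n ≠ 0) (s : ℝ) (b : M) {y : 𝔼}
    (hy : y ∈ (chartAt 𝔼 b).target) :
    (coordMetric (varMetric g ρ hρ a hs s) b y).det = (coordMetric g b y).det := by
  by_cases hx : (chartAt 𝔼 b).symm y ∈ (chartAt 𝔼 a).source
  · have ho : y ∈ overlap a b := mem_overlap.2 ⟨hy, hx⟩
    rw [coordMetric_transition _ ho, coordMetric_transition g ho,
      coordMetric_varMetric g ρ hρ a hs s (transition_mem ho)]
    simp only [det_mul]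
    rw [LocalMetric.det_varG _ hn]
    rfl
  · rw [coordMetric_varMetric_of_eq_zero g ρ hρ a hs s b hy
      (image_eq_zero_of_notMem_tsupport fun h => hx (hs h))]

lemma riemannianVolume_varMetric (hs : tsupport ρ ⊆ (chartAt 𝔼 a).source)
    [MeasurableSpace M] (hn : n ≠ 0) (s : ℝ) :
    riemannianVolume (varMetric g ρ hρ a hs s) = riemannianVolume g := by
  refine iSup_congr fun b => ?_
  rw [chartVolume, chartVolume]
  congr 1
  refine withDensity_congr_ae ?_
  filter_upwards [ae_restrict_mem (chartAt 𝔼 b).open_target.measurableSet] with y hy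
  rw [det_coordMetric_varMetric g ρ hρ a hs hn s b hy]

end Family
end QuadCurv
end

noncomputable section

namespace QuadCurv

open Matrix TopologicalSpace

/-! ### The first variation of the functional -/

section Variation

variable {n : ℕ} {M : Type*} [TopologicalSpace M] [ChartedSpace (EuclideanSpace ℝ (Fin n)) M]
  [IsManifold (𝓡 n) ∞ M]

local notation "𝔼" => EuclideanSpace ℝ (Fin n)

/-- The integrand `|Ric|² + t R²`. -/
def lagrangianAt (t : ℝ) (g : Metric n M) (x : M) : ℝ :=
  normSq₂ (metricAt g x) (ricciAt g x) + t * scalarCurvature g x ^ 2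

lemma continuous_lagrangianAt (t : ℝ) (g : Metric n M) : Continuous (lagrangianAt t g) :=
  (continuous_normSq_ricciAt g).add (continuous_const.mul ((continuous_scalarCurvature g).pow 2))

lemma functional_eq_integral [CompactSpace M] [MeasurableSpace M] [BorelSpace M] (t : ℝ)
    (g : Metric n M) [IsFiniteMeasure (riemannianVolume g)] :
    functional t g = ∫ x, lagrangianAt t g x ∂(riemannianVolume g) := by
  have hint : ∀ f : M → ℝ, Continuous f → Integrable f (riemannianVolume g) := fun f hf =>
    hf.integrable_of_hasCompactSupport (HasCompactSupport.of_compactSpace f)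
  rw [functional, ← integral_const_mul, ← integral_add]
  · rfl
  · exact hint _ (continuous_normSq_ricciAt g)
  · exact hint _ (continuous_const.mul ((continuous_scalarCurvature g).pow 2))

lemma LocalMetric.normSq₂_eq (m : LocalMetric n) {y : 𝔼} (hy : y ∈ m.U) :
    normSq₂ (m.G y) (ricci m.G y)
      = SmoothFn.extFn (m.data.ricEnd * m.data.ricEnd).trace y := by
  rw [SmoothFn.extFn_of_mem _ hy]
  exact m.isSlice.normSq₂_eq hy

lemma LocalMetric.scalar_eq (m : LocalMetric n) {y : 𝔼} (hy : y ∈ m.U) :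
    scalar m.G y = SmoothFn.extFn m.data.scal y := by
  rw [SmoothFn.extFn_of_mem _ hy]
  exact m.isSlice.scalar_eq hy

variable (g : Metric n M) (ρ : M → ℝ) (hρ : ContMDiff (𝓡 n) 𝓘(ℝ, ℝ) ∞ ρ) (a : M)

omit [IsManifold (𝓡 n) ∞ M] in
lemma isOpen_chart_preimage_compl_tsupport (b : M) :
    IsOpen ((chartAt 𝔼 b).target ∩ (chartAt 𝔼 b).symm ⁻¹' (tsupport ρ)ᶜ) :=
  (chartAt 𝔼 b).isOpen_inter_preimage_symm (isClosed_tsupport ρ).isOpen_compl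

lemma isSlice_coordMetric_varMetric (hs : tsupport ρ ⊆ (chartAt 𝔼 a).source) (s : ℝ) :
    IsSlice (localMetric g a).cylinder (fun i => ((0 : ℝ), stdDir n i))
      (fun p => (localMetric g a).varG (localFn g ρ hρ a) p.1 p.2) (fun y => (s, y))
      (localMetric g a).U (coordMetric (varMetric g ρ hρ a hs s) a) where
  isOpen := (localMetric g a).U.isOpen
  mem _ hz := hz
  eq _ hz := coordMetric_varMetric g ρ hρ a hs s hz
  deriv := ((localMetric g a).isSlice_varG (ρ := localFn g ρ hρ a) s).deriv

lemma lagrangianAt_varMetric (hs : tsupport ρ ⊆ (chartAt 𝔼 a).source) (hn : n ≠ 0) (t s : ℝ)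
    {x : M} (hx : x ∈ (chartAt 𝔼 a).source) :
    lagrangianAt t (varMetric g ρ hρ a hs s) x = SmoothFn.extFn
      (((localMetric g a).varData (localFn g ρ hρ a) hn).lagrangian t) (s, chartAt 𝔼 a x) := by
  have hy : chartAt 𝔼 a x ∈ (localMetric g a).U := (chartAt 𝔼 a).map_source hx
  have hy' : chartAt 𝔼 a x ∈ (localMetric (varMetric g ρ hρ a hs s) a).U := hy
  have h1 : normSq₂ (coordMetric (varMetric g ρ hρ a hs s) a (chartAt 𝔼 a x))
      (ricci (coordMetric (varMetric g ρ hρ a hs s) a) (chartAt 𝔼 a x)) = _ :=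
    (localMetric (varMetric g ρ hρ a hs s) a).normSq₂_eq hy'
  have h2 : scalar (coordMetric (varMetric g ρ hρ a hs s) a) (chartAt 𝔼 a x) = _ :=
    (localMetric (varMetric g ρ hρ a hs s) a).scalar_eq hy'
  rw [lagrangianAt, normSq_ricciAt_eq _ hx, scalarCurvature_eq _ hx, ← h1, ← h2,
    LocalMetric.lagrangian_eq _ hn t (isSlice_coordMetric_varMetric g ρ hρ a hs s) hy]

/-- Curvature depends on the germ of the metric, and off the closed support the metric is unchanged
on an open set. -/
lemma lagrangianAt_varMetric_of_notMem (hs : tsupport ρ ⊆ (chartAt 𝔼 a).source) (t s : ℝ)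
    {x : M} (hx : x ∉ tsupport ρ) :
    lagrangianAt t (varMetric g ρ hρ a hs s) x = lagrangianAt t g x := by
  have hsl : IsSlice (localMetric g x).U (stdDir n) (localMetric g x).G id
      ((chartAt 𝔼 x).target ∩ (chartAt 𝔼 x).symm ⁻¹' (tsupport ρ)ᶜ)
      (coordMetric (varMetric g ρ hρ a hs s) x) :=
    { isOpen := isOpen_chart_preimage_compl_tsupport ρ x
      mem := fun z hz => hz.1
      eq := fun z hz => coordMetric_varMetric_of_eq_zero g ρ hρ a hs s x hz.1
        (image_eq_zero_of_notMem_tsupport hz.2)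
      deriv := fun z _ => ⟨ContinuousLinearMap.id ℝ _, hasFDerivAt_id z, fun _ => rfl⟩ }
  have hz : coordPoint n x ∈ (chartAt 𝔼 x).target ∩ (chartAt 𝔼 x).symm ⁻¹' (tsupport ρ)ᶜ := by
    refine ⟨mem_chart_target _ x, ?_⟩
    rwa [Set.mem_preimage, coordPoint, (chartAt 𝔼 x).left_inv (mem_chart_source _ x)]
  have hsl' := (localMetric g x).isSlice
  refine congrArg₂ (fun p q : ℝ => p + t * q ^ 2) ?_ ?_
  · exact (hsl.normSq₂_eq (hG := (localMetric g x).smooth) (hs := (localMetric g x).symm)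
      (hd := fun y hy => ((localMetric g x).det_pos y hy).ne') hz).trans (hsl'.normSq₂_eq hz.1).symm
  · exact (hsl.scalar_eq (hG := (localMetric g x).smooth) (hs := (localMetric g x).symm)
      (hd := fun y hy => ((localMetric g x).det_pos y hy).ne') hz).trans (hsl'.scalar_eq hz.1).symm

open Classical in
/-- The derivative of the integrand `|Ric|² + t R²` along the variation of `g`. -/
def lagrangianDeriv (hn : n ≠ 0) (t s : ℝ) (x : M) : ℝ :=
  if x ∈ (chartAt 𝔼 a).source then SmoothFn.extFn (SmoothFn.dir ((1 : ℝ), 0)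
    (((localMetric g a).varData (localFn g ρ hρ a) hn).lagrangian t)) (s, chartAt 𝔼 a x) else 0

lemma lagrangianDeriv_of_mem (hn : n ≠ 0) (t s : ℝ) {x : M} (hx : x ∈ (chartAt 𝔼 a).source) :
    lagrangianDeriv g ρ hρ a hn t s x = SmoothFn.extFn (SmoothFn.dir ((1 : ℝ), 0)
      (((localMetric g a).varData (localFn g ρ hρ a) hn).lagrangian t)) (s, chartAt 𝔼 a x) :=
  if_pos hx

lemma hasDerivAt_lagrangianAt (hs : tsupport ρ ⊆ (chartAt 𝔼 a).source) (hn : n ≠ 0) (t s : ℝ)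
    (x : M) : HasDerivAt (fun s => lagrangianAt t (varMetric g ρ hρ a hs s) x)
      (lagrangianDeriv g ρ hρ a hn t s x) s := by
  by_cases hx : x ∈ (chartAt 𝔼 a).source
  · rw [lagrangianDeriv_of_mem g ρ hρ a hn t s hx]
    simp only [lagrangianAt_varMetric g ρ hρ a hs hn t _ hx]
    exact LocalMetric.hasDerivAt_lagrangian _ hn t s ((chartAt 𝔼 a).map_source hx)
  · rw [lagrangianDeriv, if_neg hx]
    simp only [lagrangianAt_varMetric_of_notMem g ρ hρ a hs t _ fun h => hx (hs h)]
    exact hasDerivAt_const s _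

lemma lagrangianDeriv_eq_zero (hs : tsupport ρ ⊆ (chartAt 𝔼 a).source) (hn : n ≠ 0) (t s : ℝ)
    {x : M} (hx : x ∉ tsupport ρ) : lagrangianDeriv g ρ hρ a hn t s x = 0 := by
  have h := hasDerivAt_lagrangianAt g ρ hρ a hs hn t s x
  simp only [lagrangianAt_varMetric_of_notMem g ρ hρ a hs t _ hx] at h
  exact h.unique (hasDerivAt_const s _)

lemma continuous_lagrangianDeriv (hs : tsupport ρ ⊆ (chartAt 𝔼 a).source) (hn : n ≠ 0) (t s : ℝ) :
    Continuous (lagrangianDeriv g ρ hρ a hn t s) := by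
  rw [continuous_iff_continuousAt]
  intro x
  by_cases hx : x ∈ (chartAt 𝔼 a).source
  · have h1 := (SmoothFn.differentiableAt_extFn (SmoothFn.dir ((1 : ℝ), 0)
      (((localMetric g a).varData (localFn g ρ hρ a) hn).lagrangian t))
      ⟨(s, chartAt 𝔼 a x), (chartAt 𝔼 a).map_source hx⟩).continuousAt
    have h2 : ContinuousAt (fun x => (s, chartAt 𝔼 a x)) x :=
      continuousAt_const.prodMk ((chartAt 𝔼 a).continuousAt hx)
    refine (ContinuousAt.comp (f := fun x => (s, chartAt 𝔼 a x)) h1 h2).congr ?_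
    filter_upwards [(chartAt 𝔼 a).open_source.mem_nhds hx] with z hz
    exact (lagrangianDeriv_of_mem g ρ hρ a hn t s hz).symm
  · refine (continuousAt_const (y := (0 : ℝ))).congr ?_
    filter_upwards [(isClosed_tsupport ρ).isOpen_compl.mem_nhds fun h => hx (hs h)] with z hz
    exact (lagrangianDeriv_eq_zero g ρ hρ a hs hn t s hz).symm

omit [IsManifold (𝓡 n) ∞ M] in
lemma isCompact_chart_image_tsupport [CompactSpace M] (hs : tsupport ρ ⊆ (chartAt 𝔼 a).source) :
    IsCompact (chartAt 𝔼 a '' tsupport ρ) :=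
  (isClosed_tsupport ρ).isCompact.image_of_continuousOn ((chartAt 𝔼 a).continuousOn.mono hs)

/-- Joint continuity on the compact set [-1, 1] × supp ρ supplies the constant that dominates when
differentiating under the integral. -/
lemma exists_bound_lagrangianDeriv [CompactSpace M] (hs : tsupport ρ ⊆ (chartAt 𝔼 a).source)
    (hn : n ≠ 0) (t : ℝ) : ∃ C, ∀ s ∈ Metric.ball (0 : ℝ) 1, ∀ x,
      ‖lagrangianDeriv g ρ hρ a hn t s x‖ ≤ C := by
  have hK : IsCompact (Set.Icc (-1 : ℝ) 1 ×ˢ (chartAt 𝔼 a '' tsupport ρ)) :=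
    isCompact_Icc.prod (isCompact_chart_image_tsupport ρ a hs)
  have hc : ContinuousOn (SmoothFn.extFn (SmoothFn.dir ((1 : ℝ), 0)
      (((localMetric g a).varData (localFn g ρ hρ a) hn).lagrangian t)))
      (Set.Icc (-1 : ℝ) 1 ×ˢ (chartAt 𝔼 a '' tsupport ρ)) := by
    refine (SmoothFn.contDiffOn_extFn _).continuousOn.mono ?_
    rintro ⟨s, y⟩ ⟨-, x, hx, rfl⟩
    exact (chartAt 𝔼 a).map_source (hs hx)
  obtain ⟨C, hC⟩ := hK.exists_bound_of_continuousOn hc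
  refine ⟨max C 0, fun s hs' x => ?_⟩
  by_cases hx : x ∈ tsupport ρ
  · rw [lagrangianDeriv_of_mem g ρ hρ a hn t s (hs hx)]
    refine (hC _ ⟨?_, x, hx, rfl⟩).trans (le_max_left _ _)
    rw [mem_ball_zero_iff, Real.norm_eq_abs, abs_lt] at hs'
    exact ⟨hs'.1.le, hs'.2.le⟩
  · rw [lagrangianDeriv_eq_zero g ρ hρ a hs hn t s hx, norm_zero]
    exact le_max_right _ _

lemma bochnerAt_eq_zero (t : ℝ) {x : M} (hx : x ∉ tsupport ρ) : bochnerAt g t ρ hρ x = 0 := by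
  have hU := coordPoint_mem g x
  have hz : coordPoint n x ∈ (chartAt 𝔼 x).target ∩ (chartAt 𝔼 x).symm ⁻¹' (tsupport ρ)ᶜ := by
    refine ⟨mem_chart_target _ x, ?_⟩
    rwa [Set.mem_preimage, coordPoint, (chartAt 𝔼 x).left_inv (mem_chart_source _ x)]
  have h0 : ∀ y : (localMetric g x).U,
      (y : 𝔼) ∉ ((chartAt 𝔼 x).target ∩ (chartAt 𝔼 x).symm ⁻¹' (tsupport ρ)ᶜ)ᶜ →
      SmoothFn.ev y (localFn g ρ hρ x) = 0 := fun y hy =>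
    image_eq_zero_of_notMem_tsupport (f := ρ) (not_not.1 hy : (y : 𝔼) ∈ _).2
  have h1 : ∀ k, SmoothFn.ev ⟨coordPoint n x, hU⟩
      ((localMetric g x).data.d k (localFn g ρ hρ x)) = 0 := fun k =>
    SmoothFn.ev_dir_eq_zero (isOpen_chart_preimage_compl_tsupport ρ x).isClosed_compl h0 _
      ⟨_, hU⟩ (not_not.2 hz)
  rw [bochnerAt, SmoothFn.extFn_of_mem _ hU, LocalMetric.bochnerIntegrand, map_add, map_mul,
    h0 ⟨_, hU⟩ (not_not.2 hz), zero_mul, zero_add, map_sum]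
  exact Finset.sum_eq_zero fun k _ => by rw [map_mul, h1, zero_mul]

/-- The Euler–Lagrange equation, tested against `ρ` times the trace-free Ricci tensor. -/
lemma integral_bochnerAt_eq_zero [CompactSpace M] [MeasurableSpace M] [BorelSpace M]
    (hs : tsupport ρ ⊆ (chartAt 𝔼 a).source) (hn : n ≠ 0) {t : ℝ} (hcrit : IsCritical t g) :
    ∫ x, bochnerAt g t ρ hρ x ∂(riemannianVolume g) = 0 := by
  have hfin : IsFiniteMeasure (riemannianVolume g) := ⟨by rw [hcrit.1]; exact ENNReal.one_lt_top⟩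
  have hvol := riemannianVolume_varMetric g ρ hρ a hs hn
  have hF : ∀ s, functional t (varMetric g ρ hρ a hs s)
      = ∫ x, lagrangianAt t (varMetric g ρ hρ a hs s) x ∂(riemannianVolume g) := fun s => by
    have : IsFiniteMeasure (riemannianVolume (varMetric g ρ hρ a hs s)) := by
      rw [hvol s]; exact hfin
    rw [functional_eq_integral, hvol s]
  have hd := hcrit.2 (varMetric g ρ hρ a hs) (isSmoothFamily_varMetric g ρ hρ a hs)
    (varMetric_zero g ρ hρ a hs) (fun s => by rw [hvol s, hcrit.1])
  simp only [hF] at hd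
  obtain ⟨C, hC⟩ := exists_bound_lagrangianDeriv g ρ hρ a hs hn t
  -- The measure does not depend on `s`, so only the integrand is differentiated; comparison with
  -- criticality gives zero.
  have hd' := (hasDerivAt_integral_of_dominated_loc_of_deriv_le
    (μ := riemannianVolume g) (F := fun s x => lagrangianAt t (varMetric g ρ hρ a hs s) x)
    (F' := lagrangianDeriv g ρ hρ a hn t) (x₀ := (0 : ℝ)) (bound := fun _ => C)
    (Metric.ball_mem_nhds (0 : ℝ) one_pos)
    (Filter.Eventually.of_forall fun s => (continuous_lagrangianAt t _).aestronglyMeasurable)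
    ((continuous_lagrangianAt t _).integrable_of_hasCompactSupport
      (HasCompactSupport.of_compactSpace _))
    (continuous_lagrangianDeriv g ρ hρ a hs hn t 0).aestronglyMeasurable
    (Filter.Eventually.of_forall fun x s hs' => hC s hs' x)
    (integrable_const C)
    (Filter.Eventually.of_forall fun x s _ => hasDerivAt_lagrangianAt g ρ hρ a hs hn t s x)).2
  have hzero := hd'.unique hd
  rw [integral_eq_local g a (continuous_lagrangianDeriv g ρ hρ a hs hn t 0)
    (fun x hx => lagrangianDeriv_eq_zero g ρ hρ a hs hn t 0 fun h => hx (hs h))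
    (f := fun y => SmoothFn.extFn (SmoothFn.dir ((1 : ℝ), 0)
      (((localMetric g a).varData (localFn g ρ hρ a) hn).lagrangian t)) (0, y))
    (fun x hx => lagrangianDeriv_of_mem g ρ hρ a hn t 0 hx)
    (fun y hy => SmoothFn.extFn_of_notMem _ hy)] at hzero
  rw [integral_eq_local g a (continuous_bochnerAt g t ρ hρ)
    (fun x hx => bochnerAt_eq_zero g ρ hρ t fun h => hx (hs h))
    (fun x hx => bochnerAt_eq g t ρ hρ hx) (fun y hy => SmoothFn.extFn_of_notMem _ hy)]
  refine ((localMetric g a).integral_first_variation hn t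
    (isCompact_chart_image_tsupport ρ a hs) ?_ fun y hy => ?_).symm.trans hzero
  · rintro _ ⟨x, hx, rfl⟩
    exact (chartAt 𝔼 a).map_source (hs hx)
  · refine image_eq_zero_of_notMem_tsupport (f := ρ) fun h => hy ⟨_, h, ?_⟩
    exact (chartAt 𝔼 a).right_inv y.2

end Variation
end QuadCurv
end

noncomputable section

namespace QuadCurv

open Matrix TopologicalSpace

lemma MetricData.CoordChange.map_tf_eq_zero_iff {n : ℕ} {𝒜 ℬ : Type*} [CommRing 𝒜] [Algebra ℝ 𝒜]
    [CommRing ℬ] [Algebra ℝ ℬ] {D : MetricData n 𝒜} {D' : MetricData n ℬ} (c : CoordChange D D')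
    (ev : ℬ →ₐ[ℝ] ℝ) : D'.tf.map ev = 0 ↔ (c.pull D.tf).map ev = 0 := by
  have h1 : D'.tf = c.Ji * c.pull D.tf * c.J := c.tf_eq
  have h2 : c.pull D.tf = c.J * D'.tf * c.Ji := by
    rw [h1, mul_assoc, mul_assoc, mul_assoc, c.J_mul_Ji, mul_one, c.J_mul_Ji_mul]
  constructor
  · intro h
    rw [h2, Matrix.map_mul, Matrix.map_mul, h, mul_zero, zero_mul]
  · intro h
    rw [h1, Matrix.map_mul, Matrix.map_mul, h, mul_zero, zero_mul]

/-! ### Integration of the Bochner-type formula -/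

section Rigidity

variable {n : ℕ} {M : Type*} [TopologicalSpace M] [ChartedSpace (EuclideanSpace ℝ (Fin n)) M]
  [IsManifold (𝓡 n) ∞ M]

local notation "𝔼" => EuclideanSpace ℝ (Fin n)

/-- The density is positive in each chart. This is what upgrades almost everywhere vanishing of a
continuous function to vanishing everywhere. -/
lemma isOpenPosMeasure_riemannianVolume [MeasurableSpace M] [BorelSpace M] (g : Metric n M) :
    (riemannianVolume g).IsOpenPosMeasure where
  open_pos O hO := by
    rintro ⟨x, hx⟩ h0
    have h1 : chartVolume g x O = 0 :=
      le_antisymm ((le_iSup (chartVolume g) x O).trans h0.le) bot_le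
    have hm : AEMeasurable (fun y => ENNReal.ofReal (Real.sqrt (coordMetric g x y).det))
        (volume.restrict (chartAt 𝔼 x).target) :=
      ((contDiffOn_det (contDiffOn_coordMetric g x)).continuousOn.sqrt.aemeasurable
        (chartAt 𝔼 x).open_target.measurableSet).ennreal_ofReal
    rw [chartVolume, Measure.map_apply_of_aemeasurable (aemeasurable_chart_symm g x)
      hO.measurableSet, withDensity_apply_eq_zero' hm,
      Measure.restrict_apply' (chartAt 𝔼 x).open_target.measurableSet] at h1
    have h2 : volume ((chartAt 𝔼 x).target ∩ (chartAt 𝔼 x).symm ⁻¹' O) = 0 := by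
      refine measure_mono_null ?_ h1
      intro y hy
      refine ⟨⟨?_, hy.2⟩, hy.1⟩
      have := (posDef_coordMetric g x hy.1).det_pos
      simpa using this
    refine ((chartAt 𝔼 x).isOpen_inter_preimage_symm hO).measure_ne_zero volume
      ⟨chartAt 𝔼 x x, mem_chart_target _ x, ?_⟩ h2
    rwa [Set.mem_preimage, (chartAt 𝔼 x).left_inv (mem_chart_source _ x)]

/-- The integrand of the Bochner-type formula, as a function on `M`. -/
def bochnerFunAt (g : Metric n M) (t : ℝ) (x : M) : ℝ :=
  SmoothFn.ev ⟨coordPoint n x, coordPoint_mem g x⟩ ((localMetric g x).data.bochnerFun t)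

/-- ρ f + dρ(W) is additive in ρ and equals f for ρ = 1, so the field W disappears after summation.
-/
lemma sum_bochnerAt {ι : Type*} (s : Finset ι) (g : Metric n M) (t : ℝ) (ρ : ι → M → ℝ)
    (hρ : ∀ i, ContMDiff (𝓡 n) 𝓘(ℝ, ℝ) ∞ (ρ i)) (h1 : ∀ x, ∑ i ∈ s, ρ i x = 1) (x : M) :
    ∑ i ∈ s, bochnerAt g t (ρ i) (hρ i) x = bochnerFunAt g t x := by
  have h : ∑ i ∈ s, localFn g (ρ i) (hρ i) x = 1 := by
    refine SmoothFn.funext fun y => ?_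
    rw [map_sum, map_one]
    exact h1 _
  rw [bochnerFunAt, ← LocalMetric.bochnerIntegrand_one, ← h, LocalMetric.bochnerIntegrand_sum, map_sum]
  exact Finset.sum_congr rfl fun i _ => SmoothFn.extFn_of_mem _ _

/-- The Bochner-type formula holds for critical metrics. -/
lemma integral_bochnerFunAt [T2Space M] [CompactSpace M] [MeasurableSpace M] [BorelSpace M]
    (hn : n ≠ 0) {t : ℝ} {g : Metric n M} (hcrit : IsCritical t g) :
    Continuous (bochnerFunAt g t) ∧ ∫ x, bochnerFunAt g t x ∂(riemannianVolume g) = 0 := by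
  have hfin : IsFiniteMeasure (riemannianVolume g) := ⟨by rw [hcrit.1]; exact ENNReal.one_lt_top⟩
  obtain ⟨f, hf⟩ := SmoothPartitionOfUnity.exists_isSubordinate_chartAt_source (𝓡 n) M
  -- Compactness leaves finitely many nonzero members, so sum and integral may be interchanged.
  have hfn := f.locallyFinite.finite_nonempty_of_compact
  have h1 : ∀ x, ∑ i ∈ hfn.toFinset, f i x = 1 := fun x => by
    rw [← f.sum_eq_one (Set.mem_univ x), finsum_eq_sum_of_support_subset]
    intro i hi
    rw [Set.Finite.coe_toFinset]
    exact ⟨x, hi⟩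
  have hsum := sum_bochnerAt hfn.toFinset g t (fun i => f i) (fun i => (f i).contMDiff) h1
  have hc : ∀ i, Continuous (bochnerAt g t (f i) (f i).contMDiff) := fun i =>
    continuous_bochnerAt g t _ _
  constructor
  · rw [← funext hsum]
    exact continuous_finsetSum _ fun i _ => hc i
  · rw [← funext hsum, integral_finsetSum _ fun i _ =>
      (hc i).integrable_of_hasCompactSupport (HasCompactSupport.of_compactSpace _)]
    exact Finset.sum_eq_zero fun i _ => integral_bochnerAt_eq_zero g _ _ i (hf i) hn hcrit

lemma bochnerFunAt_nonneg (hn : 3 ≤ n) {t : ℝ} (ht : t ≤ -((n : ℝ) / (4 * (n - 1))))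
    (g : Metric n M) (x : M)
    (hpinch : Real.sqrt (normSq₄ (metricAt g x) fun i j k l => weylAt g x i j k l
          - ((n : ℝ) - 4) / (Real.sqrt (2 * n) * ((n : ℝ) - 2)) *
            kulkarniNomizu (tracelessRicciAt g x) (metricAt g x) i j k l)
        < -Real.sqrt (2 / (((n : ℝ) - 1) * ((n : ℝ) - 2))) *
            ((2 * ((n : ℝ) - 2) + 2 * n * ((n : ℝ) - 1) * t) / n + 1) * scalarCurvature g x) :
    0 ≤ bochnerFunAt g t x ∧ (bochnerFunAt g t x = 0 → (localMetric g x).data.tf.map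
      (SmoothFn.ev ⟨coordPoint n x, coordPoint_mem g x⟩) = 0) := by
  refine MetricData.bochnerFun_nonneg (localMetric g x).data
    (SmoothFn.ev ⟨coordPoint n x, coordPoint_mem g x⟩) hn t ht (G := metricAt g x)
    (Ric := Matrix.of (ricciAt g x)) (A := Matrix.of (tracelessRicciAt g x))
    (R := scalarCurvature g x) (Rm := riemannAt g x) ?_ ?_ ?_ ?_ ?_ ?_ hpinch
  · rfl
  · exact (localMetric g x).posDef _ (coordPoint_mem g x)
  · ext i j
    exact ((localMetric g x).isSlice.ricci_eq (coordPoint_mem g x) i j).symm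
  · exact ((localMetric g x).isSlice.scalar_eq (coordPoint_mem g x)).symm
  · exact fun i j k l => ((localMetric g x).isSlice.riemann_eq (coordPoint_mem g x) i j k l).symm
  · exact fun i j => rfl

/-! ### Einstein metrics -/

/-- The hypothesis concerns each point in its own preferred chart. Tensoriality gives vanishing
throughout a fixed chart, where the tensor can be differentiated. -/
lemma tf_eq_zero_of_forall {g : Metric n M} (h : ∀ x, (localMetric g x).data.tf.map
      (SmoothFn.ev ⟨coordPoint n x, coordPoint_mem g x⟩) = 0) (b : M) :
    (localMetric g b).data.tf = 0 := by
  ext1 i j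
  refine SmoothFn.funext fun y => ?_
  have hy : (y : 𝔼) ∈ (chartAt 𝔼 b).target := y.2
  have ho : (y : 𝔼) ∈ overlap (n := n) ((chartAt 𝔼 b).symm y) b :=
    mem_overlap.2 ⟨hy, mem_chart_source _ _⟩
  have h0 : ((transitionChange g ((chartAt 𝔼 b).symm y) b).pull
      (localMetric g ((chartAt 𝔼 b).symm y)).data.tf).map
        (SmoothFn.ev (U := overlap (n := n) ((chartAt 𝔼 b).symm y) b) ⟨y, ho⟩) = 0 := by
    ext p q
    exact (SmoothFn.extFn_of_mem _ (coordPoint_mem g _)).trans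
      (congrFun (congrFun (h ((chartAt 𝔼 b).symm y)) p) q)
  have h1 := ((transitionChange g ((chartAt 𝔼 b).symm y) b).map_tf_eq_zero_iff
    (SmoothFn.ev ⟨y, ho⟩)).2 h0
  have h2 := ((restrictionChange g ((chartAt 𝔼 b).symm y) b).map_tf_eq_zero_iff
    (SmoothFn.ev ⟨y, ho⟩)).1 h1
  rw [← SmoothFn.extFn_apply, Matrix.zero_apply, map_zero]
  exact congrFun (congrFun h2 i) j

/-- Schur's lemma: 0 = div L = (n-2)/(2n) dR, and the coefficient is nonzero for n ≥ 3. -/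
lemma isLocallyConstant_scalarCurvature (hn : 3 ≤ n) {g : Metric n M}
    (h : ∀ b, (localMetric g b).data.tf = 0) : IsLocallyConstant (scalarCurvature g) := by
  refine (IsLocallyConstant.iff_eventually_eq _).2 fun b => ?_
  have hn3 : (3 : ℝ) ≤ n := by exact_mod_cast hn
  have hd : ∀ i, (localMetric g b).data.d i (localMetric g b).data.scal = 0 := fun i => by
    have h1 := (localMetric g b).data.dvgEnd_tf (by omega) i
    have h2 : (localMetric g b).data.dvgEnd (localMetric g b).data.tf i = 0 := by
      rw [h b, MetricData.dvgEnd]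
      simp [MetricData.cov, MetricData.dM]
    rw [h2, ← Algebra.smul_def] at h1
    exact (smul_eq_zero.1 h1.symm).resolve_left (by
      have : (n : ℝ) - 2 ≠ 0 := by linarith
      have : (n : ℝ) ≠ 0 := by linarith
      positivity)
  have hf : ∀ y ∈ (localMetric g b).U,
      fderiv ℝ (SmoothFn.extFn (localMetric g b).data.scal) y = 0 := fun y hy => by
    refine ContinuousLinearMap.coe_injective ?_
    refine (EuclideanSpace.basisFun (Fin n) ℝ).toBasis.ext fun i => ?_
    have h1 : fderiv ℝ (SmoothFn.extFn (localMetric g b).data.scal) y (stdDir n i) = 0 :=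
      (congrArg (SmoothFn.ev ⟨y, hy⟩) (hd i)).trans (map_zero _)
    simpa using h1
  obtain ⟨r, hr, hball⟩ := Metric.isOpen_iff.1 (localMetric g b).U.isOpen _ (coordPoint_mem g b)
  have hcont : ContinuousAt (chartAt 𝔼 b) b := (chartAt 𝔼 b).continuousAt (mem_chart_source _ b)
  filter_upwards [hcont.preimage_mem_nhds (Metric.ball_mem_nhds _ hr),
    (chartAt 𝔼 b).open_source.mem_nhds (mem_chart_source _ b)] with x hx hxs
  rw [scalarCurvature_eq g hxs, scalarCurvature_eq g (mem_chart_source _ b)]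
  exact Metric.isOpen_ball.is_const_of_fderiv_eq_zero (𝕜 := ℝ)
    (convex_ball (coordPoint n b) r).isPreconnected
    (fun y hy => (SmoothFn.differentiableAt_extFn _ ⟨y, hball hy⟩).differentiableWithinAt)
    (fun y hy => hf y (hball hy)) hx (Metric.mem_ball_self hr)

lemma isEinstein_of_tf_eq_zero (hn : 3 ≤ n) {g : Metric n M} (h : ∀ x, (localMetric g x).data.tf.map
      (SmoothFn.ev ⟨coordPoint n x, coordPoint_mem g x⟩) = 0) : IsEinstein g := by
  refine ⟨fun x => scalarCurvature g x / n,
    (isLocallyConstant_scalarCurvature hn (tf_eq_zero_of_forall h)).comp (fun r => r / n),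
    fun x i j => ?_⟩
  have h1 := congrArg (SmoothFn.ev ⟨coordPoint n x, coordPoint_mem g x⟩)
    (congrFun (congrFun (localMetric g x).data.G_mul_tf i) j)
  rw [tf_eq_zero_of_forall h, mul_zero, Matrix.sub_apply, Matrix.smul_apply, smul_eq_mul,
    Matrix.zero_apply, map_zero, map_sub, map_mul, map_mul, AlgHom.commutes] at h1
  have h2 : ricciAt g x i j = SmoothFn.ev ⟨coordPoint n x, coordPoint_mem g x⟩
      ((localMetric g x).data.Ric i j) :=
    (localMetric g x).isSlice.ricci_eq (coordPoint_mem g x) i j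
  have h3 : scalarCurvature g x = SmoothFn.ev ⟨coordPoint n x, coordPoint_mem g x⟩
      (localMetric g x).data.scal := (localMetric g x).isSlice.scalar_eq (coordPoint_mem g x)
  have h4 : metricAt g x i j = SmoothFn.ev ⟨coordPoint n x, coordPoint_mem g x⟩
      ((localMetric g x).data.G i j) := rfl
  rw [← h2, ← h3, ← h4, Algebra.algebraMap_self, RingHom.id_apply] at h1
  linear_combination -h1

end Rigidity
end QuadCurv
end

theorem theorem1p1 {n : ℕ} (hn : 3 ≤ n) {M : Type*} [TopologicalSpace M] [T2Space M]
    [CompactSpace M] [ChartedSpace (EuclideanSpace ℝ (Fin n)) M] [IsManifold (𝓡 n) ∞ M]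
    [MeasurableSpace M] [BorelSpace M] (g : QuadCurv.Metric n M) (t : ℝ)
    (hR : ∀ x, 0 < QuadCurv.scalarCurvature g x)
    (hcrit : QuadCurv.IsCritical t g)
    (ht₃ : n = 3 → t < -(5 / 12)) (ht₄ : n = 4 → t < -(1 / 3))
    (ht₅ : 5 ≤ n → t ≤ -((n : ℝ) / (4 * ((n : ℝ) - 1))))
    (hpinch : ∀ x,
      Real.sqrt (QuadCurv.normSq₄ (QuadCurv.metricAt g x) fun i j k l =>
          QuadCurv.weylAt g x i j k l
            - ((n : ℝ) - 4) / (Real.sqrt (2 * n) * ((n : ℝ) - 2)) *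
              QuadCurv.kulkarniNomizu (QuadCurv.tracelessRicciAt g x) (QuadCurv.metricAt g x)
                i j k l)
        < -Real.sqrt (2 / (((n : ℝ) - 1) * ((n : ℝ) - 2))) *
            ((2 * ((n : ℝ) - 2) + 2 * n * ((n : ℝ) - 1) * t) / n + 1) *
            QuadCurv.scalarCurvature g x) :
    QuadCurv.IsEinstein g := by
  have hn3 : (3 : ℝ) ≤ n := by exact_mod_cast hn
  -- The bound is -3/8 for n = 3 and -1/3 for n = 4, so all three cases imply it.
  have ht : t ≤ -((n : ℝ) / (4 * ((n : ℝ) - 1))) := by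
    rcases (by omega : n = 3 ∨ n = 4 ∨ 5 ≤ n) with h | h | h
    · have := ht₃ h
      subst h
      norm_num at this ⊢
      linarith
    · have := ht₄ h
      subst h
      norm_num at this ⊢
      linarith
    · exact ht₅ h
  have hnn := fun x => QuadCurv.bochnerFunAt_nonneg hn ht g x (hpinch x)
  obtain ⟨hc, hint⟩ := QuadCurv.integral_bochnerFunAt (by omega) hcrit
  have hfin : IsFiniteMeasure (QuadCurv.riemannianVolume g) :=
    ⟨by rw [hcrit.1]; exact ENNReal.one_lt_top⟩
  have hpos := QuadCurv.isOpenPosMeasure_riemannianVolume g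
  -- A continuous nonnegative function with integral zero vanishes everywhere, and the Bochner
  -- integrand vanishes only where L does.
  have hzero := Measure.eq_of_ae_eq ((integral_eq_zero_iff_of_nonneg (fun x => (hnn x).1)
    (hc.integrable_of_hasCompactSupport (HasCompactSupport.of_compactSpace _))).1 hint)
    hc continuous_const
  exact QuadCurv.isEinstein_of_tf_eq_zero hn fun x => (hnn x).2 (congrFun hzero x)
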